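/- **Structures, sets, tuples.** Let $\tau$ be a finite relational signature and $\mathcal K$ a class of finite $\tau$-structures (whose universes are finite subsets of some fixed set of atoms). For a finite structure $\mathfrak A$ with universe $A$, let $\mathrm{HF}(A)$ be the collection of hereditarily finite sets over the atoms $A$ (including the atoms, which have no elements), and let $\mathrm{TC}(a)$ be the transitive closure of $a$. Maps of atoms act on $\mathrm{HF}(A)$ elementwise. $A^*$ denotes the set of tuples of pairwise distinct atoms; a tuple $\bar a=(a_0,\dots,a_{k-1})$ is encoded in $\mathrm{HF}(A)$ as the set of Kuratowski pairs $(i,a_i)$, $i<k$, with $i$ a von Neumann ordinal. $\mathrm{Aut}(\mathfrak A,\bar c)$ is the group of automorphisms of $\mathfrak A$ fixing every $\mathrm{HF}(A)$-set of $\bar c$; a $1$-orbit of $(\mathfrak A,\bar a)$ is an orbit of $\mathrm{Aut}(\mathfrak A,\bar a)$ on $A$; $(\mathfrak A,\bar a)\cong(\mathfrak B,\bar b)$ means that some isomorphism $\mathfrak A\to\mathfrak B$ sends $\bar a$ to $\bar b$ entrywise. **The logic CPT+WSC.** BGS+WSC-terms are built from variables, $\emptyset$, $\mathsf{Atoms}$,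 $\mathsf{Pair}(s,t)=\{s,t\}$, $\mathsf{Union}(s)$, $\mathsf{Unique}(s)$ (the element of a singleton, otherwise $\emptyset$), $\mathsf{Card}(s)$ (as a von Neumann ordinal; $\emptyset$ for atoms), comprehension terms $\{s : y\in t,\Phi\}$ and iteration terms $s[y]^*$. Formulas are built from $R(t_1,\dots,t_k)$ with $R\in\tau$, from $t_1=t_2$, Boolean connectives, and fixed-point operators $\mathsf{WSC}^*xy.(s_{\rm step},s_{\rm choice},s_{\rm wit},\Phi_{\rm out})$, where $x$ is bound in all four components and $y$ only in $s_{\rm step}$ and $s_{\rm wit}$. A CPT+WSC-term (formula) is a pair of a BGS+WSC-term (formula) and a polynomial $p$. It is evaluated in $\mathrm{HF}(A)$ with the bound $N=p(|A|)$ imposed on all its subterms and subformulas; an evaluation may give the error value $\dagger$, which is propagated by everything that evaluates it. * $s[y]^*$ computes $a_0=\emptyset$, $a_{i+1}=s(a_i)$ and has as value the first $a_\ell$ with $a_{\ell+1}=a_\ell$, provided that $\ell\le N$ and $|\mathrm{TC}(a_i)|\le N$ for all $i\le \ell$; as soon as the bound is violated, the value is $\emptyset$. * For a WSC-operator with values $\bar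 c$ of its free variables, a computation is a sequence $b_1=\emptyset,b_2,\dots$ with $b_{i+1}=s_{\rm step}(b_i,e)$ for some $e\in s_{\rm choice}(b_i)$ ($e=\emptyset$ if $s_{\rm choice}(b_i)$ has no elements), ending with $b_n$ when $b_n=b_{n-1}$ for the first time. If some computation meets $\dagger$, has more than $N$ stages, or has a stage with $|\mathrm{TC}(b_i)|>N$, the value is $\dagger$. It is also $\dagger$ unless every completed computation is witnessed: for every $i<n$, $s_{\rm wit}(b_n,b_i)$ (that is, $x=b_n$, $y=b_i$) is a set of graphs (sets of Kuratowski pairs) of automorphisms in $\mathrm{Aut}(\mathfrak A,\bar c,b_1,\dots,b_i)$ containing, for all $u,v\in s_{\rm choice}(b_i)$, one that maps $u$ to $v$. Otherwise the operator is true iff $\Phi_{\rm out}(b_n)$ is true for all final stages $b_n$ of computations, with value $\dagger$ if $\Phi_{\rm out}$ gives $\dagger$ for one of them. **Ready for individualization.** $\mathcal K$ is ready for individualization in CPT+WSC if there is a CPT+WSC-term $s(\iota)$ such that for all $\mathfrak A\in\mathcal K$ and $\bar a\in A^*$ the value $s^{\mathfrak A}(\bar a)$ is not $\dagger$ and is a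 $1$-orbit $O$ of $(\mathfrak A,\bar a)$, and such that $O$ is disjoint from $\bar a$ if some $1$-orbit of $(\mathfrak A,\bar a)$ is disjoint from $\bar a$. **Canonization.** A CPT+WSC$[\tau,\sigma]$-interpretation $\Theta(\iota)$ consists of a CPT+WSC-term $s(\iota)$ and, for each $k$-ary $R\in\sigma$, a CPT+WSC-formula $\Phi_R(\iota,y_1,\dots,y_k)$; $\Theta(\mathfrak A,\bar a)$ is the $\sigma$-structure with universe $B=s^{\mathfrak A}(\bar a)$ and relations $\{\bar b\in B^k : \Phi_R^{\mathfrak A}(\bar a,\bar b)\}$. CPT+WSC defines a canonization for $\mathcal K$ if there is a CPT+WSC$[\tau,\tau\uplus\{\le\}]$-interpretation $\Theta(\iota)$ such that, for all $\mathfrak A,\mathfrak B\in\mathcal K$, $\bar a\in A^*$ and $\bar b\in B^*$, 0. $\dagger$ does not occur in the evaluation of $\Theta(\mathfrak A,\bar a)$ (for $s$ on $\bar a$, and for the formulas $\Phi_R$ on $\bar a$ and tuples of elements of the universe); 1. $\le$ is a total order on the universe of $\Theta(\mathfrak A,\bar a)$; 2. $(\mathfrak A,\bar a)\cong\Theta(\mathfrak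 A,\bar a){\restriction}\tau$, in the sense that there is an isomorphism from $\mathfrak A$ to $\Theta(\mathfrak A,\bar a){\restriction}\tau$ that sends $a_0,\dots,a_{k-1}$, in this order, to the first $k$ elements with respect to $\le$; 3. $\Theta(\mathfrak A,\bar a)=\Theta(\mathfrak B,\bar b)$ (equality of structures, not isomorphism) if and only if $(\mathfrak A,\bar a)\cong(\mathfrak B,\bar b)$. **Lemma.** If a class $\mathcal K$ of finite $\tau$-structures is ready for individualization in CPT+WSC, then CPT+WSC defines a canonization for $\mathcal K$. -/

import Mathlib

open FirstOrder

/-! ## Hereditarily finite sets over a set of atoms -/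

/-- The hereditarily finite sets over the atoms `α` (atoms themselves included): Mathlib's
ZFA-style hereditarily finite lists modulo extensional equality. -/
abbrev HF (α : Type*) : Type _ := Finsets α

namespace HF

variable {α β : Type*}

/-- The class of a hereditarily finite list. -/
def mk (l : Lists α) : HF α := Quotient.mk Lists.instSetoidLists l

theorem exists_mk (x : HF α) : ∃ l, mk l = x := Quotient.exists_rep x

/-- A representative of a hereditarily finite set. -/
noncomputable def rep (x : HF α) : Lists α := (exists_mk x).choose

theorem mk_rep (x : HF α) : mk (rep x) = x := (exists_mk x).choose_spec

theorem mk_eq_mk {l l' : Lists α} : mk l = mk l' ↔ Lists.Equiv l l' :=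
  ⟨fun h => Quotient.exact h, fun h => Quotient.sound h⟩

/-- An atom, as an element of `HF α`. -/
def atom (a : α) : HF α := mk (Lists.atom a)

theorem lists_mem_congr_left {a a' l : Lists α} (h : Lists.Equiv a a') : a ∈ l ↔ a' ∈ l := by
  rcases l with ⟨_ | _, l⟩
  · exact Iff.rfl
  · exact Lists'.mem_equiv_left h

theorem lists_mem_congr_right {a l l' : Lists α} (h : Lists.Equiv l l') : a ∈ l ↔ a ∈ l' := by
  cases h with
  | refl => exact Iff.rfl
  | antisymm h₁ h₂ => exact ⟨Lists'.mem_of_subset h₁, Lists'.mem_of_subset h₂⟩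

/-- Membership in hereditarily finite sets; atoms have no elements. -/
def Mem (x y : HF α) : Prop :=
  Quotient.liftOn₂ x y (fun a l : Lists α => a ∈ l) (fun _ _ _ _ h₁ h₂ =>
    propext ((lists_mem_congr_left h₁).trans (lists_mem_congr_right h₂)))

instance : Membership (HF α) (HF α) := ⟨fun y x => Mem x y⟩

theorem mk_mem_mk {a l : Lists α} : mk a ∈ mk l ↔ a ∈ l := Iff.rfl

theorem not_mem_atom (x : HF α) (a : α) : ¬ x ∈ atom a := by
  obtain ⟨l, rfl⟩ := exists_mk x
  exact fun h => h

theorem not_mem_empty (x : HF α) : ¬ x ∈ (∅ : HF α) := by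
  obtain ⟨l, rfl⟩ := exists_mk x
  rintro ⟨_, h, _⟩
  simp at h

/-- Extensionality for sets, that is, for elements of `HF α` which are not atoms. -/
theorem ext {x y : HF α} (hx : ∀ a, x ≠ atom a) (hy : ∀ a, y ≠ atom a)
    (h : ∀ z, z ∈ x ↔ z ∈ y) : x = y := by
  obtain ⟨⟨_ | _, l⟩, rfl⟩ := exists_mk x
  · cases l with
    | atom a => exact absurd rfl (hx a)
  obtain ⟨⟨_ | _, l'⟩, rfl⟩ := exists_mk y
  · cases l' with
    | atom a => exact absurd rfl (hy a)
  refine mk_eq_mk.2 (Lists.Equiv.antisymm ?_ ?_) <;> refine Lists'.subset_def.2 fun a ha => ?_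
  · exact (h (mk a)).1 ⟨a, ha, Lists.Equiv.refl _⟩
  · exact (h (mk a)).2 ⟨a, ha, Lists.Equiv.refl _⟩

theorem finite_members (x : HF α) : {y | y ∈ x}.Finite := by
  obtain ⟨l, rfl⟩ := exists_mk x
  refine ((l.toList.map mk).finite_toSet).subset ?_
  intro y hy
  obtain ⟨a, rfl⟩ := exists_mk y
  rcases l with ⟨_ | _, l⟩
  · exact False.elim hy
  · obtain ⟨a', h1, h2⟩ := hy
    exact List.mem_map.2 ⟨a', h1, (mk_eq_mk.2 h2).symm⟩

open Classical in
/-- The hereditarily finite set whose elements are exactly the elements of the finite set `S`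
(and `∅` if `S` is infinite, a case which never arises over finitely many atoms). -/
noncomputable def ofSet (S : Set (HF α)) : HF α :=
  if h : S.Finite then mk (Lists.ofList (h.toFinset.toList.map rep)) else ∅

theorem mem_ofSet {S : Set (HF α)} (h : S.Finite) {x : HF α} : x ∈ ofSet S ↔ x ∈ S := by
  rw [ofSet, dif_pos h]
  obtain ⟨a, rfl⟩ := exists_mk x
  constructor
  · rintro ⟨a', h1, h2⟩
    rw [Lists'.to_ofList, List.mem_map] at h1
    obtain ⟨z, hz, rfl⟩ := h1
    rw [(mk_eq_mk.2 h2).trans (mk_rep z)]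
    simpa using hz
  · intro hx
    refine ⟨rep (mk a), ?_, mk_eq_mk.1 (mk_rep (mk a)).symm⟩
    rw [Lists'.to_ofList, List.mem_map]
    exact ⟨mk a, by simpa using hx, rfl⟩

/-- Renaming of atoms in lists. -/
def mapLists' (f : α → β) : ∀ {b}, Lists' α b → Lists' β b
  | _, Lists'.atom a => Lists'.atom (f a)
  | _, Lists'.nil => Lists'.nil
  | _, Lists'.cons' a l => Lists'.cons' (mapLists' f a) (mapLists' f l)

/-- Renaming of atoms in lists. -/
def mapLists (f : α → β) (l : Lists α) : Lists β := ⟨l.1, mapLists' f l.2⟩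

theorem toList_mapLists' (f : α → β) : ∀ {b} (l : Lists' α b),
    (mapLists' f l).toList = l.toList.map (mapLists f)
  | _, Lists'.atom _ => rfl
  | _, Lists'.nil => rfl
  | _, Lists'.cons' a l => by
    simp only [mapLists', Lists'.toList]
    rw [toList_mapLists' f l]
    rfl

mutual

theorem mapLists_equiv (f : α → β) : ∀ {a a' : Lists α}, Lists.Equiv a a' →
    Lists.Equiv (mapLists f a) (mapLists f a')
  | _, _, Lists.Equiv.refl _ => Lists.Equiv.refl _
  | _, _, Lists.Equiv.antisymm h₁ h₂ =>
    Lists.Equiv.antisymm (mapLists'_subset f h₁) (mapLists'_subset f h₂)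

theorem mapLists'_subset (f : α → β) : ∀ {l l' : Lists' α true}, Lists'.Subset l l' →
    Lists'.Subset (mapLists' f l) (mapLists' f l')
  | _, _, Lists'.Subset.nil => Lists'.Subset.nil
  | _, _, Lists'.Subset.cons (a := a) (a' := a') (l := l) (l' := l') h₁ h₂ h₃ =>
    Lists'.Subset.cons (a := mapLists f a) (a' := mapLists f a') (l := mapLists' f l)
      (mapLists_equiv f h₁)
      (by rw [toList_mapLists']; exact List.mem_map_of_mem h₂) (mapLists'_subset f h₃)

end

/-- The extension of a map of atoms to hereditarily finite sets. -/
def map (f : α → β) (x : HF α) : HF β :=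
  Quotient.liftOn x (fun l => mk (mapLists f l)) (fun _ _ h => mk_eq_mk.2 (mapLists_equiv f h))

/-- The unordered pair `{a, b}`. -/
noncomputable def pair (a b : HF α) : HF α := ofSet {a, b}

/-- The Kuratowski pair `{{a}, {a, b}}`. -/
noncomputable def kpair (a b : HF α) : HF α := pair (pair a a) (pair a b)

/-- The union `{b | ∃ c ∈ a, b ∈ c}`. -/
noncomputable def sUnion (a : HF α) : HF α := ofSet {b | ∃ c, c ∈ a ∧ b ∈ c}

open Classical in
/-- `unique {b} = b`, and `unique a = ∅` if `a` is not a singleton. -/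
noncomputable def unique (a : HF α) : HF α :=
  if h : ∃ b, a = ofSet {b} then h.choose else ∅

/-- Von Neumann ordinals. -/
noncomputable def ofNat : ℕ → HF α
  | 0 => ∅
  | n + 1 => ofSet (insert (ofNat n) {y | y ∈ ofNat n})

/-- The cardinality of a set as a von Neumann ordinal; atoms are sent to `∅`. -/
noncomputable def card (a : HF α) : HF α := ofNat {y | y ∈ a}.ncard

/-- The transitive closure of `a`, as the set of its elements. -/
def tc (a : HF α) : Set (HF α) := {b | Relation.TransGen (fun x y : HF α => x ∈ y) b a}

/-- `|TC(a)| ≤ N`. -/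
def Small (N : ℕ) (a : HF α) : Prop := (tc a).encard ≤ (N : ℕ∞)

/-- A tuple of atoms, encoded as the function `{(i, aᵢ) | i < k}`. -/
noncomputable def ofTuple (a : List α) : HF α :=
  ofSet {x | ∃ i : Fin a.length, x = kpair (ofNat i) (atom (a.get i))}

end HF

/-! ## Automorphisms and orbits -/

section Orbits

variable (L : Language) {α : Type*} [L.Structure α]

/-- The automorphisms of a structure stabilizing every hereditarily finite set in `P`. -/
def HF.stab (P : Set (HF α)) : Set (α ≃[L] α) := {φ | ∀ a ∈ P, HF.map φ a = a}

variable {L} in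
/-- An automorphism as a hereditarily finite set: its graph, as a set of Kuratowski pairs. -/
noncomputable def HF.graph (φ : α ≃[L] α) : HF α :=
  HF.ofSet (Set.range fun u => HF.kpair (HF.atom u) (HF.atom (φ u)))

/-- The set `M` witnesses `Y` as an orbit of the structure with the sets in `P` fixed. -/
def HF.WitnessesOrbit (P : Set (HF α)) (M Y : HF α) : Prop :=
  (∀ m ∈ M, ∃ φ ∈ HF.stab L P, m = HF.graph φ) ∧
  ∀ b ∈ Y, ∀ c ∈ Y, ∃ φ ∈ HF.stab L P, HF.graph φ ∈ M ∧ HF.map φ b = c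

end Orbits

/-! ## Syntax of BGS+WSC -/

namespace BGS

mutual

/-- Terms of BGS+WSC over the relational signature `L`; variables are natural numbers. -/
inductive Term (L : Language) where
  | var (x : ℕ)
  | empty
  | atoms
  | pair (s t : Term L)
  | union (s : Term L)
  | unique (s : Term L)
  | card (s : Term L)
  /-- The comprehension term `{s | y ∈ t, Φ}`, where `y` is bound in `s` and `Φ`. -/
  | compr (s : Term L) (y : ℕ) (t : Term L) (Φ : Formula L)
  /-- The iteration term `s[y]*`. -/
  | iter (s : Term L) (y : ℕ)

/-- Formulas of BGS+WSC over the relational signature `L`. -/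
inductive Formula (L : Language) where
  | rel {n : ℕ} (R : L.Relations n) (ts : Fin n → Term L)
  | eq (s t : Term L)
  | not (Φ : Formula L)
  | and (Φ Ψ : Formula L)
  /-- The fixed-point operator with witnessed symmetric choice
  `WSC* x y. (step, choice, wit, out)`: `x` is bound in all four components,
  `y` in `step` and `wit` only. -/
  | wsc (x y : ℕ) (step choice wit : Term L) (out : Formula L)

end

variable {L : Language}

mutual

/-- Free variables of a term. -/
def Term.fv : Term L → Set ℕ
  | .var x => {x}
  | .empty => ∅
  | .atoms => ∅
  | .pair s t => s.fv ∪ t.fv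
  | .union s => s.fv
  | .unique s => s.fv
  | .card s => s.fv
  | .compr s y t Φ => (s.fv \ {y}) ∪ t.fv ∪ (Φ.fv \ {y})
  | .iter s y => s.fv \ {y}

/-- Free variables of a formula. -/
def Formula.fv : Formula L → Set ℕ
  | .rel _ ts => ⋃ i, (ts i).fv
  | .eq s t => s.fv ∪ t.fv
  | .not Φ => Φ.fv
  | .and Φ Ψ => Φ.fv ∪ Ψ.fv
  | .wsc x y step choice wit out =>
    (step.fv \ {x, y}) ∪ (choice.fv \ {x}) ∪ (wit.fv \ {x, y}) ∪ (out.fv \ {x})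

end

/-! ## Semantics

Denotations are `Option`-valued: `none` is the error marker `†`, which is propagated by every
construct that evaluates a subexpression with value `†`. All iterations are subject to a
bound `N`. -/

section Semantics

variable {α : Type}

open Classical in
/-- Iteration of `f` from the current stage `a`, with at most `r` further stages allowed. The
result is the first fixed point, or `∅` if a stage is too large or the stages are used up. -/
noncomputable def iterate (N : ℕ) (f : HF α → Option (HF α)) : ℕ → HF α → Option (HF α)
  | 0, a => if HF.Small N a then (f a).map fun b => if b = a then a else ∅ else some ∅
  | r + 1, a =>
    if HF.Small N a then (f a).bind fun b => if b = a then some a else iterate N f r b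
    else some ∅

/-- The possible values of the choice variable for the choice set `Y`: an element of `Y`, or `∅`
if there is nothing to choose from. -/
def IsChoice (Y e : HF α) : Prop := e ∈ Y ∨ ((∀ x, ¬ x ∈ Y) ∧ e = ∅)

/-- The initial segments `(b₁, …, bₖ)` of computations of a fixed-point operator with choice,
listed in reverse order: `b₁ = ∅`, every stage arises from the preceding one by the step function
for some choice, and the computation stops when a stage is repeated for the first time. -/
inductive Run (step : HF α → HF α → Option (HF α)) (choice : HF α → Option (HF α)) :
    List (HF α) → Prop
  | root : Run step choice [∅]
  | next {b : HF α} {l : List (HF α)} {Y e d : HF α} : Run step choice (b :: l) →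
      l.head? ≠ some b → choice b = some Y → IsChoice Y e → step b e = some d →
      Run step choice (d :: b :: l)

variable (L) [L.Structure α]

/-- The computation with stages `l` (in reverse order, the repetition of the fixed point `c`
omitted) is witnessed: for every stage `b`, the set `wit c b` witnesses `choice b` as an orbit of
the structure with the parameters `P` and all the stages up to `b` fixed. -/
def Witnessed (P : Set (HF α)) (choice : HF α → Option (HF α))
    (wit : HF α → HF α → Option (HF α)) (c : HF α) (l : List (HF α)) : Prop :=
  ∀ b l', (b :: l') <:+ l → ∃ M Y, wit c b = some M ∧ choice b = some Y ∧
    HF.WitnessesOrbit L (P ∪ {x | x ∈ b :: l'}) M Y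

/-- The evaluation of a fixed-point operator with choice fails: an error occurs in a step,
a computation exceeds the bound `N` (in length or in the size of a stage), or a computation
reaching a fixed point is not witnessed. -/
def WscFails (N : ℕ) (P : Set (HF α)) (step : HF α → HF α → Option (HF α))
    (choice : HF α → Option (HF α)) (wit : HF α → HF α → Option (HF α)) : Prop :=
  (∃ b l, Run step choice (b :: l) ∧ l.head? ≠ some b ∧
    (choice b = none ∨ ∃ Y e, choice b = some Y ∧ IsChoice Y e ∧ step b e = none)) ∨
  (∃ l, Run step choice l ∧ (N < l.length ∨ ∃ b ∈ l, ¬ HF.Small N b)) ∨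
  (∃ c l, Run step choice (c :: c :: l) ∧ ¬ Witnessed L P choice wit c (c :: l))

open Classical in
/-- The value of a fixed-point operator with choice: the output formula has to hold for every
fixed point that is reached. -/
noncomputable def wscEval (N : ℕ) (P : Set (HF α)) (step : HF α → HF α → Option (HF α))
    (choice : HF α → Option (HF α)) (wit : HF α → HF α → Option (HF α))
    (out : HF α → Option Prop) : Option Prop :=
  if WscFails L N P step choice wit ∨ ∃ c l, Run step choice (c :: c :: l) ∧ out c = none then none
  else some (∀ c l, Run step choice (c :: c :: l) → ∃ p, out c = some p ∧ p)

variable {L}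

open Classical in
/-- The value of the comprehension `{s b | b ∈ t, Φ b}`. -/
noncomputable def comprEval (t : HF α) (Φ : HF α → Option Prop) (s : HF α → Option (HF α)) :
    Option (HF α) :=
  if ∃ b ∈ t, Φ b = none ∨ ((∃ p, Φ b = some p ∧ p) ∧ s b = none) then none
  else some (HF.ofSet {c | ∃ b ∈ t, (∃ p, Φ b = some p ∧ p) ∧ s b = some c})

open Classical in
/-- The value of an atomic formula `R(t₁, …, tₙ)`. -/
noncomputable def relEval {n : ℕ} (R : L.Relations n) (v : Fin n → Option (HF α)) : Option Prop :=
  if ∃ i, v i = none then none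
  else some (∃ a : Fin n → α, (∀ i, v i = some (HF.atom (a i))) ∧ Language.Structure.RelMap R a)

mutual

/-- The denotation of a term under the bound `N` and the valuation `ρ` of the variables. -/
noncomputable def Term.eval (N : ℕ) : Term L → (ℕ → HF α) → Option (HF α)
  | .var x, ρ => some (ρ x)
  | .empty, _ => some ∅
  | .atoms, _ => some (HF.ofSet (Set.range HF.atom))
  | .pair s t, ρ => (s.eval N ρ).bind fun a => (t.eval N ρ).map fun b => HF.pair a b
  | .union s, ρ => (s.eval N ρ).map HF.sUnion
  | .unique s, ρ => (s.eval N ρ).map HF.unique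
  | .card s, ρ => (s.eval N ρ).map HF.card
  | .compr s y t Φ, ρ => (t.eval N ρ).bind fun a =>
      comprEval a (fun b => Φ.eval N (Function.update ρ y b))
        (fun b => s.eval N (Function.update ρ y b))
  | .iter s y, ρ => iterate N (fun a => s.eval N (Function.update ρ y a)) N ∅

/-- The denotation of a formula under the bound `N` and the valuation `ρ` of the variables. -/
noncomputable def Formula.eval (N : ℕ) : Formula L → (ℕ → HF α) → Option Prop
  | .rel R ts, ρ => relEval R fun i => (ts i).eval N ρ
  | .eq s t, ρ => (s.eval N ρ).bind fun a => (t.eval N ρ).map fun b => a = b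
  | .not Φ, ρ => (Φ.eval N ρ).map fun p => ¬ p
  | .and Φ Ψ, ρ => (Φ.eval N ρ).bind fun p => (Ψ.eval N ρ).map fun q => p ∧ q
  | .wsc x y step choice wit out, ρ =>
      wscEval L N {a | ∃ z ∈ (Formula.wsc x y step choice wit out).fv, a = ρ z}
        (fun b e => step.eval N (Function.update (Function.update ρ x b) y e))
        (fun b => choice.eval N (Function.update ρ x b))
        (fun c b => wit.eval N (Function.update (Function.update ρ x c) y b))
        (fun c => out.eval N (Function.update ρ x c))

end

end Semantics

end BGS

/-! ## CPT+WSC -/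

namespace CPTWSC

/-- A CPT+WSC-term: a BGS+WSC-term with a polynomial bound. -/
structure Term (L : Language) where
  body : BGS.Term L
  bound : Polynomial ℕ

/-- A CPT+WSC-formula: a BGS+WSC-formula with a polynomial bound. -/
structure Formula (L : Language) where
  body : BGS.Formula L
  bound : Polynomial ℕ

variable {L : Language} {α : Type} [L.Structure α]

/-- The denotation of a CPT+WSC-term; `none` is the error marker `†`. -/
noncomputable def Term.eval (s : Term L) (ρ : ℕ → HF α) : Option (HF α) :=
  s.body.eval (s.bound.eval (Nat.card α)) ρ

/-- The denotation of a CPT+WSC-formula; `none` is the error marker `†`. -/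
noncomputable def Formula.eval (Φ : Formula L) (ρ : ℕ → HF α) : Option Prop :=
  Φ.body.eval (Φ.bound.eval (Nat.card α)) ρ

/-- The valuation assigning `a₀, a₁, …` to the variables `0, 1, …` (and `∅` to all others). -/
def valuation (a : List (HF α)) : ℕ → HF α := fun i => a.getD i ∅

end CPTWSC

/-! ## Finite structures -/

/-- A finite relational `σ`-structure whose universe is a subset of `V`. -/
@[ext]
structure FinStr (σ : Language) (V : Type*) where
  carrier : Set V
  finite : carrier.Finite
  rel : ∀ n, σ.Relations n → Set (Fin n → V)
  rel_subset : ∀ n (R : σ.Relations n), ∀ v ∈ rel n R, ∀ i, v i ∈ carrier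

namespace FinStr

variable {σ τ : Language} {V W : Type*}

/-- A structure, viewed as a first-order structure on its universe. -/
instance [σ.IsRelational] (𝔄 : FinStr σ V) : σ.Structure 𝔄.carrier where
  funMap := fun f => isEmptyElim f
  RelMap := fun {n} R v => (fun i => (v i : V)) ∈ 𝔄.rel n R

/-- The reduct along an inclusion of signatures. -/
def reduct (φ : τ →ᴸ σ) (𝔄 : FinStr σ V) : FinStr τ V where
  carrier := 𝔄.carrier
  finite := 𝔄.finite
  rel := fun _ R => 𝔄.rel _ (φ.onRelation R)
  rel_subset := fun _ R => 𝔄.rel_subset _ (φ.onRelation R)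

variable [σ.IsRelational]

/-- `(𝔄, a) ≅ (𝔅, b)`. -/
def Iso (𝔄 : FinStr σ V) (a : List 𝔄.carrier) (𝔅 : FinStr σ W) (b : List 𝔅.carrier) : Prop :=
  ∃ f : 𝔄.carrier ≃[σ] 𝔅.carrier, a.map f = b

/-- `O` is a `1`-orbit of `(𝔄, a)`. -/
def IsOrbit (𝔄 : FinStr σ V) (a : List 𝔄.carrier) (O : Set 𝔄.carrier) : Prop :=
  ∃ u, O = {w | ∃ φ : 𝔄.carrier ≃[σ] 𝔄.carrier, (∀ x ∈ a, φ x = x) ∧ φ u = w}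

end FinStr

/-! ## Interpretations, individualization and canonization -/

namespace CPTWSC

variable {τ σ : Language} {U : Type}

/-- A CPT+WSC`[τ, σ]`-interpretation `Θ(ι)`: a term `s(ι)` defining the universe and, for every
relation symbol of arity `n`, a formula `Φ(ι, y₁, …, yₙ)`. The parameter `ι` is the variable `0`,
and `yᵢ` is the variable `i`. -/
structure Interpretation (τ σ : Language) where
  univ : Term τ
  univ_fv : univ.body.fv ⊆ {0}
  rel : ∀ n, σ.Relations n → Formula τ
  rel_fv : ∀ n (R : σ.Relations n), (rel n R).body.fv ⊆ {i | i ≤ n}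

namespace Interpretation

variable [τ.IsRelational]

/-- The universe of `Θ(𝔄, a)`, as a set of hereditarily finite sets. -/
def domain (Θ : Interpretation τ σ) (𝔄 : FinStr τ U) (a : List 𝔄.carrier) :
    Set (HF 𝔄.carrier) :=
  {x | ∃ B, Θ.univ.eval (valuation [HF.ofTuple a]) = some B ∧ x ∈ B}

theorem finite_domain (Θ : Interpretation τ σ) (𝔄 : FinStr τ U) (a : List 𝔄.carrier) :
    (Θ.domain 𝔄 a).Finite := by
  rcases h : Θ.univ.eval (valuation [HF.ofTuple a]) with _ | B
  · refine Set.finite_empty.subset ?_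
    rintro x ⟨B, hB, -⟩
    rw [h] at hB
    cases hB
  · refine (HF.finite_members B).subset ?_
    rintro x ⟨B', hB, hx⟩
    rw [h] at hB
    cases hB
    exact hx

/-- No error occurs in the evaluation of `Θ` on `(𝔄, a)`. -/
def Defined (Θ : Interpretation τ σ) (𝔄 : FinStr τ U) (a : List 𝔄.carrier) : Prop :=
  Θ.univ.eval (valuation [HF.ofTuple a]) ≠ none ∧
  ∀ n (R : σ.Relations n) (v : Fin n → HF 𝔄.carrier), (∀ i, v i ∈ Θ.domain 𝔄 a) →
    (Θ.rel n R).eval (valuation (HF.ofTuple a :: List.ofFn v)) ≠ none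

/-- The `σ`-structure `Θ(𝔄, a)`. Its elements are hereditarily finite sets over the atoms of `𝔄`;
they are regarded as hereditarily finite sets over the ambient set `U`, so that structures
interpreted in different structures can be compared. -/
def apply (Θ : Interpretation τ σ) (𝔄 : FinStr τ U) (a : List 𝔄.carrier) : FinStr σ (HF U) where
  carrier := HF.map Subtype.val '' Θ.domain 𝔄 a
  finite := (Θ.finite_domain 𝔄 a).image _
  rel := fun n R => {w | ∃ v : Fin n → HF 𝔄.carrier, (∀ i, v i ∈ Θ.domain 𝔄 a) ∧
    (∃ p, (Θ.rel n R).eval (valuation (HF.ofTuple a :: List.ofFn v)) = some p ∧ p) ∧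
    w = fun i => HF.map Subtype.val (v i)}
  rel_subset := by
    rintro n R w ⟨v, hv, -, rfl⟩ i
    exact ⟨v i, hv i, rfl⟩

end Interpretation

variable [τ.IsRelational]

/-- The class `K` is ready for individualization in CPT+WSC. Tuples of atoms have no
duplicates. -/
def ReadyForIndividualization (K : Set (FinStr τ U)) : Prop :=
  ∃ s : Term τ, s.body.fv ⊆ {0} ∧
    ∀ 𝔄 ∈ K, ∀ a : List 𝔄.carrier, a.Nodup →
      ∃ O : Set 𝔄.carrier, 𝔄.IsOrbit a O ∧
        s.eval (valuation [HF.ofTuple a]) = some (HF.ofSet (HF.atom '' O)) ∧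
        ((∃ O', 𝔄.IsOrbit a O' ∧ Disjoint O' {x | x ∈ a}) → Disjoint O {x | x ∈ a})

/-- CPT+WSC defines a canonization of the class `K`. As the reduct of `Θ(𝔄, a)` to `τ` carries no
tuple, `(𝔄, a) ≅ Θ(𝔄, a)↾τ` means that there is an isomorphism sending `a`, in its order, to an
initial segment with respect to `≤`. -/
def DefinesCanonization (K : Set (FinStr τ U)) : Prop :=
  ∃ Θ : Interpretation τ (τ.sum Language.order),
    (∀ 𝔄 ∈ K, ∀ a : List 𝔄.carrier, a.Nodup → Θ.Defined 𝔄 a) ∧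
    (∀ 𝔄 ∈ K, ∀ a : List 𝔄.carrier, a.Nodup →
      IsLinearOrder (Θ.apply 𝔄 a).carrier fun x y =>
        Language.Structure.RelMap (Language.leSymb : (τ.sum Language.order).Relations 2)
          ![x, y]) ∧
    (∀ 𝔄 ∈ K, ∀ a : List 𝔄.carrier, a.Nodup →
      ∃ f : 𝔄.carrier ≃[τ] ((Θ.apply 𝔄 a).reduct Language.LHom.sumInl).carrier,
        ∀ (i : Fin a.length) (x : 𝔄.carrier),
          ![(f x).1, (f (a.get i)).1] ∈ (Θ.apply 𝔄 a).rel 2 Language.leSymb ↔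
            ∃ j ≤ i, x = a.get j) ∧
    (∀ 𝔄 ∈ K, ∀ 𝔅 ∈ K, ∀ (a : List 𝔄.carrier) (b : List 𝔅.carrier), a.Nodup → b.Nodup →
      (Θ.apply 𝔄 a = Θ.apply 𝔅 b ↔ 𝔄.Iso a 𝔅 b))

end CPTWSC

namespace HF

variable {α β γ : Type*}

/-- Hereditarily finite sets which are not atoms. -/
def IsSet (x : HF α) : Prop := ∀ a, x ≠ atom a

theorem mk_mem_mk_list {a : Lists α} {l : Lists' α true} :
    mk a ∈ mk (⟨true, l⟩ : Lists α) ↔ ∃ a' ∈ l.toList, mk a = mk a' := by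
  constructor
  · rintro ⟨a', h, e⟩
    exact ⟨a', h, mk_eq_mk.2 e⟩
  · rintro ⟨a', h, e⟩
    exact ⟨a', h, mk_eq_mk.1 e⟩

theorem mem_induction {P : HF α → Prop} (h : ∀ x, (∀ y, y ∈ x → P y) → P x) (x : HF α) : P x := by
  obtain ⟨l, rfl⟩ := exists_mk x
  have key := Lists.inductionMut (α := α) (fun l => P (mk l)) (fun l => ∀ a ∈ l.toList, P (mk a))
    (fun a => h _ fun y hy => absurd hy (not_mem_atom y a))
    (fun l ih => h _ fun y hy => by
      obtain ⟨b, rfl⟩ := exists_mk y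
      obtain ⟨a', h1, h2⟩ := mk_mem_mk_list.1 hy
      rw [h2]
      exact ih a' h1)
    (by simp)
    (fun a l ha hl b hb => by
      rw [Lists'.toList_cons, List.mem_cons] at hb
      rcases hb with rfl | hb
      · exact ha
      · exact hl b hb)
  exact key.1 l

theorem not_mem_self (x : HF α) : ¬ x ∈ x := by
  induction x using mem_induction with
  | h x ih => exact fun hx => ih x hx hx

theorem atom_injective : Function.Injective (atom : α → HF α) := by
  intro a b h
  have h' := Lists.equiv_atom.1 (mk_eq_mk.1 h)
  cases h'
  rfl

theorem isSet_mk {l : Lists' α true} : IsSet (mk (⟨true, l⟩ : Lists α)) := by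
  intro a h
  have h' := Lists.equiv_atom.1 (mk_eq_mk.1 h.symm)
  cases h'

theorem isSet_empty : IsSet (∅ : HF α) := isSet_mk

theorem isSet_ofSet (S : Set (HF α)) : IsSet (ofSet S) := by
  unfold ofSet
  split_ifs
  · exact isSet_mk
  · exact isSet_empty

theorem isSet_of_mem {x y : HF α} (h : x ∈ y) : IsSet y := by
  rintro a rfl
  exact not_mem_atom x a h

theorem isSet_or_atom (x : HF α) : IsSet x ∨ ∃ a, x = atom a := by
  by_cases h : IsSet x
  · exact Or.inl h
  · right
    simpa [IsSet] using h

theorem IsSet.ext {x y : HF α} (hx : IsSet x) (hy : IsSet y) (h : ∀ z, z ∈ x ↔ z ∈ y) : x = y :=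
  HF.ext hx hy h

theorem eq_empty {x : HF α} (hx : IsSet x) (h : ∀ z, ¬ z ∈ x) : x = ∅ :=
  hx.ext isSet_empty fun z => iff_of_false (h z) (not_mem_empty z)

theorem ofSet_empty : ofSet (∅ : Set (HF α)) = ∅ :=
  eq_empty (isSet_ofSet _) fun z => by simp [mem_ofSet Set.finite_empty]

theorem ofSet_injOn {S T : Set (HF α)} (hS : S.Finite) (hT : T.Finite) (h : ofSet S = ofSet T) :
    S = T := by
  ext z
  rw [← mem_ofSet hS, h, mem_ofSet hT]

theorem isSet_pair (a b : HF α) : IsSet (pair a b) := isSet_ofSet _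

theorem isSet_sUnion (a : HF α) : IsSet (sUnion a) := isSet_ofSet _

@[simp]
theorem mem_pair {a b x : HF α} : x ∈ pair a b ↔ x = a ∨ x = b := by
  rw [pair, mem_ofSet (by simp)]
  simp

theorem mem_kpair {a b x : HF α} : x ∈ kpair a b ↔ x = pair a a ∨ x = pair a b := mem_pair

theorem finite_sUnion_set (a : HF α) : {b | ∃ c, c ∈ a ∧ b ∈ c}.Finite := by
  have : {b | ∃ c, c ∈ a ∧ b ∈ c} = ⋃ c ∈ {c | c ∈ a}, {b | b ∈ c} := by
    ext b; simp
  rw [this]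
  exact (finite_members a).biUnion fun c _ => finite_members c

@[simp]
theorem mem_sUnion {a x : HF α} : x ∈ sUnion a ↔ ∃ c, c ∈ a ∧ x ∈ c :=
  mem_ofSet (finite_sUnion_set a)

theorem pair_eq_singleton {a b c : HF α} (h : pair a b = pair c c) : a = c ∧ b = c := by
  have h1 : a ∈ pair c c := h ▸ mem_pair.2 (Or.inl rfl)
  have h2 : b ∈ pair c c := h ▸ mem_pair.2 (Or.inr rfl)
  exact ⟨by simpa using h1, by simpa using h2⟩

theorem pair_right_cancel {a b c : HF α} (h : pair a b = pair a c) : b = c := by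
  have h1 : b ∈ pair a c := h ▸ mem_pair.2 (Or.inr rfl)
  have h2 : c ∈ pair a b := h ▸ mem_pair.2 (Or.inr rfl)
  rcases mem_pair.1 h1 with rfl | h1
  · rcases mem_pair.1 h2 with h2 | h2 <;> exact h2.symm
  · exact h1

theorem kpair_inj {a b c d : HF α} : kpair a b = kpair c d ↔ a = c ∧ b = d := by
  refine ⟨fun h => ?_, by rintro ⟨rfl, rfl⟩; rfl⟩
  have hac : a = c := by
    have h1 : pair a a ∈ kpair c d := h ▸ mem_kpair.2 (Or.inl rfl)
    rcases mem_kpair.1 h1 with h1 | h1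
    · exact (pair_eq_singleton h1).1
    · exact (pair_eq_singleton h1.symm).1.symm
  subst hac
  exact ⟨rfl, pair_right_cancel (pair_right_cancel h)⟩

theorem unique_eq {a b : HF α} (ha : IsSet a) (h : ∀ z, z ∈ a ↔ z = b) : unique a = b := by
  have hab : a = ofSet {b} :=
    ha.ext (isSet_ofSet _) fun z => by rw [h, mem_ofSet (Set.finite_singleton b)]; rfl
  have hex : ∃ b, a = ofSet {b} := ⟨b, hab⟩
  rw [unique, dif_pos hex]
  have h2 := hex.choose_spec
  have h3 := ofSet_injOn (Set.finite_singleton _) (Set.finite_singleton _) (hab.symm.trans h2)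
  exact (Set.singleton_injective h3).symm

theorem unique_eq_empty {a : HF α} (h : ¬ ∃ b, a = ofSet {b}) : unique a = ∅ := by
  rw [unique, dif_neg h]

theorem unique_empty : unique (∅ : HF α) = ∅ := by
  apply unique_eq_empty
  rintro ⟨b, hb⟩
  exact not_mem_empty b (hb ▸ (mem_ofSet (Set.finite_singleton b)).2 rfl)

theorem unique_ofSet_singleton (b : HF α) : unique (ofSet {b}) = b :=
  unique_eq (isSet_ofSet _) fun _ => mem_ofSet (Set.finite_singleton b)

@[simp]
theorem unique_pair_self (b : HF α) : unique (pair b b) = b :=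
  unique_eq (isSet_pair _ _) fun _ => by simp

theorem isSet_ofNat : ∀ n, IsSet (ofNat n : HF α)
  | 0 => by rw [ofNat]; exact isSet_empty
  | n + 1 => by rw [ofNat]; exact isSet_ofSet _

theorem mem_ofNat_succ {n : ℕ} {x : HF α} : x ∈ ofNat (n + 1) ↔ x = ofNat n ∨ x ∈ ofNat n := by
  rw [ofNat, mem_ofSet ((finite_members _).insert _)]
  rfl

theorem mem_ofNat {n : ℕ} {x : HF α} : x ∈ ofNat n ↔ ∃ m < n, x = ofNat m := by
  induction n with
  | zero => simp [ofNat, not_mem_empty]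
  | succ n ih =>
    rw [mem_ofNat_succ, ih]
    constructor
    · rintro (rfl | ⟨m, hm, rfl⟩)
      · exact ⟨n, by omega, rfl⟩
      · exact ⟨m, by omega, rfl⟩
    · rintro ⟨m, hm, rfl⟩
      rcases Nat.lt_succ_iff_lt_or_eq.1 hm with h | rfl
      · exact Or.inr ⟨m, h, rfl⟩
      · exact Or.inl rfl

theorem ofNat_mem_of_lt {m n : ℕ} (h : m < n) : (ofNat m : HF α) ∈ ofNat n := mem_ofNat.2 ⟨m, h, rfl⟩

theorem ofNat_injective : Function.Injective (ofNat : ℕ → HF α) := by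
  intro m n h
  rcases lt_trichotomy m n with h' | h' | h'
  · have h1 : (ofNat m : HF α) ∈ ofNat n := ofNat_mem_of_lt h'
    rw [h] at h1
    exact absurd h1 (not_mem_self _)
  · exact h'
  · have h1 : (ofNat n : HF α) ∈ ofNat m := ofNat_mem_of_lt h'
    rw [h] at h1
    exact absurd h1 (not_mem_self _)

@[simp]
theorem ofNat_inj {m n : ℕ} : (ofNat m : HF α) = ofNat n ↔ m = n := ofNat_injective.eq_iff

@[simp]
theorem ofNat_mem_ofNat {m n : ℕ} : (ofNat m : HF α) ∈ ofNat n ↔ m < n := by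
  rw [mem_ofNat]
  constructor
  · rintro ⟨k, hk, h⟩
    rwa [ofNat_inj.1 h]
  · exact fun h => ⟨m, h, rfl⟩

theorem card_ofSet {S : Set (HF α)} (h : S.Finite) : card (ofSet S) = ofNat S.ncard := by
  rw [card]
  congr 2
  ext z
  exact mem_ofSet h

theorem card_eq_empty_iff {a : HF α} : card a = ∅ ↔ ∀ z, ¬ z ∈ a := by
  rw [card, show (∅ : HF α) = ofNat 0 by rw [ofNat], ofNat_inj, Set.ncard_eq_zero (finite_members a),
    Set.eq_empty_iff_forall_notMem]
  rfl

/-! ### Renaming of atoms -/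

@[simp]
theorem map_mk (f : α → β) (l : Lists α) : map f (mk l) = mk (mapLists f l) := rfl

@[simp]
theorem map_atom (f : α → β) (a : α) : map f (atom a) = atom (f a) := rfl

theorem isSet_map {f : α → β} {x : HF α} : IsSet (map f x) ↔ IsSet x := by
  obtain ⟨⟨_ | _, l⟩, rfl⟩ := exists_mk x
  · cases l with
    | atom a => exact iff_of_false (fun h => h (f a) rfl) (fun h => h a rfl)
  · exact iff_of_true isSet_mk isSet_mk

theorem mem_map {f : α → β} {x : HF α} {y : HF β} : y ∈ map f x ↔ ∃ z, z ∈ x ∧ y = map f z := by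
  obtain ⟨⟨_ | _, l⟩, rfl⟩ := exists_mk x
  · cases l with
    | atom a => exact iff_of_false (not_mem_atom y (f a)) (fun ⟨z, hz, _⟩ => not_mem_atom z a hz)
  · obtain ⟨b, rfl⟩ := exists_mk y
    have h : mk b ∈ map f (mk (⟨true, l⟩ : Lists α)) ↔
        ∃ a' ∈ (mapLists' f l).toList, mk b = mk a' := mk_mem_mk_list
    rw [toList_mapLists'] at h
    refine h.trans ?_
    constructor
    · rintro ⟨c, hc, e⟩
      obtain ⟨a, ha, rfl⟩ := List.mem_map.1 hc
      exact ⟨mk a, mk_mem_mk_list.2 ⟨a, ha, rfl⟩, e⟩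
    · rintro ⟨z, hz, e⟩
      obtain ⟨a, rfl⟩ := exists_mk z
      obtain ⟨a', h1, h2⟩ := mk_mem_mk_list.1 hz
      exact ⟨_, List.mem_map.2 ⟨a', h1, rfl⟩, by rw [e, h2, map_mk]⟩

theorem map_mem_map {f : α → β} {x y : HF α} (h : x ∈ y) : map f x ∈ map f y :=
  mem_map.2 ⟨x, h, rfl⟩

theorem map_ofSet (f : α → β) {S : Set (HF α)} (h : S.Finite) :
    map f (ofSet S) = ofSet (map f '' S) :=
  (isSet_map.2 (isSet_ofSet S)).ext (isSet_ofSet _) fun z => by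
    rw [mem_map, mem_ofSet (h.image _)]
    simp only [mem_ofSet h, Set.mem_image, eq_comm]

@[simp]
theorem map_empty (f : α → β) : map f (∅ : HF α) = ∅ :=
  eq_empty (isSet_map.2 isSet_empty) fun z hz => by
    obtain ⟨w, hw, -⟩ := mem_map.1 hz
    exact not_mem_empty w hw

@[simp]
theorem map_pair (f : α → β) (a b : HF α) : map f (pair a b) = pair (map f a) (map f b) := by
  rw [pair, map_ofSet f (by simp), Set.image_pair]
  rfl

@[simp]
theorem map_kpair (f : α → β) (a b : HF α) : map f (kpair a b) = kpair (map f a) (map f b) := by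
  simp [kpair]

theorem map_sUnion (f : α → β) (a : HF α) : map f (sUnion a) = sUnion (map f a) :=
  (isSet_map.2 (isSet_sUnion a)).ext (isSet_sUnion _) fun z => by
    simp only [mem_map, mem_sUnion]
    constructor
    · rintro ⟨w, ⟨c, hc, hw⟩, rfl⟩
      exact ⟨map f c, ⟨c, hc, rfl⟩, mem_map.2 ⟨w, hw, rfl⟩⟩
    · rintro ⟨_, ⟨c, hc, rfl⟩, hz⟩
      obtain ⟨w, hw, rfl⟩ := mem_map.1 hz
      exact ⟨w, ⟨c, hc, hw⟩, rfl⟩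

@[simp]
theorem map_ofNat (f : α → β) (n : ℕ) : map f (ofNat n) = ofNat n := by
  induction n with
  | zero => simp [ofNat]
  | succ n ih =>
    refine (isSet_map.2 (isSet_ofNat _)).ext (isSet_ofNat _) fun z => ?_
    simp only [mem_map, mem_ofNat_succ]
    constructor
    · rintro ⟨w, rfl | hw, rfl⟩
      · exact Or.inl ih
      · right
        rw [← ih]
        exact map_mem_map hw
    · rintro (rfl | hz)
      · exact ⟨_, Or.inl rfl, ih.symm⟩
      · rw [← ih] at hz
        obtain ⟨w, hw, rfl⟩ := mem_map.1 hz
        exact ⟨w, Or.inr hw, rfl⟩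

theorem map_injective {f : α → β} (hf : Function.Injective f) : Function.Injective (map f) := by
  intro x
  induction x using mem_induction with
  | h x ih =>
    intro y hxy
    rcases isSet_or_atom x with hx | ⟨a, rfl⟩
    · have hy : IsSet y := by
        rw [← isSet_map (f := f), ← hxy, isSet_map]
        exact hx
      refine hx.ext hy fun z => ⟨fun hz => ?_, fun hz => ?_⟩
      · have h := map_mem_map (f := f) hz
        rw [hxy] at h
        obtain ⟨w, hw, e⟩ := mem_map.1 h
        rwa [ih z hz e]
      · have h := map_mem_map (f := f) hz
        rw [← hxy] at h
        obtain ⟨w, hw, e⟩ := mem_map.1 h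
        rwa [← ih w hw e.symm]
    · rcases isSet_or_atom y with hy | ⟨b, rfl⟩
      · rw [← isSet_map (f := f), ← hxy, isSet_map] at hy
        exact absurd rfl (hy a)
      · rw [hf (atom_injective hxy)]

theorem map_map (g : β → γ) (f : α → β) (x : HF α) : map g (map f x) = map (g ∘ f) x := by
  induction x using mem_induction with
  | h x ih =>
    rcases isSet_or_atom x with hx | ⟨a, rfl⟩
    · refine (isSet_map.2 (isSet_map.2 hx)).ext (isSet_map.2 hx) fun z => ?_
      simp only [mem_map]
      constructor
      · rintro ⟨_, ⟨w, hw, rfl⟩, rfl⟩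
        exact ⟨w, hw, ih w hw⟩
      · rintro ⟨w, hw, rfl⟩
        exact ⟨_, ⟨w, hw, rfl⟩, (ih w hw).symm⟩
    · rfl

theorem map_id (x : HF α) : map id x = x := by
  induction x using mem_induction with
  | h x ih =>
    rcases isSet_or_atom x with hx | ⟨a, rfl⟩
    · refine (isSet_map.2 hx).ext hx fun z => ?_
      rw [mem_map]
      exact ⟨fun ⟨w, hw, e⟩ => by rw [e, ih w hw]; exact hw, fun hz => ⟨z, hz, (ih z hz).symm⟩⟩
    · rfl

theorem map_symm_map (f : α ≃ β) (x : HF α) : map f.symm (map f x) = x := by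
  rw [map_map, f.symm_comp_self, map_id]

theorem map_map_symm (f : α ≃ β) (x : HF β) : map f (map f.symm x) = x := by
  rw [map_map, f.self_comp_symm, map_id]

theorem map_unique {f : α → β} (hf : Function.Injective f) (a : HF α) :
    map f (unique a) = unique (map f a) := by
  by_cases h : ∃ b, a = ofSet {b}
  · obtain ⟨b, rfl⟩ := h
    rw [map_ofSet f (Set.finite_singleton b), Set.image_singleton, unique_ofSet_singleton,
      unique_ofSet_singleton]
  · rw [unique_eq_empty h, map_empty, unique_eq_empty]
    rintro ⟨b, hb⟩
    have hb' : b ∈ map f a := by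
      rw [hb]
      exact (mem_ofSet (Set.finite_singleton b)).2 rfl
    obtain ⟨c, hc, rfl⟩ := mem_map.1 hb'
    refine h ⟨c, map_injective hf ?_⟩
    rw [hb, map_ofSet f (Set.finite_singleton c), Set.image_singleton]

theorem setOf_mem_map (f : α → β) (a : HF α) : {y | y ∈ map f a} = map f '' {y | y ∈ a} := by
  ext z
  simp only [Set.mem_ofPred_eq, mem_map, Set.mem_image, eq_comm]

theorem map_card {f : α → β} (hf : Function.Injective f) (a : HF α) :
    map f (card a) = card (map f a) := by
  rw [card, card, map_ofNat, setOf_mem_map, Set.ncard_image_of_injective _ (map_injective hf)]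

/-! ### Transitive closures -/

theorem mem_tc {a b : HF α} : b ∈ tc a ↔ ∃ c, c ∈ a ∧ (b = c ∨ b ∈ tc c) := by
  constructor
  · intro h
    cases h with
    | single h => exact ⟨b, h, Or.inl rfl⟩
    | tail h1 h2 => exact ⟨_, h2, Or.inr h1⟩
  · rintro ⟨c, hc, rfl | h⟩
    · exact Relation.TransGen.single hc
    · exact Relation.TransGen.tail h hc

theorem mem_tc_of_mem {a b : HF α} (h : b ∈ a) : b ∈ tc a := Relation.TransGen.single h

theorem mem_tc_of_mem_tc {a b c : HF α} (h : c ∈ b) (hb : b ∈ tc a) : c ∈ tc a :=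
  Relation.TransGen.head h hb

theorem tc_eq_biUnion (a : HF α) : tc a = ⋃ c ∈ {c | c ∈ a}, insert c (tc c) := by
  ext b
  rw [mem_tc]
  simp

theorem finite_tc (a : HF α) : (tc a).Finite := by
  induction a using mem_induction with
  | h a ih =>
    rw [tc_eq_biUnion]
    exact (finite_members a).biUnion fun c hc => (ih c hc).insert c

theorem tc_subset {a : HF α} {S : Set (HF α)} (h1 : ∀ c, c ∈ a → c ∈ S)
    (h2 : ∀ c ∈ S, ∀ d, d ∈ c → d ∈ S) : tc a ⊆ S := by
  intro b hb
  induction hb using Relation.TransGen.head_induction_on with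
  | single h => exact h1 _ h
  | head h _ ih => exact h2 _ ih _ h

theorem small_iff {N : ℕ} {a : HF α} : Small N a ↔ (tc a).ncard ≤ N := by
  rw [Small, ← (finite_tc a).cast_ncard_eq, Nat.cast_le]

theorem tc_atom (a : α) : tc (atom a) = ∅ := by
  ext b
  rw [mem_tc]
  simp [not_mem_atom]

theorem tc_empty : tc (∅ : HF α) = ∅ := by
  ext b
  rw [mem_tc]
  simp [not_mem_empty]

theorem small_empty (N : ℕ) : Small N (∅ : HF α) := by
  rw [small_iff, tc_empty]
  simp

theorem ncard_tc_pair (a b : HF α) :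
    (tc (pair a b)).ncard ≤ 2 + (tc a).ncard + (tc b).ncard := by
  have : tc (pair a b) = insert a (insert b (tc a ∪ tc b)) := by
    ext c
    rw [mem_tc]
    simp only [mem_pair, Set.mem_insert_iff, Set.mem_union]
    constructor
    · rintro ⟨d, rfl | rfl, h⟩ <;> tauto
    · rintro (rfl | rfl | h | h)
      exacts [⟨_, Or.inl rfl, Or.inl rfl⟩, ⟨_, Or.inr rfl, Or.inl rfl⟩, ⟨a, Or.inl rfl, Or.inr h⟩,
        ⟨b, Or.inr rfl, Or.inr h⟩]
  rw [this]
  have h1 := Set.ncard_insert_le a (insert b (tc a ∪ tc b))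
  have h2 := Set.ncard_insert_le b (tc a ∪ tc b)
  have h3 := Set.ncard_union_le (tc a) (tc b)
  omega

theorem ncard_tc_kpair (a b : HF α) :
    (tc (kpair a b)).ncard ≤ 6 + 3 * (tc a).ncard + (tc b).ncard := by
  have h1 := ncard_tc_pair (pair a a) (pair a b)
  have h2 := ncard_tc_pair a a
  have h3 := ncard_tc_pair a b
  rw [kpair]
  omega

theorem ncard_tc_ofNat (n : ℕ) : (tc (ofNat n : HF α)).ncard ≤ n := by
  have : tc (ofNat n : HF α) ⊆ ofNat '' Set.Iio n := by
    refine tc_subset ?_ ?_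
    · intro c hc
      obtain ⟨m, hm, rfl⟩ := mem_ofNat.1 hc
      exact ⟨m, hm, rfl⟩
    · rintro _ ⟨m, hm, rfl⟩ d hd
      obtain ⟨k, hk, rfl⟩ := mem_ofNat.1 hd
      exact ⟨k, lt_trans hk hm, rfl⟩
  calc _ ≤ (ofNat '' Set.Iio n : Set (HF α)).ncard :=
        Set.ncard_le_ncard this ((Set.finite_Iio n).image _)
    _ ≤ (Set.Iio n).ncard := Set.ncard_image_le (Set.finite_Iio n)
    _ = n := by simp

theorem tc_map (f : α → β) (a : HF α) : tc (map f a) = map f '' tc a := by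
  induction a using mem_induction with
  | h a ih =>
    rw [tc_eq_biUnion, tc_eq_biUnion, setOf_mem_map, Set.biUnion_image, Set.image_iUnion₂]
    refine Set.iUnion₂_congr fun c hc => ?_
    rw [ih c hc, Set.image_insert_eq]

theorem small_map {f : α → β} (hf : Function.Injective f) {N : ℕ} {a : HF α} :
    Small N (map f a) ↔ Small N a := by
  rw [small_iff, small_iff, tc_map, Set.ncard_image_of_injective _ (map_injective hf)]

end HF

namespace BGS

variable {L : Language}

/-! ### Free variables -/

mutual

theorem Term.finite_fv : ∀ t : Term L, t.fv.Finite
  | .var x => Set.finite_singleton x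
  | .empty => Set.finite_empty
  | .atoms => Set.finite_empty
  | .pair s t => s.finite_fv.union t.finite_fv
  | .union s => s.finite_fv
  | .unique s => s.finite_fv
  | .card s => s.finite_fv
  | .compr s _ t Φ => (s.finite_fv.sdiff.union t.finite_fv).union Φ.finite_fv.sdiff
  | .iter s _ => s.finite_fv.sdiff

theorem Formula.finite_fv : ∀ Φ : Formula L, Φ.fv.Finite
  | .rel _ ts => Set.finite_iUnion fun i => (ts i).finite_fv
  | .eq s t => s.finite_fv.union t.finite_fv
  | .not Φ => Φ.finite_fv
  | .and Φ Ψ => Φ.finite_fv.union Ψ.finite_fv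
  | .wsc _ _ step choice wit out =>
    ((step.finite_fv.sdiff.union choice.finite_fv.sdiff).union wit.finite_fv.sdiff).union
      out.finite_fv.sdiff

end

section Coincidence

variable {α : Type} [L.Structure α]

theorem update_agree {ρ ρ' : ℕ → HF α} {S : Set ℕ} {y : ℕ} (h : ∀ z ∈ S \ {y}, ρ z = ρ' z)
    (b : HF α) : ∀ z ∈ S, Function.update ρ y b z = Function.update ρ' y b z := by
  intro z hz
  by_cases hzy : z = y
  · subst hzy; simp
  · simp [hzy, h z ⟨hz, hzy⟩]

theorem update_agree₂ {ρ ρ' : ℕ → HF α} {S : Set ℕ} {x y : ℕ}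
    (h : ∀ z ∈ S \ {x, y}, ρ z = ρ' z) (b e : HF α) : ∀ z ∈ S,
    Function.update (Function.update ρ x b) y e z =
      Function.update (Function.update ρ' x b) y e z := by
  refine update_agree (fun z hz => update_agree (S := S \ {y}) (fun w hw => h w ?_) b z hz) e
  simp only [Set.mem_sdiff, Set.mem_singleton_iff, Set.mem_insert_iff] at hw ⊢
  tauto

mutual

theorem Term.eval_congr (N : ℕ) : ∀ (t : Term L) {ρ ρ' : ℕ → HF α}, (∀ z ∈ t.fv, ρ z = ρ' z) →
    t.eval N ρ = t.eval N ρ'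
  | .var x, _, _, h => by
    simp only [Term.eval]
    rw [h x rfl]
  | .empty, _, _, _ => rfl
  | .atoms, _, _, _ => rfl
  | .pair s t, _, _, h => by
    simp only [Term.eval]
    rw [s.eval_congr N fun z hz => h z (Or.inl hz), t.eval_congr N fun z hz => h z (Or.inr hz)]
  | .union s, _, _, h => by
    simp only [Term.eval]
    rw [s.eval_congr N h]
  | .unique s, _, _, h => by
    simp only [Term.eval]
    rw [s.eval_congr N h]
  | .card s, _, _, h => by
    simp only [Term.eval]
    rw [s.eval_congr N h]
  | .compr s y t Φ, ρ, ρ', h => by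
    simp only [Term.eval]
    rw [t.eval_congr N fun z hz => h z (Or.inl (Or.inr hz))]
    have h1 : (fun b => Φ.eval N (Function.update ρ y b)) =
        fun b => Φ.eval N (Function.update ρ' y b) := funext fun b =>
      Φ.eval_congr N (update_agree (fun z hz => h z (Or.inr hz)) b)
    have h2 : (fun b => s.eval N (Function.update ρ y b)) =
        fun b => s.eval N (Function.update ρ' y b) := funext fun b =>
      s.eval_congr N (update_agree (fun z hz => h z (Or.inl (Or.inl hz))) b)
    rw [h1, h2]
  | .iter s y, ρ, ρ', h => by
    simp only [Term.eval]
    have h2 : (fun b => s.eval N (Function.update ρ y b)) =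
        fun b => s.eval N (Function.update ρ' y b) := funext fun b =>
      s.eval_congr N (update_agree h b)
    rw [h2]

theorem Formula.eval_congr (N : ℕ) : ∀ (Φ : Formula L) {ρ ρ' : ℕ → HF α},
    (∀ z ∈ Φ.fv, ρ z = ρ' z) → Φ.eval N ρ = Φ.eval N ρ'
  | .rel R ts, ρ, ρ', h => by
    simp only [Formula.eval]
    have h1 : (fun i => (ts i).eval N ρ) = fun i => (ts i).eval N ρ' := funext fun i =>
      (ts i).eval_congr N fun z hz => h z (Set.mem_iUnion.2 ⟨i, hz⟩)
    rw [h1]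
  | .eq s t, _, _, h => by
    simp only [Formula.eval]
    rw [s.eval_congr N fun z hz => h z (Or.inl hz), t.eval_congr N fun z hz => h z (Or.inr hz)]
  | .not Φ, _, _, h => by
    simp only [Formula.eval]
    rw [Φ.eval_congr N h]
  | .and Φ Ψ, _, _, h => by
    simp only [Formula.eval]
    rw [Φ.eval_congr N fun z hz => h z (Or.inl hz), Ψ.eval_congr N fun z hz => h z (Or.inr hz)]
  | .wsc x y step choice wit out, ρ, ρ', h => by
    simp only [Formula.eval]
    have h0 : {a | ∃ z ∈ (Formula.wsc x y step choice wit out).fv, a = ρ z} =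
        {a | ∃ z ∈ (Formula.wsc x y step choice wit out).fv, a = ρ' z} := by
      ext a
      constructor
      · rintro ⟨z, hz, rfl⟩
        exact ⟨z, hz, h z hz⟩
      · rintro ⟨z, hz, rfl⟩
        exact ⟨z, hz, (h z hz).symm⟩
    have h1 : (fun b e => step.eval N (Function.update (Function.update ρ x b) y e)) =
        fun b e => step.eval N (Function.update (Function.update ρ' x b) y e) :=
      funext fun b => funext fun e =>
        step.eval_congr N (update_agree₂ (fun z hz => h z (Or.inl (Or.inl (Or.inl hz)))) b e)
    have h2 : (fun b => choice.eval N (Function.update ρ x b)) =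
        fun b => choice.eval N (Function.update ρ' x b) := funext fun b =>
      choice.eval_congr N (update_agree (fun z hz => h z (Or.inl (Or.inl (Or.inr hz)))) b)
    have h3 : (fun b e => wit.eval N (Function.update (Function.update ρ x b) y e)) =
        fun b e => wit.eval N (Function.update (Function.update ρ' x b) y e) :=
      funext fun b => funext fun e =>
        wit.eval_congr N (update_agree₂ (fun z hz => h z (Or.inl (Or.inr hz))) b e)
    have h4 : (fun b => out.eval N (Function.update ρ x b)) =
        fun b => out.eval N (Function.update ρ' x b) := funext fun b =>
      out.eval_congr N (update_agree (fun z hz => h z (Or.inr hz)) b)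
    rw [h0, h1, h2, h3, h4]

end

end Coincidence

/-! ### Invariance under isomorphisms -/

section Invariance

open HF

variable {α β : Type}

/-- Partial operations which correspond to each other under a bijection of the atoms. -/
def Corr (φ : α ≃ β) (f : HF α → Option (HF α)) (g : HF β → Option (HF β)) : Prop :=
  ∀ a, g (map φ a) = (f a).map (map φ)

/-- Partial binary operations which correspond to each other under a bijection of the atoms. -/
def Corr₂ (φ : α ≃ β) (f : HF α → HF α → Option (HF α)) (g : HF β → HF β → Option (HF β)) : Prop :=
  ∀ a b, g (map φ a) (map φ b) = (f a b).map (map φ)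

theorem Corr.symm {φ : α ≃ β} {f : HF α → Option (HF α)} {g : HF β → Option (HF β)}
    (h : Corr φ f g) : Corr φ.symm g f := by
  intro a
  have h1 := h (map φ.symm a)
  rw [map_map_symm] at h1
  rw [h1, Option.map_map]
  have : map φ.symm ∘ map φ = (id : HF α → HF α) := funext fun x => map_symm_map φ x
  rw [this, Option.map_id_apply]

theorem Corr₂.symm {φ : α ≃ β} {f : HF α → HF α → Option (HF α)} {g : HF β → HF β → Option (HF β)}
    (h : Corr₂ φ f g) : Corr₂ φ.symm g f := by
  intro a b
  have h1 := h (map φ.symm a) (map φ.symm b)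
  rw [map_map_symm, map_map_symm] at h1
  rw [h1, Option.map_map]
  have : map φ.symm ∘ map φ = (id : HF α → HF α) := funext fun x => map_symm_map φ x
  rw [this, Option.map_id_apply]

theorem iterate_map (φ : α ≃ β) {f : HF α → Option (HF α)} {g : HF β → Option (HF β)}
    (h : Corr φ f g) (N r : ℕ) (a : HF α) :
    iterate N g r (map φ a) = (iterate N f r a).map (map φ) := by
  have hi : ∀ {x y : HF α}, map φ x = map φ y ↔ x = y := (map_injective φ.injective).eq_iff
  induction r generalizing a with
  | zero =>
    unfold iterate
    rw [h a]
    by_cases ha : Small N a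
    · rw [if_pos ha, if_pos ((small_map φ.injective).2 ha)]
      rcases f a with _ | b
      · rfl
      · by_cases hb : b = a
        · simp [hb]
        · simp [hb, hi]
    · rw [if_neg ha, if_neg (fun h => ha ((small_map φ.injective).1 h))]
      simp
  | succ r ih =>
    unfold iterate
    rw [h a]
    by_cases ha : Small N a
    · rw [if_pos ha, if_pos ((small_map φ.injective).2 ha)]
      rcases f a with _ | b
      · rfl
      · by_cases hb : b = a
        · simp [hb]
        · simp [hb, hi, ih]
    · rw [if_neg ha, if_neg (fun h => ha ((small_map φ.injective).1 h))]
      simp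

theorem comprEval_map (φ : α ≃ β) {P : HF α → Option Prop} {Q : HF β → Option Prop}
    {f : HF α → Option (HF α)} {g : HF β → Option (HF β)} (hP : ∀ a, Q (map φ a) = P a)
    (h : Corr φ f g) (a : HF α) :
    comprEval (map φ a) Q g = (comprEval a P f).map (map φ) := by
  unfold comprEval
  have h1 : (∃ b ∈ map φ a, Q b = none ∨ ((∃ p, Q b = some p ∧ p) ∧ g b = none)) ↔
      ∃ b ∈ a, P b = none ∨ ((∃ p, P b = some p ∧ p) ∧ f b = none) := by
    constructor
    · rintro ⟨_, hb, h2⟩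
      obtain ⟨b, hb', rfl⟩ := mem_map.1 hb
      rw [hP, h b, Option.map_eq_none_iff] at h2
      exact ⟨b, hb', h2⟩
    · rintro ⟨b, hb, h2⟩
      refine ⟨map φ b, map_mem_map hb, ?_⟩
      rw [hP, h b, Option.map_eq_none_iff]
      exact h2
  by_cases hc : ∃ b ∈ a, P b = none ∨ ((∃ p, P b = some p ∧ p) ∧ f b = none)
  · rw [if_pos hc, if_pos (h1.2 hc)]
    rfl
  · rw [if_neg hc, if_neg (fun h => hc (h1.1 h)), Option.map_some, map_ofSet]
    · congr 2
      ext c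
      constructor
      · rintro ⟨_, hb, h2, h3⟩
        obtain ⟨b, hb', rfl⟩ := mem_map.1 hb
        rw [h b, Option.map_eq_some_iff] at h3
        rw [hP b] at h2
        obtain ⟨d, h3, rfl⟩ := h3
        exact ⟨d, ⟨b, hb', h2, h3⟩, rfl⟩
      · rintro ⟨d, ⟨b, hb, h2, h3⟩, rfl⟩
        exact ⟨map φ b, map_mem_map hb, by rw [hP]; exact h2, by rw [h b, h3]; rfl⟩
    · refine (((finite_members a).image f).preimage (Option.some_injective _).injOn).subset ?_
      rintro c ⟨b, hb, -, h3⟩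
      exact ⟨b, hb, h3⟩

theorem isChoice_map (φ : α ≃ β) {Y e : HF α} (h : IsChoice Y e) :
    IsChoice (map φ Y) (map φ e) := by
  rcases h with h | ⟨h, rfl⟩
  · exact Or.inl (map_mem_map h)
  · refine Or.inr ⟨fun x hx => ?_, map_empty _⟩
    obtain ⟨z, hz, -⟩ := mem_map.1 hx
    exact h z hz

theorem Run.map (φ : α ≃ β) {step : HF α → HF α → Option (HF α)} {choice : HF α → Option (HF α)}
    {step' : HF β → HF β → Option (HF β)} {choice' : HF β → Option (HF β)}
    (h1 : Corr₂ φ step step') (h2 : Corr φ choice choice') {l : List (HF α)}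
    (hl : Run step choice l) : Run step' choice' (l.map (HF.map φ)) := by
  induction hl with
  | root =>
    simp only [List.map_cons, List.map_nil, map_empty]
    exact Run.root
  | @next b l Y e d _ hne hY he hd ih =>
    refine Run.next ih ?_ (Y := HF.map φ Y) (e := HF.map φ e) ?_ (isChoice_map φ he) ?_
    · rw [List.head?_map]
      intro h
      obtain ⟨c, hc, e⟩ := Option.map_eq_some_iff.1 h
      rw [map_injective φ.injective e] at hc
      exact hne hc
    · rw [h2, hY]; rfl
    · rw [h1, hd]; rfl

section

variable [L.Structure α] [L.Structure β]

theorem conj_mem_stab (φ : α ≃[L] β) {P : Set (HF α)} {ψ : α ≃[L] α} (h : ψ ∈ stab L P) :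
    φ.comp (ψ.comp φ.symm) ∈ stab L (HF.map φ '' P) := by
  rintro _ ⟨a, ha, rfl⟩
  rw [HF.map_map]
  have h1 : (φ.comp (ψ.comp φ.symm)) ∘ φ = φ ∘ ψ := by
    ext u
    simp
  rw [h1, ← HF.map_map, h a ha]

theorem graph_conj [Finite α] (φ : α ≃[L] β) (ψ : α ≃[L] α) :
    graph (φ.comp (ψ.comp φ.symm)) = HF.map φ (graph ψ) := by
  rw [graph, graph, map_ofSet _ (Set.finite_range _), ← Set.range_comp]
  congr 1
  ext x
  constructor
  · rintro ⟨u, rfl⟩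
    exact ⟨φ.symm u, by simp⟩
  · rintro ⟨u, rfl⟩
    exact ⟨φ u, by simp⟩

theorem witnessesOrbit_map [Finite α] (φ : α ≃[L] β) {P : Set (HF α)} {M Y : HF α}
    (h : WitnessesOrbit L P M Y) :
    WitnessesOrbit L (HF.map φ '' P) (HF.map φ M) (HF.map φ Y) := by
  obtain ⟨h1, h2⟩ := h
  constructor
  · intro m hm
    obtain ⟨m, hm', rfl⟩ := mem_map.1 hm
    obtain ⟨ψ, hψ, rfl⟩ := h1 m hm'
    exact ⟨_, conj_mem_stab φ hψ, (graph_conj φ ψ).symm⟩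
  · intro b hb c hc
    obtain ⟨b, hb', rfl⟩ := mem_map.1 hb
    obtain ⟨c, hc', rfl⟩ := mem_map.1 hc
    obtain ⟨ψ, hψ, hM, rfl⟩ := h2 b hb' c hc'
    refine ⟨_, conj_mem_stab φ hψ, ?_, ?_⟩
    · rw [graph_conj]
      exact map_mem_map hM
    · rw [HF.map_map, HF.map_map]
      congr 1
      ext u
      simp

theorem witnessed_map [Finite α] (φ : α ≃[L] β) {P : Set (HF α)} {choice : HF α → Option (HF α)}
    {choice' : HF β → Option (HF β)} {wit : HF α → HF α → Option (HF α)}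
    {wit' : HF β → HF β → Option (HF β)} (h2 : Corr φ.toEquiv choice choice')
    (h3 : Corr₂ φ.toEquiv wit wit') {c : HF α} {l : List (HF α)}
    (h : Witnessed L P choice wit c l) :
    Witnessed L (HF.map φ '' P) choice' wit' (HF.map φ c) (l.map (HF.map φ)) := by
  intro b' l' hbl
  obtain ⟨l₁, hl₁, e⟩ := List.suffix_map_iff.1 hbl
  cases l₁ with
  | nil => cases e
  | cons b l₂ =>
    rw [List.map_cons, List.cons.injEq] at e
    obtain ⟨rfl, rfl⟩ := e
    obtain ⟨M, Y, hM, hY, hw⟩ := h b l₂ hl₁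
    refine ⟨HF.map φ M, HF.map φ Y, ?_, ?_, ?_⟩
    · have := h3 c b
      rw [hM] at this
      exact this
    · have := h2 b
      rw [hY] at this
      exact this
    · have := witnessesOrbit_map φ hw
      rw [Set.image_union] at this
      convert this using 2
      ext x
      rw [← List.map_cons]
      simp only [Set.mem_ofPred_eq, List.mem_map, Set.mem_image]

theorem wscFails_map [Finite β] (φ : α ≃[L] β) {P : Set (HF α)} {P' : Set (HF β)}
    {step wit : HF α → HF α → Option (HF α)} {choice : HF α → Option (HF α)}
    {step' wit' : HF β → HF β → Option (HF β)} {choice' : HF β → Option (HF β)}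
    (hP : P' = HF.map φ '' P) (h1 : Corr₂ φ.toEquiv step step')
    (h2 : Corr φ.toEquiv choice choice') (h3 : Corr₂ φ.toEquiv wit wit') {N : ℕ}
    (h : WscFails L N P step choice wit) : WscFails L N P' step' choice' wit' := by
  rcases h with ⟨b, l, hr, hne, h⟩ | ⟨l, hr, h⟩ | ⟨c, l, hr, h⟩
  · refine Or.inl ⟨HF.map φ b, l.map (HF.map φ), hr.map φ.toEquiv h1 h2, ?_, ?_⟩
    · rw [List.head?_map]
      intro h
      obtain ⟨c, hc, e⟩ := Option.map_eq_some_iff.1 h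
      rw [map_injective φ.injective e] at hc
      exact hne hc
    · rcases h with h | ⟨Y, e, hY, he, hs⟩
      · left
        have := h2 b
        rw [h] at this
        exact this
      · right
        refine ⟨HF.map φ Y, HF.map φ e, ?_, isChoice_map φ.toEquiv he, ?_⟩
        · have := h2 b
          rw [hY] at this
          exact this
        · have := h1 b e
          rw [hs] at this
          exact this
  · refine Or.inr (Or.inl ⟨l.map (HF.map φ), hr.map φ.toEquiv h1 h2, ?_⟩)
    rcases h with h | ⟨b, hb, hs⟩
    · left
      rwa [List.length_map]
    · exact Or.inr ⟨HF.map φ b, List.mem_map_of_mem hb, fun h => hs ((small_map φ.injective).1 h)⟩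
  · refine Or.inr (Or.inr ⟨HF.map φ c, l.map (HF.map φ), hr.map φ.toEquiv h1 h2, fun hw => h ?_⟩)
    have := witnessed_map φ.symm h2.symm h3.symm hw
    rw [hP, ← Set.image_comp] at this
    have hid : ∀ x : HF α, HF.map φ.symm (HF.map φ x) = x := fun x => map_symm_map φ.toEquiv x
    have hid' : HF.map φ.symm ∘ HF.map φ = (id : HF α → HF α) := funext hid
    rw [hid, hid', Set.image_id, List.map_cons, hid, List.map_map, hid', List.map_id] at this
    exact this

theorem wscEval_map [Finite α] [Finite β] (φ : α ≃[L] β) {P : Set (HF α)} {P' : Set (HF β)}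
    {step wit : HF α → HF α → Option (HF α)} {choice : HF α → Option (HF α)}
    {step' wit' : HF β → HF β → Option (HF β)} {choice' : HF β → Option (HF β)}
    {out : HF α → Option Prop} {out' : HF β → Option Prop}
    (hP : P' = HF.map φ '' P) (h1 : Corr₂ φ.toEquiv step step')
    (h2 : Corr φ.toEquiv choice choice') (h3 : Corr₂ φ.toEquiv wit wit')
    (h4 : ∀ a, out' (HF.map φ a) = out a) (N : ℕ) :
    wscEval L N P' step' choice' wit' out' = wscEval L N P step choice wit out := by
  have hid : HF.map φ.symm ∘ HF.map φ = (id : HF α → HF α) :=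
    funext fun x => map_symm_map φ.toEquiv x
  have hf : WscFails L N P' step' choice' wit' ↔ WscFails L N P step choice wit := by
    refine ⟨fun h => ?_, wscFails_map φ hP h1 h2 h3⟩
    refine wscFails_map φ.symm ?_ h1.symm h2.symm h3.symm h
    rw [hP, ← Set.image_comp, hid, Set.image_id]
  have hr : ∀ q : Option Prop → Prop, (∃ c l, Run step' choice' (c :: c :: l) ∧ q (out' c)) ↔
      ∃ c l, Run step choice (c :: c :: l) ∧ q (out c) := by
    intro q
    constructor
    · rintro ⟨c, l, hr, ho⟩
      refine ⟨HF.map φ.symm c, l.map (HF.map φ.symm), hr.map φ.toEquiv.symm h1.symm h2.symm, ?_⟩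
      rw [← h4, show HF.map φ (HF.map φ.symm c) = c from map_map_symm φ.toEquiv c]
      exact ho
    · rintro ⟨c, l, hr, ho⟩
      exact ⟨HF.map φ c, l.map (HF.map φ), hr.map φ.toEquiv h1 h2, by rw [h4]; exact ho⟩
  unfold wscEval
  have hc := or_congr hf (hr fun o => o = none)
  by_cases hcond : WscFails L N P step choice wit ∨ ∃ c l, Run step choice (c :: c :: l) ∧
      out c = none
  · rw [if_pos hcond, if_pos (hc.2 hcond)]
  rw [if_neg hcond, if_neg (fun h => hcond (hc.1 h))]
  congr 1
  rw [eq_iff_iff]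
  have := not_congr (hr fun o => ¬ ∃ p, o = some p ∧ p)
  push Not at this
  exact this

theorem relEval_map (φ : α ≃[L] β) {n : ℕ} (R : L.Relations n) (v : Fin n → Option (HF α)) :
    relEval (α := β) R (fun i => (v i).map (HF.map φ)) = relEval R v := by
  unfold relEval
  simp only [Option.map_eq_none_iff]
  split_ifs
  · rfl
  · congr 1
    rw [eq_iff_iff]
    constructor
    · rintro ⟨a, ha, hR⟩
      refine ⟨φ.symm ∘ a, fun i => ?_, ?_⟩
      · obtain ⟨x, hx, e⟩ := Option.map_eq_some_iff.1 (ha i)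
        rw [hx]
        have h1 : HF.map φ x = HF.map φ (atom (φ.symm (a i))) := by
          rw [e, map_atom, φ.apply_symm_apply]
        rw [map_injective φ.injective h1]
        rfl
      · exact (φ.symm.map_rel R a).2 hR
    · rintro ⟨a, ha, hR⟩
      exact ⟨φ ∘ a, fun i => by rw [ha i]; rfl, (φ.map_rel R a).2 hR⟩

mutual

theorem Term.eval_map [Finite α] [Finite β] (N : ℕ) (φ : α ≃[L] β) : ∀ (t : Term L) (ρ : ℕ → HF α),
    t.eval N (HF.map φ ∘ ρ) = (t.eval N ρ).map (HF.map φ)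
  | .var x, _ => rfl
  | .empty, _ => by simp [Term.eval]
  | .atoms, _ => by
    simp only [Term.eval, Option.map_some]
    rw [map_ofSet _ (Set.finite_range _), ← Set.range_comp]
    congr 2
    ext x
    constructor
    · rintro ⟨u, rfl⟩
      exact ⟨φ.symm u, by simp⟩
    · rintro ⟨u, rfl⟩
      exact ⟨φ u, by simp⟩
  | .pair s t, ρ => by
    simp only [Term.eval]
    rw [s.eval_map N φ, t.eval_map N φ]
    rcases s.eval N ρ with _ | a
    · rfl
    · rcases t.eval N ρ with _ | b <;> simp
  | .union s, ρ => by
    simp only [Term.eval]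
    rw [s.eval_map N φ]
    rcases s.eval N ρ with _ | a <;> simp [map_sUnion]
  | .unique s, ρ => by
    simp only [Term.eval]
    rw [s.eval_map N φ]
    rcases s.eval N ρ with _ | a <;> simp [HF.map_unique φ.injective]
  | .card s, ρ => by
    simp only [Term.eval]
    rw [s.eval_map N φ]
    rcases s.eval N ρ with _ | a <;> simp [HF.map_card φ.injective]
  | .compr s y t Φ, ρ => by
    simp only [Term.eval]
    rw [t.eval_map N φ]
    rcases t.eval N ρ with _ | a
    · rfl
    · simp only [Option.map_some, Option.bind_some]
      refine comprEval_map φ.toEquiv (fun b => ?_) (fun b => ?_) a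
      · have := Φ.eval_map N φ (Function.update ρ y b)
        rw [Function.comp_update] at this
        exact this
      · have := s.eval_map N φ (Function.update ρ y b)
        rw [Function.comp_update] at this
        exact this
  | .iter s y, ρ => by
    simp only [Term.eval]
    rw [← map_empty φ]
    refine iterate_map φ.toEquiv (fun b => ?_) N N ∅
    have := s.eval_map N φ (Function.update ρ y b)
    rw [Function.comp_update] at this
    exact this

theorem Formula.eval_map [Finite α] [Finite β] (N : ℕ) (φ : α ≃[L] β) : ∀ (Φ : Formula L) (ρ : ℕ → HF α),
    Φ.eval N (HF.map φ ∘ ρ) = Φ.eval N ρ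
  | .rel R ts, ρ => by
    simp only [Formula.eval]
    rw [← relEval_map φ]
    congr 1
    funext i
    exact (ts i).eval_map N φ ρ
  | .eq s t, ρ => by
    simp only [Formula.eval]
    rw [s.eval_map N φ, t.eval_map N φ]
    rcases s.eval N ρ with _ | a
    · rfl
    · rcases t.eval N ρ with _ | b
      · rfl
      · simp [(map_injective φ.injective).eq_iff]
  | .not Φ, ρ => by
    simp only [Formula.eval]
    rw [Φ.eval_map N φ]
  | .and Φ Ψ, ρ => by
    simp only [Formula.eval]
    rw [Φ.eval_map N φ, Ψ.eval_map N φ]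
  | .wsc x y step choice wit out, ρ => by
    simp only [Formula.eval]
    refine wscEval_map φ ?_ (fun b e => ?_) (fun b => ?_) (fun b e => ?_) (fun b => ?_) N
    · ext a
      constructor
      · rintro ⟨z, hz, rfl⟩
        exact ⟨ρ z, ⟨z, hz, rfl⟩, rfl⟩
      · rintro ⟨_, ⟨z, hz, rfl⟩, rfl⟩
        exact ⟨z, hz, rfl⟩
    · have := step.eval_map N φ (Function.update (Function.update ρ x b) y e)
      rw [Function.comp_update, Function.comp_update] at this
      exact this
    · have := choice.eval_map N φ (Function.update ρ x b)
      rw [Function.comp_update] at this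
      exact this
    · have := wit.eval_map N φ (Function.update (Function.update ρ x b) y e)
      rw [Function.comp_update, Function.comp_update] at this
      exact this
    · have := out.eval_map N φ (Function.update ρ x b)
      rw [Function.comp_update] at this
      exact this

end

end

end Invariance

end BGS

/-! ## Derived operations -/

namespace HF

variable {α : Type*}

/-- The union of two sets. -/
noncomputable def cup (a b : HF α) : HF α := sUnion (pair a b)

@[simp]
theorem mem_cup {a b x : HF α} : x ∈ cup a b ↔ x ∈ a ∨ x ∈ b := by simp [cup]

theorem isSet_cup (a b : HF α) : IsSet (cup a b) := isSet_sUnion _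

/-- The successor of an ordinal. -/
noncomputable def succ (a : HF α) : HF α := cup a (pair a a)

@[simp]
theorem succ_ofNat (n : ℕ) : succ (ofNat n : HF α) = ofNat (n + 1) :=
  (isSet_cup _ _).ext (isSet_ofNat _) fun z => by
    rw [mem_ofNat_succ, mem_cup, mem_pair]
    tauto

theorem cup_singleton_eq_iff {a b : HF α} : cup (pair a a) b = b ↔ a ∈ b := by
  constructor
  · intro h
    rw [← h]
    simp
  · intro h
    refine (isSet_cup _ _).ext (isSet_of_mem h) fun z => ?_
    simp only [mem_cup, mem_pair, or_self]
    exact ⟨fun h' => h'.elim (fun e => e ▸ h) id, Or.inr⟩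

/-- The first component of a Kuratowski pair. -/
noncomputable def fst (z : HF α) : HF α :=
  unique (ofSet {c | ∃ b, b ∈ sUnion z ∧ (∃ d, d ∈ sUnion z ∧ z = kpair b d) ∧ b = c})

/-- The second component of a Kuratowski pair. -/
noncomputable def snd (z : HF α) : HF α :=
  unique (ofSet {c | ∃ b, b ∈ sUnion z ∧ (∃ d, d ∈ sUnion z ∧ z = kpair d b) ∧ b = c})

theorem mem_sUnion_kpair {a b x : HF α} : x ∈ sUnion (kpair a b) ↔ x = a ∨ x = b := by
  simp only [mem_sUnion, mem_kpair]
  constructor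
  · rintro ⟨c, rfl | rfl, h⟩ <;> simp at h <;> tauto
  · rintro (rfl | rfl)
    · exact ⟨_, Or.inl rfl, by simp⟩
    · exact ⟨_, Or.inr rfl, by simp⟩

@[simp]
theorem fst_kpair (a b : HF α) : fst (kpair a b) = a := by
  have : {c | ∃ x, x ∈ sUnion (kpair a b) ∧ (∃ d, d ∈ sUnion (kpair a b) ∧
      kpair a b = kpair x d) ∧ x = c} = {a} := by
    ext c
    simp only [mem_sUnion_kpair, kpair_inj, Set.mem_ofPred_eq, Set.mem_singleton_iff]
    constructor
    · rintro ⟨x, -, ⟨d, -, h, -⟩, rfl⟩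
      exact h.symm
    · rintro rfl
      exact ⟨c, Or.inl rfl, ⟨b, Or.inr rfl, rfl, rfl⟩, rfl⟩
  rw [fst, this, unique_ofSet_singleton]

@[simp]
theorem snd_kpair (a b : HF α) : snd (kpair a b) = b := by
  have : {c | ∃ x, x ∈ sUnion (kpair a b) ∧ (∃ d, d ∈ sUnion (kpair a b) ∧
      kpair a b = kpair d x) ∧ x = c} = {b} := by
    ext c
    simp only [mem_sUnion_kpair, kpair_inj, Set.mem_ofPred_eq, Set.mem_singleton_iff]
    constructor
    · rintro ⟨x, -, ⟨d, -, -, h⟩, rfl⟩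
      exact h.symm
    · rintro rfl
      exact ⟨c, Or.inr rfl, ⟨a, Or.inl rfl, rfl, rfl⟩, rfl⟩
  rw [snd, this, unique_ofSet_singleton]

theorem fst_eq_empty {z : HF α} (h : ∀ a b, z ≠ kpair a b) : fst z = ∅ := by
  have : {c | ∃ x, x ∈ sUnion z ∧ (∃ d, d ∈ sUnion z ∧ z = kpair x d) ∧ x = c} = ∅ := by
    ext c
    simp [h]
  rw [fst, this, ofSet_empty, unique_empty]

theorem snd_eq_empty {z : HF α} (h : ∀ a b, z ≠ kpair a b) : snd z = ∅ := by
  have : {c | ∃ x, x ∈ sUnion z ∧ (∃ d, d ∈ sUnion z ∧ z = kpair d x) ∧ x = c} = ∅ := by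
    ext c
    simp [h]
  rw [snd, this, ofSet_empty, unique_empty]

theorem empty_ne_kpair (a b : HF α) : (∅ : HF α) ≠ kpair a b := by
  intro h
  exact not_mem_empty (pair a a) (h ▸ mem_kpair.2 (Or.inl rfl))

theorem singleton_empty_ne_kpair (a b : HF α) : pair (∅ : HF α) ∅ ≠ kpair a b := by
  intro h
  have h1 : pair a a ∈ pair (∅ : HF α) ∅ := h ▸ mem_kpair.2 (Or.inl rfl)
  have h2 : pair a a = (∅ : HF α) := by simpa using h1
  exact not_mem_empty a (h2 ▸ mem_pair.2 (Or.inl rfl))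

theorem singleton_empty_ne_empty : pair (∅ : HF α) ∅ ≠ ∅ := by
  intro h
  exact not_mem_empty (∅ : HF α) (by
    have : (∅ : HF α) ∈ pair (∅ : HF α) ∅ := by simp
    rwa [h] at this)

theorem finite_image_set (a : HF α) (P : HF α → Prop) (f : HF α → HF α) :
    {c | ∃ b, b ∈ a ∧ P b ∧ f b = c}.Finite := by
  refine ((finite_members a).image f).subset ?_
  rintro _ ⟨b, hb, -, rfl⟩
  exact ⟨b, hb, rfl⟩

end HF

namespace BGS

variable {L : Language}

namespace Formula

/-- Truth. -/
def tt : Formula L := .eq .empty .empty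

/-- Disjunction. -/
def or (Φ Ψ : Formula L) : Formula L := .not (.and (.not Φ) (.not Ψ))

/-- Membership. -/
def mem (s t : Term L) : Formula L := .eq (.union (.pair (.pair s s) t)) t

/-- Bounded existential quantification. -/
def ex (y : ℕ) (t : Term L) (Φ : Formula L) : Formula L :=
  .not (.eq (.compr .empty y t Φ) .empty)

/-- A formula whose value is always `†`. -/
def fail : Formula L := .wsc 0 0 .empty (.pair .empty .empty) .empty tt

/-- The formula `Φ` with `x` evaluated to `t`. -/
def subst (x : ℕ) (t : Term L) (Φ : Formula L) : Formula L := ex x (.pair t t) Φ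

end Formula

namespace Term

/-- Kuratowski pairs. -/
def kpair (s t : Term L) : Term L := .pair (.pair s s) (.pair s t)

/-- Binary unions. -/
def cup (s t : Term L) : Term L := .union (.pair s t)

/-- Successors of ordinals. -/
def succ (s : Term L) : Term L := cup s (.pair s s)

/-- Case distinction; `w` may be any variable. -/
def ite (w : ℕ) (Φ : Formula L) (s t : Term L) : Term L :=
  .unique (cup (.compr s w (.pair (.var w) (.var w)) Φ)
    (.compr t w (.pair (.var w) (.var w)) (.not Φ)))

/-- A term whose value is always `†`. -/
def fail : Term L := .compr .empty 0 (.pair .empty .empty) .fail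

/-- The term `s` with `x` evaluated to `t`. -/
def subst (x : ℕ) (t s : Term L) : Term L := .unique (.compr s x (.pair t t) .tt)

/-- The first component of the pair `z`. -/
def fst (z : ℕ) : Term L :=
  .unique (.compr (.var (z + 1)) (z + 1) (.union (.var z))
    (.ex (z + 2) (.union (.var z)) (.eq (.var z) (kpair (.var (z + 1)) (.var (z + 2))))))

/-- The second component of the pair `z`. -/
def snd (z : ℕ) : Term L :=
  .unique (.compr (.var (z + 1)) (z + 1) (.union (.var z))
    (.ex (z + 2) (.union (.var z)) (.eq (.var z) (kpair (.var (z + 2)) (.var (z + 1))))))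

/-- The transitive closure of `z`. -/
def tc (z : ℕ) : Term L :=
  .iter (cup (cup (.var z) (.var (z + 1))) (.union (.var (z + 1)))) (z + 1)

end Term

/-- The transitive closure of `z` has at most as many elements as the ordinal `b`. -/
def Formula.small (b : Term L) (z : ℕ) : Formula L :=
  .or (.eq (.card (.var z)) .empty)
    (.and (.not (.eq (.tc z) .empty)) (.mem (.card (.tc z)) b.succ))

section FreeVariables

open Set

@[simp] theorem fv_tt : (Formula.tt : Formula L).fv = ∅ := by simp [Formula.tt, Formula.fv, Term.fv]

@[simp] theorem fv_or (Φ Ψ : Formula L) : (Formula.or Φ Ψ).fv = Φ.fv ∪ Ψ.fv := by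
  simp [Formula.or, Formula.fv]

@[simp] theorem fv_mem (s t : Term L) : (Formula.mem s t).fv = s.fv ∪ t.fv := by
  simp [Formula.mem, Formula.fv, Term.fv]

@[simp] theorem fv_ex (y : ℕ) (t : Term L) (Φ : Formula L) :
    (Formula.ex y t Φ).fv = t.fv ∪ (Φ.fv \ {y}) := by
  simp [Formula.ex, Formula.fv, Term.fv]

@[simp] theorem fv_fail : (Formula.fail : Formula L).fv = ∅ := by
  simp [Formula.fail, Formula.fv, Term.fv]

@[simp] theorem fv_subst (x : ℕ) (t : Term L) (Φ : Formula L) :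
    (Formula.subst x t Φ).fv = t.fv ∪ (Φ.fv \ {x}) := by
  simp [Formula.subst, Term.fv]

@[simp] theorem fv_kpair (s t : Term L) : (Term.kpair s t).fv = s.fv ∪ t.fv := by
  simp [Term.kpair, Term.fv, ← union_assoc]

@[simp] theorem fv_cup (s t : Term L) : (Term.cup s t).fv = s.fv ∪ t.fv := by
  simp [Term.cup, Term.fv]

@[simp] theorem fv_succ (s : Term L) : (Term.succ s).fv = s.fv := by
  simp [Term.succ, Term.fv]

@[simp] theorem fv_ite (w : ℕ) (Φ : Formula L) (s t : Term L) :
    (Term.ite w Φ s t).fv = {w} ∪ (Φ.fv ∪ s.fv ∪ t.fv) := by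
  ext x
  simp only [Term.ite, Term.fv, fv_cup, Formula.fv, mem_union, mem_sdiff, mem_singleton_iff]
  tauto

@[simp] theorem fv_term_fail : (Term.fail : Term L).fv = ∅ := by
  simp [Term.fail, Term.fv]

@[simp] theorem fv_term_subst (x : ℕ) (t s : Term L) :
    (Term.subst x t s).fv = t.fv ∪ (s.fv \ {x}) := by
  simp [Term.subst, Term.fv, union_comm]

@[simp] theorem fv_fst (z : ℕ) : (Term.fst z : Term L).fv = {z} := by
  ext x
  simp only [Term.fst, Term.fv, fv_ex, Formula.fv, fv_kpair, mem_union, mem_sdiff,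
    mem_singleton_iff]
  omega

@[simp] theorem fv_snd (z : ℕ) : (Term.snd z : Term L).fv = {z} := by
  ext x
  simp only [Term.snd, Term.fv, fv_ex, Formula.fv, fv_kpair, mem_union, mem_sdiff,
    mem_singleton_iff]
  omega

@[simp] theorem fv_tc (z : ℕ) : (Term.tc z : Term L).fv = {z} := by
  ext x
  simp only [Term.tc, Term.fv, fv_cup, mem_union, mem_sdiff, mem_singleton_iff]
  omega

@[simp] theorem fv_small (b : Term L) (z : ℕ) : (Formula.small b z).fv = b.fv ∪ {z} := by
  ext x
  simp only [Formula.small, Term.fv, fv_or, fv_mem, fv_succ, Formula.fv, fv_tc, mem_union,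
    mem_singleton_iff, mem_empty_iff_false]
  tauto

end FreeVariables

section Evaluation

open HF

variable {α : Type}

theorem comprEval_eq {a : HF α} {Φ : HF α → Option Prop} {s : HF α → Option (HF α)}
    {P : HF α → Prop} {f : HF α → HF α} (hΦ : ∀ b, b ∈ a → Φ b = some (P b))
    (hs : ∀ b, b ∈ a → P b → s b = some (f b)) :
    comprEval a Φ s = some (ofSet {c | ∃ b, b ∈ a ∧ P b ∧ f b = c}) := by
  have h : ¬ ∃ b ∈ a, Φ b = none ∨ ((∃ p, Φ b = some p ∧ p) ∧ s b = none) := by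
    rintro ⟨b, hb, h⟩
    rw [hΦ b hb] at h
    rcases h with h | ⟨⟨p, hp, hp'⟩, h⟩
    · cases h
    · cases hp
      rw [hs b hb hp'] at h
      cases h
  rw [comprEval, if_neg h]
  congr 2
  ext c
  constructor
  · rintro ⟨b, hb, ⟨p, hp, hp'⟩, h⟩
    rw [hΦ b hb] at hp
    cases hp
    rw [hs b hb hp'] at h
    exact ⟨b, hb, hp', Option.some_injective _ h⟩
  · rintro ⟨b, hb, hP, rfl⟩
    exact ⟨b, hb, ⟨_, hΦ b hb, hP⟩, hs b hb hP⟩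

theorem comprEval_singleton_none (c : HF α) {Φ : HF α → Option Prop} {s : HF α → Option (HF α)}
    (h : Φ c = none ∨ ((∃ p, Φ c = some p ∧ p) ∧ s c = none)) :
    comprEval (HF.pair c c) Φ s = none := by
  rw [comprEval, if_pos ⟨c, by simp, h⟩]

theorem comprEval_singleton_some (c : HF α) {Φ : HF α → Option Prop} {s : HF α → Option (HF α)}
    {p : Prop} {d : HF α} (h : Φ c = some p) (hp : p) (hs : s c = some d) :
    comprEval (HF.pair c c) Φ s = some (HF.pair d d) := by
  rw [comprEval_eq (P := fun _ => p) (f := fun _ => d)]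
  · congr 1
    refine (isSet_ofSet _).ext (isSet_pair _ _) fun z => ?_
    rw [mem_ofSet (finite_image_set _ _ _)]
    simp only [Set.mem_ofPred_eq, mem_pair]
    constructor
    · rintro ⟨b, -, -, rfl⟩; simp
    · intro h; exact ⟨c, by simp, hp, by tauto⟩
  · simpa using h
  · simpa using fun _ => hs

theorem comprEval_singleton_false (c : HF α) {Φ : HF α → Option Prop} {s : HF α → Option (HF α)}
    {p : Prop} (h : Φ c = some p) (hp : ¬ p) : comprEval (HF.pair c c) Φ s = some ∅ := by
  rw [comprEval_eq (P := fun _ => p) (f := fun _ => ∅)]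
  · congr 1
    refine eq_empty (isSet_ofSet _) fun z => ?_
    rw [mem_ofSet (finite_image_set _ _ _)]
    rintro ⟨b, -, hb, -⟩
    exact hp hb
  · simpa using h
  · exact fun _ _ h => absurd h hp

variable [L.Structure α] {N : ℕ} {ρ : ℕ → HF α}

@[simp]
theorem eval_tt : (Formula.tt : Formula L).eval N ρ = some True := by
  simp [Formula.tt, Formula.eval, Term.eval]

theorem eval_or {Φ Ψ : Formula L} {p q : Prop} (h1 : Φ.eval N ρ = some p)
    (h2 : Ψ.eval N ρ = some q) : (Formula.or Φ Ψ).eval N ρ = some (p ∨ q) := by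
  simp only [Formula.or, Formula.eval, h1, h2, Option.map_some, Option.bind_some]
  congr 1
  rw [eq_iff_iff]
  tauto

theorem eval_and {Φ Ψ : Formula L} {p q : Prop} (h1 : Φ.eval N ρ = some p)
    (h2 : Ψ.eval N ρ = some q) : (Formula.and Φ Ψ).eval N ρ = some (p ∧ q) := by
  simp only [Formula.eval, h1, h2, Option.map_some, Option.bind_some]

theorem eval_not {Φ : Formula L} {p : Prop} (h1 : Φ.eval N ρ = some p) :
    (Formula.not Φ).eval N ρ = some (¬ p) := by
  simp only [Formula.eval, h1, Option.map_some]

theorem eval_eq {s t : Term L} {a b : HF α} (h1 : s.eval N ρ = some a)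
    (h2 : t.eval N ρ = some b) : (Formula.eq s t).eval N ρ = some (a = b) := by
  simp only [Formula.eval, h1, h2, Option.map_some, Option.bind_some]

theorem eval_mem {s t : Term L} {a b : HF α} (h1 : s.eval N ρ = some a)
    (h2 : t.eval N ρ = some b) : (Formula.mem s t).eval N ρ = some (a ∈ b) := by
  simp only [Formula.mem, Formula.eval, Term.eval, h1, h2, Option.map_some, Option.bind_some]
  congr 1
  rw [eq_iff_iff]
  exact cup_singleton_eq_iff

theorem eval_compr {s t : Term L} {y : ℕ} {Φ : Formula L} {a : HF α} {P : HF α → Prop}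
    {f : HF α → HF α} (ht : t.eval N ρ = some a)
    (hΦ : ∀ b, b ∈ a → Φ.eval N (Function.update ρ y b) = some (P b))
    (hs : ∀ b, b ∈ a → P b → s.eval N (Function.update ρ y b) = some (f b)) :
    (Term.compr s y t Φ).eval N ρ = some (ofSet {c | ∃ b, b ∈ a ∧ P b ∧ f b = c}) := by
  rw [Term.eval, ht, Option.bind_some]
  exact comprEval_eq hΦ hs

theorem eval_ex {t : Term L} {y : ℕ} {Φ : Formula L} {a : HF α} {P : HF α → Prop}
    (ht : t.eval N ρ = some a)
    (hΦ : ∀ b, b ∈ a → Φ.eval N (Function.update ρ y b) = some (P b)) :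
    (Formula.ex y t Φ).eval N ρ = some (∃ b, b ∈ a ∧ P b) := by
  have h := eval_compr (s := Term.empty) (f := fun _ => ∅) ht hΦ (fun _ _ _ => rfl)
  refine (eval_not (eval_eq h rfl)).trans ?_
  congr 1
  rw [eq_iff_iff]
  constructor
  · intro h1
    by_contra h2
    refine h1 (eq_empty (isSet_ofSet _) fun z hz => h2 ?_)
    obtain ⟨b, hb, hP, -⟩ := (mem_ofSet (finite_image_set _ _ _)).1 hz
    exact ⟨b, hb, hP⟩
  · rintro ⟨b, hb, hP⟩ h2
    exact not_mem_empty ∅ (h2 ▸ (mem_ofSet (finite_image_set _ _ _)).2 ⟨b, hb, hP, rfl⟩)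

@[simp]
theorem eval_var (x : ℕ) : (Term.var x : Term L).eval N ρ = some (ρ x) := rfl

theorem eval_pair {s t : Term L} {a b : HF α} (h1 : s.eval N ρ = some a)
    (h2 : t.eval N ρ = some b) : (Term.pair s t).eval N ρ = some (HF.pair a b) := by
  simp only [Term.eval, h1, h2, Option.map_some, Option.bind_some]

theorem eval_kpair {s t : Term L} {a b : HF α} (h1 : s.eval N ρ = some a)
    (h2 : t.eval N ρ = some b) : (Term.kpair s t).eval N ρ = some (HF.kpair a b) :=
  eval_pair (eval_pair h1 h1) (eval_pair h1 h2)

theorem eval_union {s : Term L} {a : HF α} (h1 : s.eval N ρ = some a) :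
    (Term.union s).eval N ρ = some (HF.sUnion a) := by
  simp only [Term.eval, h1, Option.map_some]

theorem eval_unique {s : Term L} {a : HF α} (h1 : s.eval N ρ = some a) :
    (Term.unique s).eval N ρ = some (HF.unique a) := by
  simp only [Term.eval, h1, Option.map_some]

theorem eval_card {s : Term L} {a : HF α} (h1 : s.eval N ρ = some a) :
    (Term.card s).eval N ρ = some (HF.card a) := by
  simp only [Term.eval, h1, Option.map_some]

theorem eval_cup {s t : Term L} {a b : HF α} (h1 : s.eval N ρ = some a)
    (h2 : t.eval N ρ = some b) : (Term.cup s t).eval N ρ = some (HF.cup a b) :=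
  eval_union (eval_pair h1 h2)

theorem eval_succ {s : Term L} {a : HF α} (h1 : s.eval N ρ = some a) :
    (Term.succ s).eval N ρ = some (HF.succ a) :=
  eval_cup h1 (eval_pair h1 h1)

open Classical in
theorem eval_ite {w : ℕ} {Φ : Formula L} {s t : Term L} {p : Prop} (h : Φ.eval N ρ = some p) :
    (Term.ite w Φ s t).eval N ρ = if p then s.eval N ρ else t.eval N ρ := by
  have hw : ∀ x, x = ρ w → Function.update ρ w x = ρ := fun x hx => by
    rw [hx, Function.update_eq_self]
  have hcup : ∀ d : HF α, HF.unique (HF.cup (HF.pair d d) ∅) = d ∧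
      HF.unique (HF.cup ∅ (HF.pair d d)) = d := fun d =>
    ⟨unique_eq (isSet_cup _ _) fun z => by simp [not_mem_empty],
      unique_eq (isSet_cup _ _) fun z => by simp [not_mem_empty]⟩
  have hN : (Formula.not Φ).eval N ρ = some (¬ p) := eval_not h
  have hwt : (Term.pair (.var w) (.var w) : Term L).eval N ρ = some (HF.pair (ρ w) (ρ w)) :=
    eval_pair rfl rfl
  have hwρ := hw (ρ w) rfl
  by_cases hp : p
  · rw [if_pos hp]
    have h2 : (Term.compr t w (.pair (.var w) (.var w)) (.not Φ)).eval N ρ = some ∅ := by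
      rw [Term.eval, hwt, Option.bind_some]
      exact comprEval_singleton_false (p := ¬ p) _ (by rw [hwρ, hN]) (not_not.2 hp)
    rcases hs : s.eval N ρ with _ | d
    · have h1 : (Term.compr s w (.pair (.var w) (.var w)) Φ).eval N ρ = none := by
        rw [Term.eval, hwt, Option.bind_some]
        exact comprEval_singleton_none _ (Or.inr ⟨⟨p, by rw [hwρ, h], hp⟩, by rw [hwρ, hs]⟩)
      simp only [Term.ite, Term.cup]
      rw [Term.eval, Term.eval, Term.eval, h1]
      rfl
    · have h1 : (Term.compr s w (.pair (.var w) (.var w)) Φ).eval N ρ = some (HF.pair d d) := by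
        rw [Term.eval, hwt, Option.bind_some]
        exact comprEval_singleton_some (p := p) _ (by rw [hwρ, h]) hp (by rw [hwρ, hs])
      refine (eval_unique (eval_cup h1 h2)).trans ?_
      rw [(hcup d).1]
  · rw [if_neg hp]
    have h2 : (Term.compr s w (.pair (.var w) (.var w)) Φ).eval N ρ = some ∅ := by
      rw [Term.eval, hwt, Option.bind_some]
      exact comprEval_singleton_false (p := p) _ (by rw [hwρ, h]) hp
    rcases hs : t.eval N ρ with _ | d
    · have h1 : (Term.compr t w (.pair (.var w) (.var w)) (.not Φ)).eval N ρ = none := by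
        rw [Term.eval, hwt, Option.bind_some]
        exact comprEval_singleton_none _ (Or.inr ⟨⟨¬ p, by rw [hwρ, hN], hp⟩, by rw [hwρ, hs]⟩)
      simp only [Term.ite, Term.cup]
      rw [Term.eval, Term.eval, Term.eval, h1, h2]
      rfl
    · have h1 : (Term.compr t w (.pair (.var w) (.var w)) (.not Φ)).eval N ρ =
          some (HF.pair d d) := by
        rw [Term.eval, hwt, Option.bind_some]
        exact comprEval_singleton_some (p := ¬ p) _ (by rw [hwρ, hN]) hp (by rw [hwρ, hs])
      refine (eval_unique (eval_cup h2 h1)).trans ?_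
      rw [(hcup d).2]

theorem eval_subst {x : ℕ} {s t : Term L} {a : HF α} (h : t.eval N ρ = some a) :
    (Term.subst x t s).eval N ρ = s.eval N (Function.update ρ x a) := by
  rcases hs : s.eval N (Function.update ρ x a) with _ | d
  · rw [Term.subst, Term.eval, Term.eval, eval_pair h h, Option.bind_some,
      comprEval_singleton_none _ (Or.inr ⟨⟨True, eval_tt, trivial⟩, hs⟩), Option.map_none]
  · rw [Term.subst, Term.eval, Term.eval, eval_pair h h, Option.bind_some,
      comprEval_singleton_some _ eval_tt trivial hs, Option.map_some, unique_pair_self]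

theorem eval_formula_subst {x : ℕ} {Φ : Formula L} {t : Term L} {a : HF α}
    (h : t.eval N ρ = some a) :
    (Formula.subst x t Φ).eval N ρ = Φ.eval N (Function.update ρ x a) := by
  rcases hs : Φ.eval N (Function.update ρ x a) with _ | p
  · have h1 : (Term.compr .empty x (.pair t t) Φ).eval N ρ = none := by
      rw [Term.eval, eval_pair h h, Option.bind_some, comprEval_singleton_none _ (Or.inl hs)]
    rw [Formula.subst, Formula.ex, Formula.eval, Formula.eval, h1]
    rfl
  · rw [Formula.subst, eval_ex (P := fun _ => p) (eval_pair h h)]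
    · simp
    · intro b hb
      have : b = a := by simpa using hb
      rw [this, hs]

theorem eval_fst (z : ℕ) : (Term.fst z : Term L).eval N ρ = some (HF.fst (ρ z)) := by
  refine eval_unique (eval_compr (P := fun b => ∃ d, d ∈ HF.sUnion (ρ z) ∧ ρ z = HF.kpair b d)
    (f := fun b => b) (eval_union rfl) (fun b _ => ?_) (fun b _ _ => by simp))
  refine eval_ex ?_ fun d _ => ?_
  · have := eval_union (N := N) (ρ := Function.update ρ (z + 1) b) (eval_var (L := L) z)
    simpa using this
  · refine (eval_eq rfl (eval_kpair rfl rfl)).trans ?_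
    simp

theorem eval_snd (z : ℕ) : (Term.snd z : Term L).eval N ρ = some (HF.snd (ρ z)) := by
  refine eval_unique (eval_compr (P := fun b => ∃ d, d ∈ HF.sUnion (ρ z) ∧ ρ z = HF.kpair d b)
    (f := fun b => b) (eval_union rfl) (fun b _ => ?_) (fun b _ _ => by simp))
  refine eval_ex ?_ fun d _ => ?_
  · have := eval_union (N := N) (ρ := Function.update ρ (z + 1) b) (eval_var (L := L) z)
    simpa using this
  · refine (eval_eq rfl (eval_kpair rfl rfl)).trans ?_
    simp

theorem eval_fail : (Formula.fail : Formula L).eval N ρ = none := by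
  rw [Formula.fail, Formula.eval, wscEval, if_pos]
  refine Or.inl (Or.inr (Or.inr ⟨∅, [], ?_, fun h => ?_⟩))
  · exact Run.next (Y := HF.pair ∅ ∅) (e := ∅) Run.root (by simp) rfl (Or.inl (by simp)) rfl
  · obtain ⟨M, Y, hM, hY, -, h⟩ := h ∅ [] List.suffix_rfl
    cases hM
    cases hY
    obtain ⟨φ, -, hφ, -⟩ := h ∅ (by simp) ∅ (by simp)
    exact not_mem_empty _ hφ

theorem eval_term_fail : (Term.fail : Term L).eval N ρ = none := by
  rw [Term.fail, Term.eval, show (Term.pair .empty .empty : Term L).eval N ρ =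
    some (HF.pair ∅ ∅) from rfl, Option.bind_some, comprEval_singleton_none _ (Or.inl eval_fail)]

/-! ### Transitive closures -/

theorem iterate_tc (N : ℕ) (a : HF α) (r : ℕ) : ∀ X : HF α, IsSet X →
    (∀ c, c ∈ X → c ∈ HF.tc a) → ∃ T,
    iterate N (fun X => some (HF.cup (HF.cup a X) (HF.sUnion X))) r X = some T ∧
    (T = ∅ ∨ T = ofSet (HF.tc a)) ∧
    ((HF.tc a).ncard ≤ N → (HF.tc a).ncard ≤ {c | c ∈ X}.ncard + r → T = ofSet (HF.tc a)) := by
  have hf := finite_tc a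
  have hsmall : ∀ X : HF α, (∀ c, c ∈ X → c ∈ HF.tc a) → (HF.tc a).ncard ≤ N → Small N X :=
    fun X hXa h => HF.small_iff.2 ((Set.ncard_le_ncard
      (tc_subset hXa fun c hc d hd => mem_tc_of_mem_tc hd hc) hf).trans h)
  have hstep : ∀ X : HF α, (∀ c, c ∈ X → c ∈ HF.tc a) →
      ∀ c, c ∈ HF.cup (HF.cup a X) (HF.sUnion X) → c ∈ HF.tc a := by
    intro X hXa c hc
    simp only [HF.mem_cup, HF.mem_sUnion] at hc
    rcases hc with (hc | hc) | ⟨d, hd, hc⟩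
    · exact mem_tc_of_mem hc
    · exact hXa c hc
    · exact mem_tc_of_mem_tc hc (hXa d hd)
  have hfix : ∀ X : HF α, IsSet X → (∀ c, c ∈ X → c ∈ HF.tc a) →
      HF.cup (HF.cup a X) (HF.sUnion X) = X → X = ofSet (HF.tc a) := by
    intro X hX hXa h
    refine hX.ext (isSet_ofSet _) fun z => ?_
    rw [mem_ofSet hf]
    refine ⟨hXa z, fun hz => ?_⟩
    refine tc_subset (S := {c | c ∈ X}) (fun c hc => ?_) (fun c hc d hd => ?_) hz
    · change c ∈ X
      rw [← h]
      simp [hc]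
    · change d ∈ X
      rw [← h]
      simp only [HF.mem_cup, HF.mem_sUnion]
      exact Or.inr ⟨c, hc, hd⟩
  have hgrow : ∀ X : HF α, IsSet X → HF.cup (HF.cup a X) (HF.sUnion X) ≠ X →
      {c | c ∈ X}.ncard < {c | c ∈ HF.cup (HF.cup a X) (HF.sUnion X)}.ncard := by
    intro X hX h
    have hsub : ∀ z, z ∈ X → z ∈ HF.cup (HF.cup a X) (HF.sUnion X) := fun z hz => by
      simp only [HF.mem_cup]
      exact Or.inl (Or.inr hz)
    exact Set.ncard_lt_ncard ⟨hsub, fun h' => h ((isSet_cup _ _).ext hX fun z =>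
      ⟨fun hz => h' hz, hsub z⟩)⟩ (finite_members _)
  induction r with
  | zero =>
    intro X hX hXa
    unfold iterate
    by_cases hs : Small N X
    · rw [if_pos hs]
      by_cases h : HF.cup (HF.cup a X) (HF.sUnion X) = X
      · exact ⟨X, by simp [h], Or.inr (hfix X hX hXa h), fun _ _ => hfix X hX hXa h⟩
      · refine ⟨∅, by simp [h], Or.inl rfl, fun _ h2 => ?_⟩
        have h3 := hgrow X hX h
        have h4 := Set.ncard_le_ncard (hstep X hXa) hf
        have h5 : {c | c ∈ HF.cup (HF.cup a X) (HF.sUnion X)}.ncard ≤ (HF.tc a).ncard := h4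
        omega
    · rw [if_neg hs]
      exact ⟨∅, rfl, Or.inl rfl, fun h => absurd (hsmall X hXa h) hs⟩
  | succ r ih =>
    intro X hX hXa
    unfold iterate
    by_cases hs : Small N X
    · rw [if_pos hs]
      simp only [Option.bind_some]
      by_cases h : HF.cup (HF.cup a X) (HF.sUnion X) = X
      · rw [if_pos h]
        exact ⟨X, rfl, Or.inr (hfix X hX hXa h), fun _ _ => hfix X hX hXa h⟩
      · rw [if_neg h]
        have h3 := hgrow X hX h
        obtain ⟨T, h5, h6, h7⟩ := ih _ (isSet_cup _ _) (hstep X hXa)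
        exact ⟨T, h5, h6, fun h8 h9 => h7 h8 (by omega)⟩
    · rw [if_neg hs]
      exact ⟨∅, rfl, Or.inl rfl, fun h => absurd (hsmall X hXa h) hs⟩

theorem eval_tc (z : ℕ) : ∃ T, (Term.tc z : Term L).eval N ρ = some T ∧
    (T = ∅ ∨ T = ofSet (HF.tc (ρ z))) ∧
    ((HF.tc (ρ z)).ncard ≤ N → T = ofSet (HF.tc (ρ z))) := by
  obtain ⟨T, h1, h2, h3⟩ := iterate_tc N (ρ z) N ∅ isSet_empty fun c hc =>
    absurd hc (not_mem_empty c)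
  refine ⟨T, ?_, h2, fun h => h3 h (by omega)⟩
  rw [← h1, Term.tc, Term.eval]
  congr 1
  funext X
  refine (eval_cup (eval_cup rfl rfl) (eval_union rfl)).trans ?_
  simp

theorem eval_small {b : Term L} {z M : ℕ} (hb : b.eval N ρ = some (ofNat M)) (hM : M ≤ N) :
    (Formula.small b z).eval N ρ = some (Small M (ρ z)) := by
  obtain ⟨T, h1, h2, h3⟩ := eval_tc (L := L) (N := N) (ρ := ρ) z
  refine (eval_or (eval_eq (eval_card rfl) rfl) (eval_and (eval_not (eval_eq h1 rfl))
    (eval_mem (eval_card h1) (eval_succ hb)))).trans ?_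
  congr 1
  rw [eq_iff_iff, HF.small_iff, card_eq_empty_iff, succ_ofNat]
  have hf := finite_tc (ρ z)
  constructor
  · rintro (h | ⟨h4, h5⟩)
    · have : HF.tc (ρ z) = ∅ := by
        rw [tc_eq_biUnion]
        simp [h]
      simp [this]
    · have hT := h2.resolve_left h4
      rw [hT, card_ofSet hf, ofNat_mem_ofNat] at h5
      omega
  · intro h
    by_cases he : ∀ x, ¬ x ∈ ρ z
    · exact Or.inl he
    · right
      have hT := h3 (h.trans hM)
      push Not at he
      obtain ⟨x, hx⟩ := he
      constructor
      · rintro rfl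
        exact not_mem_empty x (hT ▸ (mem_ofSet hf).2 (mem_tc_of_mem hx))
      · rw [hT, card_ofSet hf, ofNat_mem_ofNat]
        omega

end Evaluation

end BGS

namespace BGS

open HF

/-! ## Simulation of a bound by a larger bound -/

section Stages

variable {α : Type}

/-- The pair of a stage number and a stage; the initial stage `∅` represents itself. -/
noncomputable def stage : ℕ → HF α → HF α
  | 0, _ => ∅
  | i + 1, a => kpair (ofNat (i + 1)) a

@[simp]
theorem fst_stage (i : ℕ) (a : HF α) : fst (stage i a) = ofNat i := by
  cases i with
  | zero => exact fst_eq_empty empty_ne_kpair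
  | succ i => exact fst_kpair _ _

theorem snd_stage {i : ℕ} {a : HF α} (h : i = 0 → a = ∅) : snd (stage i a) = a := by
  cases i with
  | zero => rw [h rfl]; exact snd_eq_empty empty_ne_kpair
  | succ i => exact snd_kpair _ _

theorem stage_ne_of_ne {i j : ℕ} (h : i ≠ j) (a b : HF α) : stage i a ≠ stage j b := by
  intro h1
  have h2 := congrArg fst h1
  rw [fst_stage, fst_stage, ofNat_inj] at h2
  exact h h2

theorem stage_ne_singleton (i : ℕ) (a : HF α) : stage i a ≠ pair ∅ ∅ := by
  cases i with
  | zero => exact singleton_empty_ne_empty.symm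
  | succ i => exact (singleton_empty_ne_kpair _ _).symm

theorem small_stage {i N Q : ℕ} {a : HF α} (ha : Small N a) (hi : i ≤ N + 1)
    (hQ : 4 * N + 20 ≤ Q) : Small Q (stage i a) := by
  cases i with
  | zero => exact small_empty Q
  | succ i =>
    rw [HF.small_iff] at ha ⊢
    have h1 := ncard_tc_kpair (ofNat (i + 1)) a
    have h2 := ncard_tc_ofNat (α := α) (i + 1)
    rw [stage]
    omega

theorem map_stage_eq_iff {i : ℕ} {a : HF α} (h : i = 0 → a = ∅) (f : α → α) :
    map f (stage i a) = stage i a ↔ map f a = a := by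
  cases i with
  | zero => simp [stage, h rfl]
  | succ i => simp [stage, kpair_inj]

end Stages

section Iterate

variable {α : Type}

open Classical in
/-- The step function on numbered stages which simulates the iteration of `f`. -/
noncomputable def countedStep (N : ℕ) (f : HF α → Option (HF α)) (z : HF α) : Option (HF α) :=
  if z = pair ∅ ∅ then some (pair ∅ ∅)
  else (f (snd z)).map fun b => if b = snd z then z
    else if succ (fst z) ∈ succ (ofNat N : HF α) ∧ Small N b then kpair (succ (fst z)) b
    else pair ∅ ∅

theorem iterate_of_not_small {N r : ℕ} {f : HF α → Option (HF α)} {a : HF α} (h : ¬ Small N a) :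
    iterate N f r a = some ∅ := by
  cases r <;> rw [iterate, if_neg h]

theorem iterate_countedStep {N Q : ℕ} (hQ : 4 * N + 20 ≤ Q) (f : HF α → Option (HF α)) (r : ℕ) :
    ∀ (i R : ℕ) (a : HF α), i + r = N → r + 2 ≤ R → Small N a → (i = 0 → a = ∅) →
      (iterate Q (countedStep N f) R (stage i a)).map snd = iterate N f r a := by
  have herr : ∀ R, (iterate Q (countedStep N f) (R + 1) (pair (∅ : HF α) ∅)).map snd = some ∅ := by
    intro R
    have hs : Small Q (pair (∅ : HF α) ∅) := by
      rw [HF.small_iff]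
      have := ncard_tc_pair (∅ : HF α) ∅
      rw [tc_empty, Set.ncard_empty] at this
      omega
    rw [iterate, if_pos hs, countedStep, if_pos rfl, Option.bind_some, if_pos rfl, Option.map_some,
      snd_eq_empty singleton_empty_ne_kpair]
  induction r with
  | zero =>
    rintro i R a hi hR ha h0
    obtain ⟨R, rfl⟩ : ∃ R', R = R' + 1 + 1 := ⟨R - 2, by omega⟩
    rw [iterate, iterate, if_pos (small_stage ha (by omega) hQ), if_pos ha, countedStep,
      if_neg (stage_ne_singleton i a), snd_stage h0, fst_stage, succ_ofNat, succ_ofNat,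
      ofNat_mem_ofNat]
    rcases f a with _ | b
    · rfl
    · simp only [Option.map_some, Option.bind_some]
      by_cases hb : b = a
      · rw [if_pos hb, if_pos rfl, if_pos hb, Option.map_some, snd_stage h0]
      · rw [if_neg hb, if_neg (show ¬ (i + 1 < N + 1 ∧ Small N b) from fun h => by omega),
          if_neg (stage_ne_singleton i a).symm, herr, if_neg hb]
  | succ r ih =>
    rintro i R a hi hR ha h0
    obtain ⟨R, rfl⟩ : ∃ R', R = R' + 1 + 1 := ⟨R - 2, by omega⟩
    rw [iterate, iterate, if_pos (small_stage ha (by omega) hQ), if_pos ha, countedStep,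
      if_neg (stage_ne_singleton i a), snd_stage h0, fst_stage, succ_ofNat, succ_ofNat,
      ofNat_mem_ofNat]
    rcases f a with _ | b
    · rfl
    · simp only [Option.map_some, Option.bind_some]
      by_cases hb : b = a
      · rw [if_pos hb, if_pos rfl, if_pos hb, Option.map_some, snd_stage h0]
      · rw [if_neg hb, if_neg hb]
        by_cases hs : Small N b
        · rw [if_pos (show i + 1 < N + 1 ∧ Small N b from ⟨by omega, hs⟩)]
          have hne : kpair (ofNat (i + 1)) b ≠ stage i a :=
            stage_ne_of_ne (i := i + 1) (j := i) (by omega) b a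
          rw [if_neg hne]
          exact ih (i + 1) (R + 1) b (by omega) (by omega) hs (by omega)
        · rw [if_neg (show ¬ (i + 1 < N + 1 ∧ Small N b) from fun h => hs h.2),
            if_neg (stage_ne_singleton i a).symm, herr, iterate_of_not_small hs]

end Iterate

section Runs

variable {α : Type}

/-- The list of numbered stages of a computation. -/
noncomputable def stages : List (HF α) → List (HF α)
  | [] => []
  | b :: l => stage l.length b :: stages l

@[simp]
theorem length_stages : ∀ l : List (HF α), (stages l).length = l.length
  | [] => rfl
  | _ :: l => by simp [stages, length_stages l]

theorem mem_stages {x : HF α} : ∀ {l : List (HF α)}, x ∈ stages l →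
    ∃ i b, i < l.length ∧ b ∈ l ∧ x = stage i b
  | b :: l, h => by
    rcases List.mem_cons.1 h with rfl | h
    · exact ⟨l.length, b, by simp, by simp, rfl⟩
    · obtain ⟨i, b', h1, h2, h3⟩ := mem_stages h
      exact ⟨i, b', by simp; omega, by simp [h2], h3⟩

/-- The earliest stage is `∅`. -/
def Rooted (l : List (HF α)) : Prop := ∀ b l', (b :: l') <:+ l → l'.length = 0 → b = ∅

theorem Rooted.tail {b : HF α} {l : List (HF α)} (h : Rooted (b :: l)) : Rooted l :=
  fun c l' hs => h c l' (hs.trans (List.suffix_cons b l))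

theorem Rooted.head {b : HF α} {l : List (HF α)} (h : Rooted (b :: l)) : l.length = 0 → b = ∅ :=
  h b l List.suffix_rfl

theorem Run.rooted {step : HF α → HF α → Option (HF α)} {choice : HF α → Option (HF α)}
    {l : List (HF α)} (h : Run step choice l) : Rooted l := by
  induction h with
  | root =>
    intro b l' h _
    have h1 := List.suffix_cons_iff.1 h
    simp only [List.cons.injEq, List.suffix_nil, reduceCtorEq, or_false] at h1
    exact h1.1
  | next _ _ _ _ _ ih =>
    intro b l' h hl
    rcases List.suffix_cons_iff.1 h with h | h
    · rw [List.cons.injEq] at h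
      rw [h.2] at hl
      simp at hl
    · exact ih b l' h hl

theorem head_stages_ne (b : HF α) (l : List (HF α)) :
    (stages l).head? ≠ some (stage (l.length) b) := by
  cases l with
  | nil => simp [stages]
  | cons d l =>
    simp only [stages, List.head?_cons, ne_eq, Option.some.injEq]
    exact stage_ne_of_ne (by simp) d b

theorem suffix_stages_iff {b' : HF α} {l' : List (HF α)} : ∀ {m : List (HF α)},
    (b' :: l') <:+ stages m ↔ ∃ b l, (b :: l) <:+ m ∧ b' = stage l.length b ∧ l' = stages l
  | [] => by simp [stages]
  | c :: m => by
    rw [stages, List.suffix_cons_iff, suffix_stages_iff (m := m)]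
    constructor
    · rintro (h | ⟨b, l, h, h1⟩)
      · rw [List.cons.injEq] at h
        exact ⟨c, m, List.suffix_rfl, h⟩
      · exact ⟨b, l, h.trans (List.suffix_cons c m), h1⟩
    · rintro ⟨b, l, h, rfl, rfl⟩
      rcases List.suffix_cons_iff.1 h with h | h
      · rw [List.cons.injEq] at h
        obtain ⟨rfl, rfl⟩ := h
        exact Or.inl rfl
      · exact Or.inr ⟨b, l, h, rfl, rfl⟩

theorem map_stages_iff (f : α → α) : ∀ {l : List (HF α)}, Rooted l →
    ((∀ x ∈ stages l, map f x = x) ↔ ∀ x ∈ l, map f x = x)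
  | [], _ => by simp [stages]
  | b :: l, h => by
    rw [stages, List.forall_mem_cons, List.forall_mem_cons, map_stages_iff f h.tail,
      map_stage_eq_iff h.head]

variable {L : Language} [L.Structure α]

theorem stab_stages {P : Set (HF α)} {l : List (HF α)} (h : Rooted l) :
    stab L (P ∪ {x | x ∈ stages l}) = stab L (P ∪ {x | x ∈ l}) := by
  ext φ
  have h1 : ∀ S : Set (HF α), φ ∈ stab L (P ∪ S) ↔
      (∀ a ∈ P, HF.map φ a = a) ∧ ∀ a ∈ S, HF.map φ a = a := by
    intro S
    simp only [stab, Set.mem_union, Set.mem_ofPred_eq]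
    exact ⟨fun h => ⟨fun a ha => h a (Or.inl ha), fun a ha => h a (Or.inr ha)⟩,
      fun h a ha => ha.elim (h.1 a) (h.2 a)⟩
  rw [h1, h1]
  exact and_congr Iff.rfl (map_stages_iff φ h)

theorem witnessed_stages {P : Set (HF α)} {choice : HF α → Option (HF α)}
    {wit : HF α → HF α → Option (HF α)} {c : HF α} {l : List (HF α)} (h : Rooted (c :: l)) :
    Witnessed L P (fun z => choice (snd z)) (fun z w => wit (snd z) (snd w)) (stage l.length c)
      (stages (c :: l)) ↔ Witnessed L P choice wit c (c :: l) := by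
  have hr : ∀ b l', (b :: l') <:+ c :: l → Rooted (b :: l') := fun b l' hs d m hm =>
    h d m (hm.trans hs)
  unfold Witnessed
  constructor
  · intro hw b l' hs
    obtain ⟨M, Y, hM, hY, hO⟩ := hw _ _ (suffix_stages_iff.2 ⟨b, l', hs, rfl, rfl⟩)
    simp only [snd_stage h.head, snd_stage (hr b l' hs).head] at hM hY
    refine ⟨M, Y, hM, hY, ?_⟩
    rw [← stages] at hO
    unfold WitnessesOrbit at hO ⊢
    rwa [stab_stages (hr b l' hs)] at hO
  · intro hw b' l' hs
    obtain ⟨b, l', hs', rfl, rfl⟩ := suffix_stages_iff.1 hs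
    obtain ⟨M, Y, hM, hY, hO⟩ := hw b l' hs'
    refine ⟨M, Y, ?_, ?_, ?_⟩
    · simpa only [snd_stage h.head, snd_stage (hr b l' hs').head] using hM
    · simpa only [snd_stage (hr b l' hs').head] using hY
    · rw [← stages]
      unfold WitnessesOrbit at hO ⊢
      rwa [stab_stages (hr b l' hs')]

theorem exists_isChoice (Y : HF α) : ∃ e, IsChoice Y e := by
  by_cases h : ∀ x, ¬ x ∈ Y
  · exact ⟨∅, Or.inr ⟨h, rfl⟩⟩
  · push Not at h
    obtain ⟨x, hx⟩ := h
    exact ⟨x, Or.inl hx⟩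

open Classical in
/-- The step function on numbered stages which simulates the step function `step` of a fixed-point
operator with choice. -/
noncomputable def countedStep₂ (N : ℕ) (step : HF α → HF α → Option (HF α)) (z e : HF α) :
    Option (HF α) :=
  (step (snd z) e).bind fun d =>
    if succ (succ (fst z)) ∈ succ (ofNat N : HF α) ∧ Small N d then
      if d = snd z then some z else some (kpair (succ (fst z)) d)
    else none

theorem countedStep₂_stage {N : ℕ} {step : HF α → HF α → Option (HF α)} {i : ℕ} {a e : HF α}
    (h : i = 0 → a = ∅) {z : HF α} : countedStep₂ N step (stage i a) e = some z ↔
    ∃ d, step a e = some d ∧ i + 2 ≤ N ∧ Small N d ∧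
      ((d = a ∧ z = stage i a) ∨ (d ≠ a ∧ z = stage (i + 1) d)) := by
  rw [countedStep₂, snd_stage h, fst_stage, succ_ofNat, succ_ofNat, succ_ofNat, ofNat_mem_ofNat]
  rcases step a e with _ | d
  · simp
  · simp only [Option.bind_some, Option.some.injEq, exists_eq_left']
    by_cases h1 : i + 1 + 1 < N + 1 ∧ Small N d
    · rw [if_pos h1]
      by_cases hd : d = a
      · rw [if_pos hd, Option.some.injEq]
        have : i + 2 ≤ N := by omega
        simp [hd, hd ▸ h1.2, this, eq_comm]
      · rw [if_neg hd, Option.some.injEq]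
        have : i + 2 ≤ N := by omega
        simp [hd, h1.2, this, eq_comm, stage]
    · rw [if_neg h1]
      refine iff_of_false (by simp) ?_
      rintro ⟨h2, h3, -⟩
      exact h1 ⟨by omega, h3⟩

theorem countedStep₂_stage_eq_none {N : ℕ} {step : HF α → HF α → Option (HF α)} {i : ℕ}
    {a e : HF α} (h : i = 0 → a = ∅) : countedStep₂ N step (stage i a) e = none ↔
    ∀ d, step a e = some d → ¬ (i + 2 ≤ N ∧ Small N d) := by
  constructor
  · rintro h1 d hd ⟨h2, h3⟩
    by_cases hda : d = a
    · have := (countedStep₂_stage h).2 ⟨d, hd, h2, h3, Or.inl ⟨hda, rfl⟩⟩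
      rw [h1] at this
      cases this
    · have := (countedStep₂_stage h).2 ⟨d, hd, h2, h3, Or.inr ⟨hda, rfl⟩⟩
      rw [h1] at this
      cases this
  · intro h1
    by_contra h2
    obtain ⟨z, hz⟩ := Option.ne_none_iff_exists'.1 h2
    obtain ⟨d, hd, h3, h4, -⟩ := (countedStep₂_stage h).1 hz
    exact h1 d hd ⟨h3, h4⟩

variable {N Q : ℕ} {P : Set (HF α)} {step wit : HF α → HF α → Option (HF α)}
  {choice : HF α → Option (HF α)} {out : HF α → Option Prop}

theorem run_of_run_counted {l' : List (HF α)}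
    (h : Run (countedStep₂ N step) (fun z => choice (snd z)) l') :
    ∃ b l, Run step choice (b :: l) ∧ (b :: l).length ≤ max 1 N ∧ (∀ c ∈ b :: l, Small N c) ∧
      ((l.head? ≠ some b ∧ l' = stages (b :: l)) ∨
        ∃ l₁, l = b :: l₁ ∧ l' = stage l₁.length b :: stages (b :: l₁)) := by
  induction h with
  | root =>
    exact ⟨∅, [], Run.root, by simp, by simp [HF.small_empty], Or.inl ⟨by simp, rfl⟩⟩
  | @next st L' Y e d' _ hne hY he hd ih =>
    obtain ⟨b, l, hrun, hlen, hsm, ⟨hnb, h2⟩ | ⟨l₁, rfl, h2⟩⟩ := ih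
    · rw [stages, List.cons.injEq] at h2
      obtain ⟨rfl, rfl⟩ := h2
      have h0 := hrun.rooted.head
      rw [snd_stage h0] at hY
      obtain ⟨d, hd1, hd2, hd3, hd4⟩ := (countedStep₂_stage h0).1 hd
      have hrun' := Run.next hrun hnb hY he hd1
      refine ⟨d, b :: l, hrun', by simp; omega, ?_, ?_⟩
      · rw [List.forall_mem_cons]
        exact ⟨hd3, hsm⟩
      · rcases hd4 with ⟨rfl, rfl⟩ | ⟨hdb, rfl⟩
        · exact Or.inr ⟨l, rfl, rfl⟩
        · refine Or.inl ⟨?_, rfl⟩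
          simp only [List.head?_cons, ne_eq, Option.some.injEq]
          exact fun h => hdb h.symm
    · rw [List.cons.injEq] at h2
      obtain ⟨rfl, rfl⟩ := h2
      exact absurd rfl hne

theorem run_counted_of_run (hf : ¬ WscFails L Q P (countedStep₂ N step)
      (fun z => choice (snd z)) wit) {l : List (HF α)}
    (h : Run step choice l) : l.length ≤ N ∧ (∀ b ∈ l, Small N b) ∧ ∃ b l₀, l = b :: l₀ ∧
      (l₀.head? ≠ some b → Run (countedStep₂ N step) (fun z => choice (snd z)) (stages l)) ∧
      (∀ l₁, l₀ = b :: l₁ → Run (countedStep₂ N step) (fun z => choice (snd z))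
        (stage l₁.length b :: stages (b :: l₁))) := by
  induction h with
  | root =>
    have h1 : 1 ≤ N := by
      by_contra hN
      refine hf (Or.inl ⟨∅, [], Run.root, by simp, ?_⟩)
      rcases hc : choice (snd ∅) with _ | Y
      · exact Or.inl hc
      · obtain ⟨e, he⟩ := exists_isChoice Y
        refine Or.inr ⟨Y, e, hc, he, ?_⟩
        refine (countedStep₂_stage_eq_none (i := 0) (a := ∅) fun _ => rfl).2 fun d _ h => ?_
        omega
    refine ⟨by simpa using h1, by simp [HF.small_empty], ∅, [], rfl, fun _ => Run.root, ?_⟩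
    intro l₁ h
    cases h
  | @next b l Y e d hrun hne hY he hd ih =>
    obtain ⟨hlen, hsm, b', l₀, heq, h1, -⟩ := ih
    rw [List.cons.injEq] at heq
    obtain ⟨rfl, rfl⟩ := heq
    have hrun' := h1 hne
    have h0 := hrun.rooted.head
    have hne' : (stages l).head? ≠ some (stage l.length b) := head_stages_ne b l
    have hY' : (fun z => choice (snd z)) (stage l.length b) = some Y := by
      simp only [snd_stage h0, hY]
    have hcond : l.length + 2 ≤ N ∧ Small N d := by
      by_contra hc
      refine hf (Or.inl ⟨stage l.length b, stages l, hrun', hne', Or.inr ⟨Y, e, hY', he, ?_⟩⟩)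
      refine (countedStep₂_stage_eq_none h0).2 fun d' hd' => ?_
      rw [hd] at hd'
      cases hd'
      exact hc
    refine ⟨hcond.1, ?_, d, b :: l, rfl, fun h => ?_, fun l₁ h => ?_⟩
    · rw [List.forall_mem_cons]
      exact ⟨hcond.2, hsm⟩
    · refine Run.next hrun' hne' hY' he ((countedStep₂_stage h0).2 ⟨d, hd, hcond.1, hcond.2,
        Or.inr ⟨fun h' => h ?_, rfl⟩⟩)
      rw [h', List.head?_cons]
    · rw [List.cons.injEq] at h
      obtain ⟨rfl, rfl⟩ := h
      exact Run.next hrun' hne' hY' he ((countedStep₂_stage h0).2 ⟨b, hd, hcond.1, hcond.2,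
        Or.inl ⟨rfl, rfl⟩⟩)

theorem complete_run_of_run_counted {c : HF α} {l' : List (HF α)}
    (h : Run (countedStep₂ N step) (fun z => choice (snd z)) (c :: c :: l')) :
    ∃ b l, Run step choice (b :: b :: l) ∧ c = stage l.length b ∧ c :: l' = stages (b :: l) := by
  obtain ⟨b, l, hrun, -, -, ⟨-, h2⟩ | ⟨l₁, rfl, h2⟩⟩ := run_of_run_counted h
  · exfalso
    rw [stages, List.cons.injEq] at h2
    obtain ⟨h2, h3⟩ := h2
    refine head_stages_ne b l ?_
    rw [← h3, ← h2]
    rfl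
  · rw [List.cons.injEq] at h2
    exact ⟨b, l₁, hrun, h2.1, h2.2⟩

theorem wscFails_counted_iff (hQ : 4 * N + 20 ≤ Q) :
    WscFails L Q P (countedStep₂ N step) (fun z => choice (snd z))
      (fun z w => wit (snd z) (snd w)) ↔ WscFails L N P step choice wit := by
  constructor
  · rintro (⟨st, l', hr, hne, h⟩ | ⟨l', hr, h⟩ | ⟨c, l', hr, h⟩)
    · obtain ⟨b, l, hrun, -, -, ⟨hnb, h2⟩ | ⟨l₁, rfl, h2⟩⟩ := run_of_run_counted hr
      · rw [stages, List.cons.injEq] at h2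
        obtain ⟨rfl, rfl⟩ := h2
        have h0 := hrun.rooted.head
        simp only [snd_stage h0] at h
        rcases h with h | ⟨Y, e, hY, he, h⟩
        · exact Or.inl ⟨b, l, hrun, hnb, Or.inl h⟩
        · rcases hs : step b e with _ | d
          · exact Or.inl ⟨b, l, hrun, hnb, Or.inr ⟨Y, e, hY, he, hs⟩⟩
          · have h3 := (countedStep₂_stage_eq_none h0).1 h d hs
            refine Or.inr (Or.inl ⟨d :: b :: l, Run.next hrun hnb hY he hs, ?_⟩)
            by_cases hd : Small N d
            · left
              simp only [List.length_cons]
              by_contra hlen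
              exact h3 ⟨by omega, hd⟩
            · exact Or.inr ⟨d, by simp, hd⟩
      · rw [List.cons.injEq] at h2
        obtain ⟨rfl, rfl⟩ := h2
        exact absurd rfl hne
    · exfalso
      obtain ⟨b, l, hrun, hlen, hsm, h2⟩ := run_of_run_counted hr
      have h3 : l'.length = (b :: l).length ∧
          ∀ x ∈ l', ∃ i c, i < (b :: l).length ∧ c ∈ b :: l ∧ x = stage i c := by
        rcases h2 with ⟨-, rfl⟩ | ⟨l₁, rfl, rfl⟩
        · exact ⟨length_stages _, fun x hx => mem_stages hx⟩
        · refine ⟨by simp, fun x hx => ?_⟩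
          have hx' : x ∈ stages (b :: l₁) := by
            rcases List.mem_cons.1 hx with rfl | hx
            · simp [stages]
            · exact hx
          obtain ⟨i, c, h4, h5, h6⟩ := mem_stages hx'
          exact ⟨i, c, by simp at h4 ⊢; omega, List.mem_cons_of_mem _ h5, h6⟩
      rcases h with h | ⟨x, hx, h⟩
      · omega
      · obtain ⟨i, c, h4, h5, rfl⟩ := h3.2 x hx
        exact h (small_stage (hsm c h5) (by omega) hQ)
    · obtain ⟨b, l, hrun, rfl, h2⟩ := complete_run_of_run_counted hr
      refine Or.inr (Or.inr ⟨b, l, hrun, fun hw => h ?_⟩)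
      rw [h2]
      exact (witnessed_stages hrun.rooted.tail).2 hw
  · intro h
    by_contra hf
    rcases h with ⟨b, l, hr, hne, h⟩ | ⟨l, hr, h⟩ | ⟨c, l, hr, h⟩
    · obtain ⟨-, -, b', l₀, heq, h1, -⟩ := run_counted_of_run hf hr
      rw [List.cons.injEq] at heq
      obtain ⟨rfl, rfl⟩ := heq
      have h0 := hr.rooted.head
      refine hf (Or.inl ⟨_, _, h1 hne, head_stages_ne b l, ?_⟩)
      simp only [snd_stage h0]
      rcases h with h | ⟨Y, e, hY, he, h⟩
      · exact Or.inl h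
      · refine Or.inr ⟨Y, e, hY, he, (countedStep₂_stage_eq_none h0).2 fun d hd => ?_⟩
        rw [h] at hd
        cases hd
    · obtain ⟨h1, h2, -⟩ := run_counted_of_run hf hr
      rcases h with h | ⟨b, hb, h⟩
      · omega
      · exact h (h2 b hb)
    · obtain ⟨-, -, b', l₀, heq, -, h1⟩ := run_counted_of_run hf hr
      rw [List.cons.injEq] at heq
      obtain ⟨rfl, rfl⟩ := heq
      refine hf (Or.inr (Or.inr ⟨_, _, h1 l rfl, fun hw => h ?_⟩))
      exact (witnessed_stages hr.rooted.tail).1 hw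

theorem wscEval_counted (hQ : 4 * N + 20 ≤ Q) :
    wscEval L Q P (countedStep₂ N step) (fun z => choice (snd z))
      (fun z w => wit (snd z) (snd w)) (fun z => out (snd z)) =
    wscEval L N P step choice wit out := by
  have hiff := wscFails_counted_iff (L := L) (P := P) (step := step) (wit := wit)
    (choice := choice) hQ
  unfold wscEval
  by_cases hf : WscFails L N P step choice wit
  · rw [if_pos (Or.inl hf), if_pos (Or.inl (hiff.2 hf))]
  have hf' := fun h => hf (hiff.1 h)
  have hr : ∀ q : Option Prop → Prop,
      (∃ c l, Run (countedStep₂ N step) (fun z => choice (snd z)) (c :: c :: l) ∧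
        q (out (snd c))) ↔ ∃ c l, Run step choice (c :: c :: l) ∧ q (out c) := by
    intro q
    constructor
    · rintro ⟨c, l', hr, ho⟩
      obtain ⟨b, l, hrun, rfl, h2⟩ := complete_run_of_run_counted hr
      rw [snd_stage hrun.rooted.tail.head] at ho
      exact ⟨b, l, hrun, ho⟩
    · rintro ⟨c, l, hr, ho⟩
      obtain ⟨-, -, b', l₀, heq, -, h1⟩ := run_counted_of_run hf' hr
      rw [List.cons.injEq] at heq
      obtain ⟨rfl, rfl⟩ := heq
      refine ⟨_, _, h1 l rfl, ?_⟩
      rw [snd_stage hr.rooted.tail.head]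
      exact ho
  have hc := or_congr hiff (hr fun o => o = none)
  by_cases hcond : WscFails L N P step choice wit ∨ ∃ c l, Run step choice (c :: c :: l) ∧
      out c = none
  · rw [if_pos hcond, if_pos (hc.2 hcond)]
  rw [if_neg hcond, if_neg (fun h => hcond (hc.1 h))]
  congr 1
  rw [eq_iff_iff]
  have := not_congr (hr fun o => ¬ ∃ p, o = some p ∧ p)
  push Not at this
  exact this

end Runs

end BGS

namespace BGS

open HF

variable {L : Language}

/-! ### Polynomials as terms -/

/-- The sum of two ordinals. -/
def Term.add (s t : Term L) : Term L :=
  .card (.cup (.compr (.kpair .empty (.var 0)) 0 s .tt)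
    (.compr (.kpair (.pair .empty .empty) (.var 0)) 0 t .tt))

/-- The product of two ordinals. -/
def Term.mul (s t : Term L) : Term L :=
  .card (.union (.compr (.compr (.kpair (.var 0) (.var 1)) 1 t .tt) 0 s .tt))

section

variable {α : Type} [L.Structure α] {N : ℕ}

theorem ncard_members_ofNat (m : ℕ) : {x : HF α | x ∈ (ofNat m : HF α)}.ncard = m := by
  have : {x : HF α | x ∈ (ofNat m : HF α)} = ofNat '' Set.Iio m := by
    ext x
    simp only [Set.mem_ofPred_eq, mem_ofNat, Set.mem_image, Set.mem_Iio, eq_comm]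
  rw [this, Set.ncard_image_of_injective _ ofNat_injective]
  simp

theorem eval_add {s t : Term L} {m n : ℕ} (hs : ∀ ρ : ℕ → HF α, s.eval N ρ = some (ofNat m))
    (ht : ∀ ρ : ℕ → HF α, t.eval N ρ = some (ofNat n)) (ρ : ℕ → HF α) :
    (Term.add s t).eval N ρ = some (ofNat (m + n)) := by
  have h1 := eval_compr (P := fun _ => True) (f := fun b => HF.kpair ∅ b) (y := 0)
    (s := .kpair .empty (.var 0)) (hs ρ) (fun b _ => eval_tt)
    (fun b _ _ => (eval_kpair rfl rfl).trans (by simp))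
  have h2 := eval_compr (P := fun _ => True) (f := fun b => HF.kpair (HF.pair ∅ ∅) b) (y := 0)
    (s := .kpair (.pair .empty .empty) (.var 0)) (ht ρ) (fun b _ => eval_tt)
    (fun b _ _ => (eval_kpair (eval_pair rfl rfl) rfl).trans (by simp))
  refine (eval_card (eval_cup h1 h2)).trans ?_
  rw [HF.card]
  congr 2
  have h3 : {y | y ∈ HF.cup (ofSet {c | ∃ b, b ∈ (ofNat m : HF α) ∧ True ∧ HF.kpair ∅ b = c})
      (ofSet {c | ∃ b, b ∈ (ofNat n : HF α) ∧ True ∧ HF.kpair (HF.pair ∅ ∅) b = c})} =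
      (fun b => HF.kpair ∅ b) '' {b | b ∈ (ofNat m : HF α)} ∪
      (fun b => HF.kpair (HF.pair ∅ ∅) b) '' {b | b ∈ (ofNat n : HF α)} := by
    ext x
    simp only [Set.mem_ofPred_eq, HF.mem_cup, mem_ofSet (finite_image_set _ _ _),
      Set.mem_union, Set.mem_image]
    simp only [true_and]
  rw [h3, Set.ncard_union_eq ?_ ((finite_members _).image _) ((finite_members _).image _),
    Set.ncard_image_of_injective _ (fun a b h => (kpair_inj.1 h).2),
    Set.ncard_image_of_injective _ (fun a b h => (kpair_inj.1 h).2), ncard_members_ofNat,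
    ncard_members_ofNat]
  rw [Set.disjoint_left]
  rintro _ ⟨a, -, rfl⟩ ⟨b, -, h⟩
  exact singleton_empty_ne_empty (kpair_inj.1 h).1

theorem eval_mul {s t : Term L} {m n : ℕ} (hs : ∀ ρ : ℕ → HF α, s.eval N ρ = some (ofNat m))
    (ht : ∀ ρ : ℕ → HF α, t.eval N ρ = some (ofNat n)) (ρ : ℕ → HF α) :
    (Term.mul s t).eval N ρ = some (ofNat (m * n)) := by
  have h1 : ∀ a : HF α, (Term.compr (.kpair (.var 0) (.var 1)) 1 t .tt).eval N
      (Function.update ρ 0 a) =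
      some (ofSet {c | ∃ b, b ∈ (ofNat n : HF α) ∧ True ∧ HF.kpair a b = c}) := fun a =>
    eval_compr (ht _) (fun b _ => eval_tt)
      (fun b _ _ => (eval_kpair rfl rfl).trans (by simp))
  have h2 := eval_compr (P := fun _ => True)
    (f := fun a => ofSet {c | ∃ b, b ∈ (ofNat n : HF α) ∧ True ∧ HF.kpair a b = c}) (y := 0)
    (hs ρ) (fun b _ => eval_tt) (fun a _ _ => h1 a)
  refine (eval_card (eval_union h2)).trans ?_
  rw [HF.card]
  congr 2
  have h3 : {y | y ∈ HF.sUnion (ofSet {c | ∃ a, a ∈ (ofNat m : HF α) ∧ True ∧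
      ofSet {c | ∃ b, b ∈ (ofNat n : HF α) ∧ True ∧ HF.kpair a b = c} = c})} =
      (fun p : HF α × HF α => HF.kpair p.1 p.2) ''
        ({b | b ∈ (ofNat m : HF α)} ×ˢ {b | b ∈ (ofNat n : HF α)}) := by
    ext x
    simp only [Set.mem_ofPred_eq, HF.mem_sUnion, mem_ofSet (finite_image_set _ _ _),
      Set.mem_image, Set.mem_prod, Prod.exists]
    constructor
    · rintro ⟨_, ⟨a, ha, -, rfl⟩, hx⟩
      obtain ⟨b, hb, -, rfl⟩ := (mem_ofSet (finite_image_set _ _ _)).1 hx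
      exact ⟨a, b, ⟨ha, hb⟩, rfl⟩
    · rintro ⟨a, b, ⟨ha, hb⟩, rfl⟩
      exact ⟨_, ⟨a, ha, trivial, rfl⟩,
        (mem_ofSet (finite_image_set _ _ _)).2 ⟨b, hb, trivial, rfl⟩⟩
  rw [h3, Set.ncard_image_of_injective, Set.ncard_prod, ncard_members_ofNat, ncard_members_ofNat]
  rintro ⟨a, b⟩ ⟨c, d⟩ h
  obtain ⟨h1, h2⟩ := kpair_inj.1 h
  exact Prod.ext h1 h2

theorem eval_card_atoms [Finite α] (ρ : ℕ → HF α) :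
    (Term.card .atoms : Term L).eval N ρ = some (ofNat (Nat.card α)) := by
  refine (eval_card rfl).trans ?_
  rw [card_ofSet (Set.finite_range _), ← Set.image_univ,
    Set.ncard_image_of_injective _ atom_injective, Set.ncard_univ]

end

theorem exists_polynomial_term (p : Polynomial ℕ) : ∃ t : Term L, t.fv = ∅ ∧
    ∀ (α : Type) [L.Structure α] [Finite α] (N : ℕ) (ρ : ℕ → HF α),
      t.eval N ρ = some (ofNat (p.eval (Nat.card α))) := by
  have hconst : ∀ a : ℕ, ∃ t : Term L, t.fv = ∅ ∧
      ∀ (α : Type) [L.Structure α] [Finite α] (N : ℕ) (ρ : ℕ → HF α),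
        t.eval N ρ = some (ofNat a) := by
    intro a
    induction a with
    | zero => exact ⟨.empty, rfl, fun α _ _ N ρ => rfl⟩
    | succ a ih =>
      obtain ⟨t, h1, h2⟩ := ih
      exact ⟨t.succ, by simp [h1], fun α _ _ N ρ => by rw [eval_succ (h2 α N ρ), succ_ofNat]⟩
  induction p using Polynomial.induction_on with
  | C a => simpa using hconst a
  | add p q hp hq =>
    obtain ⟨s, h1, h2⟩ := hp
    obtain ⟨t, h3, h4⟩ := hq
    refine ⟨.add s t, by simp [Term.add, Term.fv, h1, h3], fun α _ _ N ρ => ?_⟩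
    rw [eval_add (h2 α N) (h4 α N), Polynomial.eval_add]
  | monomial n a ih =>
    obtain ⟨s, h1, h2⟩ := ih
    refine ⟨.mul s (.card .atoms), by simp [Term.mul, Term.fv, h1], fun α _ _ N ρ => ?_⟩
    rw [eval_mul (h2 α N) eval_card_atoms]
    congr 2
    simp only [Polynomial.eval_mul, Polynomial.eval_pow, Polynomial.eval_C, Polynomial.eval_X]
    ring

theorem eval_subst_bind {α : Type} [L.Structure α] {N : ℕ} {ρ : ℕ → HF α} {x : ℕ} {s t : Term L} :
    (Term.subst x t s).eval N ρ =
      (t.eval N ρ).bind fun a => s.eval N (Function.update ρ x a) := by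
  rcases h : t.eval N ρ with _ | a
  · rw [Term.subst, Term.eval, Term.eval, Term.eval, h]
    rfl
  · exact eval_subst h

/-! ### Raising the bound -/

/-- The term `t'` has, under all large bounds, the value which `t` has under the bound `b`. -/
def Term.Raises (b t t' : Term L) : Prop :=
  t'.fv = t.fv ∧ ∀ (α : Type) [L.Structure α] [Finite α] (N Q : ℕ),
    (∀ ρ : ℕ → HF α, b.eval Q ρ = some (ofNat N)) → 4 * N + 20 ≤ Q →
    ∀ ρ : ℕ → HF α, t'.eval Q ρ = t.eval N ρ

/-- The formula `Φ'` has, under all large bounds, the value which `Φ` has under the bound `b`. -/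
def Formula.Raises (b : Term L) (Φ Φ' : Formula L) : Prop :=
  Φ'.fv = Φ.fv ∧ ∀ (α : Type) [L.Structure α] [Finite α] (N Q : ℕ),
    (∀ ρ : ℕ → HF α, b.eval Q ρ = some (ofNat N)) → 4 * N + 20 ≤ Q →
    ∀ ρ : ℕ → HF α, Φ'.eval Q ρ = Φ.eval N ρ

/-- The numbered iteration of `s` with state variable `z` and bound `b`. -/
def Term.countedIter (b s : Term L) (y z : ℕ) : Term L :=
  .subst z (.iter
    (.ite z (.eq (.var z) (.pair .empty .empty)) (.pair .empty .empty)
      (.subst (z + 1) (.subst y (.snd z) s)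
        (.ite z (.eq (.var (z + 1)) (.snd z)) (.var z)
          (.ite z (.and (.mem (.succ (.fst z)) (.succ b)) (.small b (z + 1)))
            (.kpair (.succ (.fst z)) (.var (z + 1))) (.pair .empty .empty))))) z) (.snd z)

theorem raises_iter {b s s' : Term L} {y : ℕ} (hb : b.fv = ∅) (h : Term.Raises b s s') :
    ∃ t, Term.Raises b (.iter s y) t := by
  obtain ⟨hfv, heval⟩ := h
  obtain ⟨z, hz⟩ : ∃ z, ∀ x ∈ insert y s.fv, x < z := by
    obtain ⟨m, hm⟩ := (s.finite_fv.insert y).bddAbove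
    exact ⟨m + 1, fun x hx => Nat.lt_succ_of_le (hm hx)⟩
  have hzy : y < z := hz y (Set.mem_insert _ _)
  have hzs : ∀ x ∈ s.fv, x < z := fun x hx => hz x (Set.mem_insert_of_mem _ hx)
  refine ⟨Term.countedIter b s' y z, ?_, fun α _ _ N Q hbe hQ ρ => ?_⟩
  · ext x
    have h1 := hzs x
    simp only [Term.countedIter, fv_term_subst, Term.fv, fv_ite, Formula.fv, fv_snd, fv_fst,
      fv_mem, fv_succ, fv_small, fv_kpair, hb, hfv, Set.mem_union, Set.mem_sdiff,
      Set.mem_singleton_iff, Set.union_empty, Set.empty_union]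
    by_cases hx : x ∈ s.fv
    · have := h1 hx
      simp only [hx, true_and]
      omega
    · simp only [hx, false_and, or_false, iff_false]
      omega
  · have hstep : ∀ st : HF α,
        (Term.ite z (.eq (.var z) (.pair .empty .empty)) (.pair .empty .empty)
          (.subst (z + 1) (.subst y (.snd z) s')
            (.ite z (.eq (.var (z + 1)) (.snd z)) (.var z)
              (.ite z (.and (.mem (.succ (.fst z)) (.succ b)) (.small b (z + 1)))
                (.kpair (.succ (.fst z)) (.var (z + 1))) (.pair .empty .empty))))).eval Q
              (Function.update ρ z st) =
        countedStep N (fun a => s.eval N (Function.update ρ y a)) st := by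
      intro st
      have hz : Function.update ρ z st z = st := Function.update_self ..
      rw [eval_ite (eval_eq rfl (eval_pair rfl rfl)), countedStep, hz]
      by_cases hst : st = HF.pair ∅ ∅
      · rw [if_pos hst, if_pos hst]
        rfl
      rw [if_neg hst, if_neg hst, eval_subst_bind, eval_subst (eval_snd z), hz, heval α N Q hbe hQ,
        Term.eval_congr (ρ' := Function.update ρ y (HF.snd st)) N s fun x hx => by
          have := hzs x hx
          by_cases hxy : x = y
          · simp [hxy]
          · rw [Function.update_of_ne hxy, Function.update_of_ne hxy,
              Function.update_of_ne (by omega)] ]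
      rcases s.eval N (Function.update ρ y (HF.snd st)) with _ | d
      · rfl
      · have h1 : Function.update (Function.update ρ z st) (z + 1) d z = st := by simp
        have h2 : Function.update (Function.update ρ z st) (z + 1) d (z + 1) = d := by simp
        rw [Option.bind_some, Option.map_some, eval_ite (eval_eq rfl (eval_snd z)),
          eval_ite (eval_and (eval_mem (eval_succ (eval_fst z)) (eval_succ (hbe _)))
            (eval_small (hbe _) (by omega))), eval_kpair (eval_succ (eval_fst z)) rfl, h1, h2,
          eval_var, h1]
        split_ifs <;> rfl
    rw [Term.countedIter, eval_subst_bind]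
    have h3 := iterate_countedStep hQ (fun a => s.eval N (Function.update ρ y a)) N 0 Q ∅
      (by omega) (by omega) (HF.small_empty N) fun _ => rfl
    rw [Term.eval, Term.eval, funext hstep, ← h3]
    change _ = Option.map HF.snd (iterate Q _ Q ∅)
    rcases iterate Q (countedStep N fun a => s.eval N (Function.update ρ y a)) Q ∅ with _ | d
    · rfl
    · simp only [Option.bind_some, Option.map_some, eval_snd, Function.update_self]

/-- The numbered variant of a fixed-point operator with choice, with bound `b` and fresh
variables from `z` on. -/
def Formula.countedWsc (b : Term L) (x y : ℕ) (step choice wit : Term L) (out : Formula L)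
    (z : ℕ) : Formula L :=
  .wsc z (z + 1)
    (.subst (z + 2) (.subst x (.snd z) (.subst y (.var (z + 1)) step))
      (.ite z (.and (.mem (.succ (.succ (.fst z))) (.succ b)) (.small b (z + 2)))
        (.ite z (.eq (.var (z + 2)) (.snd z)) (.var z) (.kpair (.succ (.fst z)) (.var (z + 2))))
        .fail))
    (.subst x (.snd z) choice)
    (.subst x (.snd z) (.subst y (.snd (z + 1)) wit))
    (.subst x (.snd z) out)

theorem fv_countedWsc {b : Term L} {x y : ℕ} {step choice wit : Term L} {out : Formula L} {z : ℕ}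
    (hb : b.fv = ∅) (hx : x < z) (hy : y < z) (hs : ∀ i ∈ step.fv, i < z)
    (hc : ∀ i ∈ choice.fv, i < z) (hw : ∀ i ∈ wit.fv, i < z) (ho : ∀ i ∈ out.fv, i < z) :
    (Formula.countedWsc b x y step choice wit out z).fv =
      (Formula.wsc x y step choice wit out).fv := by
  ext i
  have hs := hs i
  have hc := hc i
  have hw := hw i
  have ho := ho i
  simp only [Formula.countedWsc, fv_term_subst, Term.fv, fv_ite, Formula.fv, fv_snd, fv_fst,
    fv_mem, fv_succ, fv_small, fv_kpair, fv_subst, fv_term_fail, hb, Set.mem_union, Set.mem_sdiff,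
    Set.mem_singleton_iff, Set.union_empty, Set.empty_union, Set.mem_insert_iff]
  by_cases h1 : i ∈ step.fv <;> by_cases h2 : i ∈ choice.fv <;> by_cases h3 : i ∈ wit.fv <;>
    by_cases h4 : i ∈ out.fv <;> simp only [h1, h2, h3, h4, forall_const, true_and, false_and,
      or_false, false_or, iff_false] at hs hc hw ho ⊢ <;> omega

theorem raises_wsc {b : Term L} {x y : ℕ} {step step' choice choice' wit wit' : Term L}
    {out out' : Formula L} (hb : b.fv = ∅) (hs : Term.Raises b step step')
    (hc : Term.Raises b choice choice') (hw : Term.Raises b wit wit')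
    (ho : Formula.Raises b out out') :
    ∃ Φ, Formula.Raises b (.wsc x y step choice wit out) Φ := by
  obtain ⟨z, hz⟩ : ∃ z, ∀ i ∈ {x, y} ∪ step.fv ∪ choice.fv ∪ wit.fv ∪ out.fv, i < z := by
    obtain ⟨m, hm⟩ := ((((((Set.finite_singleton y).insert x).union step.finite_fv).union
      choice.finite_fv).union wit.finite_fv).union out.finite_fv).bddAbove
    exact ⟨m + 1, fun x hx => Nat.lt_succ_of_le (hm hx)⟩
  simp only [Set.mem_union, Set.mem_insert_iff, Set.mem_singleton_iff] at hz
  have hx : x < z := hz x (by tauto)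
  have hy : y < z := hz y (by tauto)
  have hfs : ∀ i ∈ step.fv, i < z := fun i hi => hz i (by tauto)
  have hfc : ∀ i ∈ choice.fv, i < z := fun i hi => hz i (by tauto)
  have hfw : ∀ i ∈ wit.fv, i < z := fun i hi => hz i (by tauto)
  have hfo : ∀ i ∈ out.fv, i < z := fun i hi => hz i (by tauto)
  have hfv := fv_countedWsc (b := b) (x := x) (y := y) (step := step') (choice := choice')
    (wit := wit') (out := out') (z := z) hb hx hy (hs.1 ▸ hfs) (hc.1 ▸ hfc) (hw.1 ▸ hfw)
    (ho.1 ▸ hfo)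
  have hfv' : (Formula.wsc x y step' choice' wit' out').fv =
      (Formula.wsc x y step choice wit out).fv := by
    simp only [Formula.fv, hs.1, hc.1, hw.1, ho.1]
  refine ⟨_, hfv.trans hfv', fun α _ _ N Q hbe hQ ρ => ?_⟩
  have hagree : ∀ (S : Set ℕ) (ρ' : ℕ → HF α), (∀ i ∈ S, i < z) → (∀ i, i < z → ρ' i = ρ i) →
      ∀ (a e : HF α), (∀ i ∈ S, Function.update ρ' x a i = Function.update ρ x a i) ∧
        ∀ i ∈ S, Function.update (Function.update ρ' x a) y e i =
          Function.update (Function.update ρ x a) y e i := by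
    intro S ρ' hS hρ a e
    have h1 : ∀ i ∈ S, Function.update ρ' x a i = Function.update ρ x a i := by
      intro i hi
      by_cases hix : i = x
      · simp [hix]
      · rw [Function.update_of_ne hix, Function.update_of_ne hix, hρ i (hS i hi)]
    refine ⟨h1, fun i hi => ?_⟩
    by_cases hiy : i = y
    · simp [hiy]
    · rw [Function.update_of_ne hiy, Function.update_of_ne hiy, h1 i hi]
  have hupd : ∀ (st : HF α) (i : ℕ), i < z → Function.update ρ z st i = ρ i := fun st i hi =>
    Function.update_of_ne (by omega) ..
  have hupd₂ : ∀ (st e : HF α) (i : ℕ), i < z →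
      Function.update (Function.update ρ z st) (z + 1) e i = ρ i := fun st e i hi => by
    rw [Function.update_of_ne (by omega), Function.update_of_ne (by omega)]
  rw [Formula.countedWsc, Formula.eval, Formula.eval, ← wscEval_counted hQ]
  congr 1
  · rw [← Formula.countedWsc, hfv.trans hfv']
  · funext st e
    have h1 : Function.update (Function.update ρ z st) (z + 1) e z = st := by simp
    rw [countedStep₂, eval_subst_bind, eval_subst (eval_snd z), h1]
    rw [eval_subst (a := e) (by
      rw [eval_var, Function.update_of_ne (by omega), Function.update_self]),
      hs.2 α N Q hbe hQ, Term.eval_congr N step (hagree _ _ hfs (hupd₂ st e) (HF.snd st) e).2]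
    rcases step.eval N (Function.update (Function.update ρ x (HF.snd st)) y e) with _ | d
    · rfl
    · have h2 : Function.update (Function.update (Function.update ρ z st) (z + 1) e) (z + 2) d z =
          st := by simp
      have h3 : Function.update (Function.update (Function.update ρ z st) (z + 1) e) (z + 2) d
          (z + 2) = d := by simp
      rw [Option.bind_some, Option.bind_some,
        eval_ite (eval_and (eval_mem (eval_succ (eval_succ (eval_fst z))) (eval_succ (hbe _)))
          (eval_small (hbe _) (by omega))), eval_ite (eval_eq rfl (eval_snd z)),
        eval_kpair (eval_succ (eval_fst z)) rfl, eval_term_fail, eval_var, h2, h3]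
      split_ifs <;> rfl
  · funext st
    rw [eval_subst (eval_snd z), Function.update_self, hc.2 α N Q hbe hQ,
      Term.eval_congr N choice (hagree _ _ hfc (hupd st) (HF.snd st) ∅).1]
  · funext st e
    have h1 : Function.update (Function.update ρ z st) (z + 1) e z = st := by simp
    rw [eval_subst (eval_snd z), h1, eval_subst (a := HF.snd e) (by
      rw [eval_snd, Function.update_of_ne (by omega), Function.update_self]),
      hw.2 α N Q hbe hQ, Term.eval_congr N wit (hagree _ _ hfw (hupd₂ st e) (HF.snd st) _).2]
  · funext st
    rw [eval_formula_subst (eval_snd z), Function.update_self, ho.2 α N Q hbe hQ,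
      Formula.eval_congr N out (hagree _ _ hfo (hupd st) (HF.snd st) ∅).1]

mutual

theorem Term.exists_raises {b : Term L} (hb : b.fv = ∅) : ∀ t : Term L, ∃ t', Term.Raises b t t'
  | .var x => ⟨.var x, rfl, fun _ _ _ _ _ _ _ _ => rfl⟩
  | .empty => ⟨.empty, rfl, fun _ _ _ _ _ _ _ _ => rfl⟩
  | .atoms => ⟨.atoms, rfl, fun _ _ _ _ _ _ _ _ => rfl⟩
  | .pair s t => by
    obtain ⟨s', hs, hs'⟩ := Term.exists_raises hb s
    obtain ⟨t', ht, ht'⟩ := Term.exists_raises hb t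
    exact ⟨.pair s' t', by simp only [Term.fv, hs, ht], fun α _ _ N Q h1 h2 ρ => by
      rw [Term.eval, Term.eval, hs' α N Q h1 h2, ht' α N Q h1 h2]⟩
  | .union s => by
    obtain ⟨s', hs, hs'⟩ := Term.exists_raises hb s
    exact ⟨.union s', by simp only [Term.fv, hs], fun α _ _ N Q h1 h2 ρ => by
      rw [Term.eval, Term.eval, hs' α N Q h1 h2]⟩
  | .unique s => by
    obtain ⟨s', hs, hs'⟩ := Term.exists_raises hb s
    exact ⟨.unique s', by simp only [Term.fv, hs], fun α _ _ N Q h1 h2 ρ => by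
      rw [Term.eval, Term.eval, hs' α N Q h1 h2]⟩
  | .card s => by
    obtain ⟨s', hs, hs'⟩ := Term.exists_raises hb s
    exact ⟨.card s', by simp only [Term.fv, hs], fun α _ _ N Q h1 h2 ρ => by
      rw [Term.eval, Term.eval, hs' α N Q h1 h2]⟩
  | .compr s y t Φ => by
    obtain ⟨s', hs, hs'⟩ := Term.exists_raises hb s
    obtain ⟨t', ht, ht'⟩ := Term.exists_raises hb t
    obtain ⟨Φ', hΦ, hΦ'⟩ := Formula.exists_raises hb Φ
    exact ⟨.compr s' y t' Φ', by simp only [Term.fv, hs, ht, hΦ], fun α _ _ N Q h1 h2 ρ => by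
      simp only [Term.eval, hs' α N Q h1 h2, ht' α N Q h1 h2, hΦ' α N Q h1 h2]⟩
  | .iter s y => by
    obtain ⟨s', hs⟩ := Term.exists_raises hb s
    exact raises_iter hb hs

theorem Formula.exists_raises {b : Term L} (hb : b.fv = ∅) :
    ∀ Φ : Formula L, ∃ Φ', Formula.Raises b Φ Φ'
  | .rel R ts => by
    choose ts' hts hts' using fun i => Term.exists_raises hb (ts i)
    exact ⟨.rel R ts', by simp only [Formula.fv, hts], fun α _ _ N Q h1 h2 ρ => by
      simp only [Formula.eval, fun i => hts' i α N Q h1 h2 ρ]⟩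
  | .eq s t => by
    obtain ⟨s', hs, hs'⟩ := Term.exists_raises hb s
    obtain ⟨t', ht, ht'⟩ := Term.exists_raises hb t
    exact ⟨.eq s' t', by simp only [Formula.fv, hs, ht], fun α _ _ N Q h1 h2 ρ => by
      rw [Formula.eval, Formula.eval, hs' α N Q h1 h2, ht' α N Q h1 h2]⟩
  | .not Φ => by
    obtain ⟨Φ', hΦ, hΦ'⟩ := Formula.exists_raises hb Φ
    exact ⟨.not Φ', by simp only [Formula.fv, hΦ], fun α _ _ N Q h1 h2 ρ => by
      rw [Formula.eval, Formula.eval, hΦ' α N Q h1 h2]⟩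
  | .and Φ Ψ => by
    obtain ⟨Φ', hΦ, hΦ'⟩ := Formula.exists_raises hb Φ
    obtain ⟨Ψ', hΨ, hΨ'⟩ := Formula.exists_raises hb Ψ
    exact ⟨.and Φ' Ψ', by simp only [Formula.fv, hΦ, hΨ], fun α _ _ N Q h1 h2 ρ => by
      rw [Formula.eval, Formula.eval, hΦ' α N Q h1 h2, hΨ' α N Q h1 h2]⟩
  | .wsc x y step choice wit out => by
    obtain ⟨step', hs⟩ := Term.exists_raises hb step
    obtain ⟨choice', hc⟩ := Term.exists_raises hb choice
    obtain ⟨wit', hw⟩ := Term.exists_raises hb wit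
    obtain ⟨out', ho⟩ := Formula.exists_raises hb out
    exact raises_wsc hb hs hc hw ho

end

end BGS

/-! ## Codes of tuples -/

namespace HF

variable {α β : Type*}

/-- The tuple `c`, coded as a function with domain `{m, m + 1, …}`. -/
noncomputable def seg (m : ℕ) (c : List α) : HF α :=
  ofSet {x | ∃ j v, (c)[j]? = some v ∧ x = kpair (ofNat (m + j)) (atom v)}

theorem seg_set_eq (m : ℕ) (c : List α) :
    {x | ∃ j v, (c)[j]? = some v ∧ x = kpair (ofNat (m + j)) (atom v)} =
      Set.range fun j : Fin c.length => kpair (ofNat (m + j)) (atom (c.get j)) := by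
  ext x
  constructor
  · rintro ⟨j, v, hj, rfl⟩
    obtain ⟨h, rfl⟩ := List.getElem?_eq_some_iff.1 hj
    exact ⟨⟨j, h⟩, rfl⟩
  · rintro ⟨j, rfl⟩
    exact ⟨j, c.get j, by simp, rfl⟩

theorem finite_seg_set (m : ℕ) (c : List α) :
    {x | ∃ j v, (c)[j]? = some v ∧ x = kpair (ofNat (m + j)) (atom v)}.Finite := by
  rw [seg_set_eq]
  exact Set.finite_range _

theorem mem_seg {m : ℕ} {c : List α} {x : HF α} :
    x ∈ seg m c ↔ ∃ j v, (c)[j]? = some v ∧ x = kpair (ofNat (m + j)) (atom v) :=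
  mem_ofSet (finite_seg_set m c)

theorem isSet_seg (m : ℕ) (c : List α) : IsSet (seg m c) := isSet_ofSet _

theorem kpair_mem_seg {i : ℕ} {c : List α} {v : α} :
    kpair (ofNat i) (atom v) ∈ seg 0 c ↔ (c)[i]? = some v := by
  rw [mem_seg]
  constructor
  · rintro ⟨j, w, hj, h⟩
    obtain ⟨h1, h2⟩ := kpair_inj.1 h
    rw [ofNat_inj] at h1
    rw [h1, zero_add, hj, atom_injective h2]
  · exact fun h => ⟨i, v, h, by rw [zero_add]⟩

@[simp]
theorem seg_nil (m : ℕ) : seg m ([] : List α) = ∅ :=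
  eq_empty (isSet_seg _ _) fun z hz => by
    obtain ⟨j, v, h, -⟩ := mem_seg.1 hz
    simp at h

theorem ofTuple_eq_seg (a : List α) : ofTuple a = seg 0 a := by
  rw [ofTuple, seg, seg_set_eq]
  congr 1
  ext x
  simp only [Set.mem_ofPred_eq, Set.mem_range, zero_add, eq_comm]

theorem cup_seg (m : ℕ) (a c : List α) : cup (seg m a) (seg (m + a.length) c) = seg m (a ++ c) :=
  (isSet_cup _ _).ext (isSet_seg _ _) fun z => by
    rw [mem_cup, mem_seg, mem_seg, mem_seg]
    constructor
    · rintro (⟨j, v, h, rfl⟩ | ⟨j, v, h, rfl⟩)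
      · refine ⟨j, v, ?_, rfl⟩
        rw [List.getElem?_append_left (List.getElem?_eq_some_iff.1 h).1, h]
      · refine ⟨a.length + j, v, ?_, by rw [add_assoc]⟩
        rw [List.getElem?_append_right (by omega), Nat.add_sub_cancel_left, h]
    · rintro ⟨j, v, h, rfl⟩
      rcases lt_or_ge j a.length with hj | hj
      · rw [List.getElem?_append_left hj] at h
        exact Or.inl ⟨j, v, h, rfl⟩
      · rw [List.getElem?_append_right hj] at h
        exact Or.inr ⟨j - a.length, v, h, by congr 2; omega⟩

theorem seg_singleton (m : ℕ) (v : α) :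
    seg m [v] = pair (kpair (ofNat m) (atom v)) (kpair (ofNat m) (atom v)) :=
  (isSet_seg _ _).ext (isSet_pair _ _) fun z => by
    rw [mem_seg, mem_pair, or_self]
    constructor
    · rintro ⟨j, w, h, rfl⟩
      obtain ⟨h1, h2⟩ := List.getElem?_eq_some_iff.1 h
      have hj : j = 0 := by simpa using h1
      subst hj
      simp at h2
      rw [h2, add_zero]
    · rintro rfl
      exact ⟨0, v, rfl, by rw [add_zero]⟩

theorem card_seg (m : ℕ) (c : List α) : card (seg m c) = ofNat c.length := by
  rw [seg, card_ofSet (finite_seg_set m c), seg_set_eq, ← Set.image_univ,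
    Set.ncard_image_of_injective, Set.ncard_univ, Nat.card_eq_fintype_card, Fintype.card_fin]
  intro i j h
  have h1 := (kpair_inj.1 h).1
  rw [ofNat_inj] at h1
  exact Fin.ext (by omega)

theorem seg_ne_of_length_ne {m : ℕ} {c d : List α} (h : c.length ≠ d.length) :
    seg m c ≠ seg m d := by
  intro h1
  have h2 := congrArg card h1
  rw [card_seg, card_seg, ofNat_inj] at h2
  exact h h2

theorem map_seg (f : α → β) (m : ℕ) (c : List α) : map f (seg m c) = seg m (c.map f) := by
  rw [seg, map_ofSet f (finite_seg_set m c), seg]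
  congr 1
  ext x
  constructor
  · rintro ⟨_, ⟨j, v, h, rfl⟩, rfl⟩
    exact ⟨j, f v, by rw [List.getElem?_map, h]; rfl, by simp⟩
  · rintro ⟨j, w, h, rfl⟩
    rw [List.getElem?_map, Option.map_eq_some_iff] at h
    obtain ⟨v, h, rfl⟩ := h
    exact ⟨_, ⟨j, v, h, rfl⟩, by simp⟩

theorem ncard_tc_cup (a b : HF α) : (tc (cup a b)).ncard ≤ (tc a).ncard + (tc b).ncard := by
  have : tc (cup a b) = tc a ∪ tc b := by
    ext x
    rw [Set.mem_union, mem_tc, mem_tc, mem_tc]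
    simp only [mem_cup]
    constructor
    · rintro ⟨c, hc | hc, h⟩
      · exact Or.inl ⟨c, hc, h⟩
      · exact Or.inr ⟨c, hc, h⟩
    · rintro (⟨c, hc, h⟩ | ⟨c, hc, h⟩)
      · exact ⟨c, Or.inl hc, h⟩
      · exact ⟨c, Or.inr hc, h⟩
  rw [this]
  exact Set.ncard_union_le _ _

theorem ncard_tc_seg (m : ℕ) (c : List α) :
    (tc (seg m c)).ncard ≤ c.length * (3 * (m + c.length) + 20) := by
  induction c using List.reverseRecOn with
  | nil => simp [tc_empty]
  | append_singleton c v ih =>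
    rw [← cup_seg, seg_singleton]
    set p := kpair (ofNat (m + c.length)) (atom v) with hp
    have h1 := ncard_tc_cup (seg m c) (pair p p)
    have h2 : (tc (pair p p)).ncard ≤ 1 + (tc p).ncard := by
      have : tc (pair p p) = insert p (tc p) := by
        rw [tc_eq_biUnion]
        simp
      rw [this]
      have := Set.ncard_insert_le p (tc p)
      omega
    have h3 := ncard_tc_kpair (ofNat (m + c.length)) (atom v)
    have h4 := ncard_tc_ofNat (α := α) (m + c.length)
    rw [tc_atom, Set.ncard_empty] at h3
    rw [← hp] at h3
    simp only [List.length_append, List.length_singleton]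
    nlinarith

end HF

/-! ## Individualization -/

namespace CPTWSC

open HF

variable {τ : Language}

section

variable {α β : Type} [τ.Structure α] [τ.Structure β]

/-- The set of atoms selected by the term `s` for the tuple `t`. -/
def Sel (s : Term τ) (t : List α) : Set α :=
  {v | ∃ X, s.eval (valuation [ofTuple t]) = some X ∧ atom v ∈ X}

/-- The term `s` selects an orbit for every tuple, and a new one if there are further atoms. -/
structure Individualizes (s : Term τ) (α : Type) [τ.Structure α] : Prop where
  eval_eq : ∀ t : List α, t.Nodup →
    s.eval (valuation [ofTuple t]) = some (ofSet (atom '' Sel s t))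
  orbit : ∀ t : List α, t.Nodup → ∀ u ∈ Sel s t, ∀ v ∈ Sel s t,
    ∃ φ : α ≃[τ] α, t.map φ = t ∧ φ u = v
  fresh : ∀ t : List α, t.Nodup → (∃ x, x ∉ t) → (Sel s t).Nonempty ∧ ∀ v ∈ Sel s t, v ∉ t

theorem map_comp_valuation (f : α → β) (l : List (HF α)) :
    HF.map f ∘ valuation l = valuation (l.map (HF.map f)) := by
  funext i
  simp only [valuation, Function.comp_apply, List.getD_eq_getElem?_getD, List.getElem?_map]
  rcases l[i]? with _ | x <;> simp

theorem Term.eval_equiv [Finite α] [Finite β] (s : Term τ) (φ : α ≃[τ] β) (l : List (HF α)) :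
    s.eval (valuation (l.map (HF.map φ))) = (s.eval (valuation l)).map (HF.map φ) := by
  rw [← map_comp_valuation, Term.eval, Term.eval, BGS.Term.eval_map, Nat.card_congr φ.toEquiv]

theorem map_mem_sel [Finite α] [Finite β] {s : Term τ} (φ : α ≃[τ] β) {t : List α} {v : α}
    (h : v ∈ Sel s t) : φ v ∈ Sel s (t.map φ) := by
  obtain ⟨X, hX, hv⟩ := h
  refine ⟨HF.map φ X, ?_, ?_⟩
  · have := s.eval_equiv φ [ofTuple t]
    rw [hX] at this
    simpa [ofTuple_eq_seg, map_seg] using this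
  · rw [← map_atom]
    exact map_mem_map hv

/-- The tuple `d` arises by successively adding selected atoms, beginning with the tuple `t`. -/
def Chain (s : Term τ) : List α → List α → Prop
  | _, [] => True
  | t, v :: d => v ∈ Sel s t ∧ Chain s (t ++ [v]) d

theorem chain_append {s : Term τ} {t d e : List α} :
    Chain s t (d ++ e) ↔ Chain s t d ∧ Chain s (t ++ d) e := by
  induction d generalizing t with
  | nil => simp [Chain]
  | cons v d ih =>
    rw [List.cons_append, Chain, Chain, ih, and_assoc, List.append_assoc, List.singleton_append]

theorem chain_concat {s : Term τ} {t d : List α} {v : α} :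
    Chain s t (d ++ [v]) ↔ Chain s t d ∧ v ∈ Sel s (t ++ d) := by
  rw [chain_append]
  simp [Chain]

theorem exists_not_mem [Finite α] {t : List α} (h : t.length < Nat.card α) : ∃ x, x ∉ t := by
  classical
  have := Fintype.ofFinite α
  by_contra! hall
  have h1 : Finset.univ ⊆ t.toFinset := fun x _ => List.mem_toFinset.2 (hall x)
  have h2 := Finset.card_le_card h1
  have h3 := t.toFinset_card_le
  rw [Finset.card_univ, ← Nat.card_eq_fintype_card] at h2
  omega

theorem length_le_card [Finite α] {t : List α} (h : t.Nodup) : t.length ≤ Nat.card α := by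
  have := Fintype.ofFinite α
  rw [Nat.card_eq_fintype_card]
  exact h.length_le_card

theorem mem_of_length_eq [Finite α] {t : List α} (h : t.Nodup) (hl : t.length = Nat.card α)
    (x : α) : x ∈ t := by
  by_contra hx
  have := length_le_card (List.nodup_cons.2 ⟨hx, h⟩)
  simp at this
  omega

theorem Individualizes.nodup_chain [Finite α] {s : Term τ} (hs : Individualizes s α)
    {t d : List α} (ht : t.Nodup) (hd : Chain s t d) (hl : t.length + d.length ≤ Nat.card α) :
    (t ++ d).Nodup := by
  induction d generalizing t with
  | nil => simpa using ht
  | cons v d ih =>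
    simp only [List.length_cons] at hl
    have hv := (hs.fresh t ht (exists_not_mem (by omega))).2 v hd.1
    have := ih (t := t ++ [v]) (by
      rw [List.nodup_append]
      refine ⟨ht, by simp, ?_⟩
      rintro a ha b hb rfl
      simp at hb
      exact hv (hb ▸ ha)) hd.2 (by simp; omega)
    simpa using this

theorem Individualizes.exists_chain [Finite α] {s : Term τ} (hs : Individualizes s α)
    {t : List α} (ht : t.Nodup) : ∃ d, Chain s t d ∧ t.length + d.length = Nat.card α := by
  have hle := length_le_card ht
  obtain ⟨m, hm⟩ : ∃ m, m = Nat.card α - t.length := ⟨_, rfl⟩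
  induction m generalizing t with
  | zero => exact ⟨[], trivial, by simp; omega⟩
  | succ m ih =>
    obtain ⟨⟨v, hv⟩, hfr⟩ := hs.fresh t ht (exists_not_mem (by omega))
    have hnd : (t ++ [v]).Nodup := by
      rw [List.nodup_append]
      refine ⟨ht, by simp, ?_⟩
      rintro a ha b hb rfl
      simp at hb
      exact hfr v hv (hb ▸ ha)
    obtain ⟨d, hd, hl⟩ := ih hnd (length_le_card hnd) (by simp; omega)
    exact ⟨v :: d, ⟨hv, hd⟩, by simp at hl ⊢; omega⟩

/-- Chains which are built over isomorphic tuples are isomorphic. -/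
theorem exists_equiv_of_chain [Finite α] [Finite β] {s : Term τ}
    (hβ : Individualizes s β) {t d : List α} {e : List β} (φ : α ≃[τ] β)
    (hd : Chain s t d) (he : Chain s (t.map φ) e)
    (hnd : (t.map φ ++ e).Nodup) (hl : d.length = e.length) :
    ∃ ψ : α ≃[τ] β, (t ++ d).map ψ = t.map φ ++ e := by
  induction d generalizing t e φ with
  | nil =>
    cases e with
    | nil => exact ⟨φ, by simp⟩
    | cons w e => simp at hl
  | cons v d ih =>
    cases e with
    | nil => simp at hl
    | cons w e =>
      obtain ⟨θ, hθ, hθv⟩ := hβ.orbit (t.map φ) (List.nodup_append.1 hnd).1 (φ v)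
        (map_mem_sel φ hd.1) w he.1
      have hmap : (t ++ [v]).map (θ.comp φ) = t.map φ ++ [w] := by
        have hc : (θ.comp φ : α → β) = θ ∘ φ := rfl
        rw [List.map_append, hc, ← List.map_map, hθ]
        simp [hθv]
      obtain ⟨ψ, hψ⟩ := ih (t := t ++ [v]) (e := e) (θ.comp φ) hd.2 (by rw [hmap]; exact he.2)
        (by rw [hmap]; simpa using hnd) (by simpa using hl)
      refine ⟨ψ, ?_⟩
      rw [hmap] at hψ
      simpa using hψ

end

end CPTWSC

/-! ## Terms for the canonization procedure -/

namespace BGS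

open HF CPTWSC

variable {τ : Language}

namespace Term

/-- The extension of the parameter tuple by the tuple `x`. -/
def tup (x : ℕ) : Term τ := cup (.var 0) (.var x)

/-- The tuple `z` extended by the atom `e`, where `T` is the whole tuple. -/
def concat (z T e : Term τ) : Term τ := cup z (.pair (kpair (.card T) e) (kpair (.card T) e))

end Term

/-- The tuple `T` contains all atoms. -/
def Formula.full (T : Term τ) : Formula τ := .eq (.card T) (.card .atoms)

namespace Term

/-- One step of an individualization procedure: the stage `x` is extended by `x + 1`. -/
def individualize (x : ℕ) : Term τ :=
  .ite x (.full (tup x)) (.var x) (concat (.var x) (tup x) (.var (x + 1)))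

/-- The orbit selected by `s` for the stage `x`. -/
def select (s : Term τ) (x : ℕ) : Term τ :=
  .ite x (.full (tup x)) .empty (.subst 0 (tup x) s)

/-- The element of `x + 5` which is minimal with respect to the order given by `x`. -/
def minimum (x : ℕ) : Term τ :=
  .unique (.compr (.var (x + 6)) (x + 6) (.var (x + 5))
    (.ex (x + 7) (.card .atoms) (.and (.mem (.kpair (.var (x + 7)) (.var (x + 6))) (tup x))
      (.not (.ex (x + 8) (.var (x + 7)) (.ex (x + 9) (.var (x + 5))
        (.mem (.kpair (.var (x + 8)) (.var (x + 9))) (tup x))))))))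

/-- The stage `x + 1` with the atom `e` added. -/
def base (x e : ℕ) : Term τ := concat (tup (x + 1)) (tup (x + 1)) (.var e)

/-- The body of the iteration `extension`. -/
def extensionStep (s : Term τ) (x e : ℕ) : Term τ :=
  .ite (x + 4) (.full (cup (base x e) (.var (x + 4)))) (.var (x + 4))
    (.subst (x + 5) (.subst 0 (cup (base x e) (.var (x + 4))) s)
      (concat (.var (x + 4)) (cup (base x e) (.var (x + 4))) (minimum x)))

/-- A tuple of all atoms which extends the stage `x + 1` and the atom `e`; the order given by `x`
is used to choose from the selected orbits. -/
def extension (s : Term τ) (x e : ℕ) : Term τ :=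
  cup (base x e) (.iter (extensionStep s x e) (x + 4))

/-- The graph of the map sending the tuple `x + 4` to the tuple `x + 5`. -/
def graph (x : ℕ) : Term τ :=
  .union (.compr (.compr (.kpair (.var (x + 6)) (.var (x + 7))) (x + 7) .atoms
    (.ex (x + 8) (.card .atoms) (.and (.mem (.kpair (.var (x + 8)) (.var (x + 6))) (.var (x + 4)))
      (.mem (.kpair (.var (x + 8)) (.var (x + 7))) (.var (x + 5)))))) (x + 6) .atoms .tt)

/-- The graph of an automorphism sending the atom `x + 2` to the atom `x + 3`. -/
def transport (s : Term τ) (x : ℕ) : Term τ :=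
  .subst (x + 4) (extension s x (x + 2)) (.subst (x + 5) (extension s x (x + 3)) (graph x))

/-- The witnessing automorphisms for the stage `x + 1` and the fixed point `x`. -/
def witness (s : Term τ) (x : ℕ) : Term τ :=
  .union (.compr (.compr (transport s x) (x + 3) (select s (x + 1)) .tt) (x + 2)
    (select s (x + 1)) .tt)

/-- The atom represented by the element `v` of the canonical form, given the order `x`. -/
def lookup (x v : ℕ) : Term τ :=
  .unique (.compr (.var (x + 1)) (x + 1) .atoms
    (.ex (x + 2) (.card .atoms) (.and (.eq (.var v) (.kpair (.card (.var 0)) (.var (x + 2))))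
      (.mem (.kpair (.var (x + 2)) (.var (x + 1))) (tup x)))))

end Term

/-- The relation `R` of the canonical form. -/
def Formula.canonRel (s : Term τ) {n : ℕ} (R : τ.Relations n) : Formula τ :=
  .wsc (n + 1) (n + 2) (.individualize (n + 1)) (.select s (n + 1)) (.witness s (n + 1))
    (.rel R fun i => .lookup (n + 1) (i + 1))

section FreeVariables

@[simp] theorem fv_tup (x : ℕ) : (Term.tup x : Term τ).fv = {0, x} := by
  rw [Term.tup, fv_cup, Set.insert_eq]
  rfl

@[simp] theorem fv_concat (z T e : Term τ) :
    (Term.concat z T e).fv = z.fv ∪ (T.fv ∪ e.fv) := by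
  simp [Term.concat, Term.fv]

@[simp] theorem fv_full (T : Term τ) : (Formula.full T).fv = T.fv := by
  simp [Formula.full, Formula.fv, Term.fv]

theorem fv_canonRel {s : Term τ} (hs : s.fv ⊆ {0}) {n : ℕ} (R : τ.Relations n) :
    (Formula.canonRel s R).fv ⊆ {i | i ≤ n} := by
  have h0 : ∀ i, i ∈ s.fv → i = 0 := fun i hi => hs hi
  intro i hi
  have hi0 := h0 i
  change i ≤ n
  simp only [Formula.canonRel, Formula.fv, Set.mem_union, Set.mem_sdiff, Set.mem_iUnion,
    Set.mem_insert_iff, Set.mem_singleton_iff] at hi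
  rcases hi with ((⟨h1, h2⟩ | ⟨h1, h2⟩) | ⟨h1, h2⟩) | ⟨⟨j, h1⟩, h2⟩
  · simp only [Term.individualize, fv_ite, fv_full, fv_tup, fv_concat, Term.fv, Set.mem_union,
      Set.mem_insert_iff, Set.mem_singleton_iff] at h1
    omega
  · simp only [Term.select, fv_ite, fv_full, fv_tup, fv_term_subst, Term.fv, Set.mem_union,
      Set.mem_insert_iff, Set.mem_singleton_iff, Set.mem_sdiff, Set.mem_empty_iff_false] at h1
    by_cases hi : i ∈ s.fv
    · have := hi0 hi
      omega
    · simp only [hi, false_and, or_false] at h1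
      omega
  · simp only [Term.witness, Term.transport, Term.graph, Term.extension, Term.extensionStep,
      Term.base, Term.minimum, Term.select, fv_ite, fv_full, fv_tup, fv_concat, fv_term_subst,
      fv_cup, fv_tt, fv_ex, fv_mem, fv_kpair, Term.fv, Formula.fv, Set.mem_union,
      Set.mem_insert_iff, Set.mem_singleton_iff, Set.mem_sdiff, Set.mem_empty_iff_false] at h1
    by_cases hi : i ∈ s.fv
    · have := hi0 hi
      omega
    · simp only [hi, false_and, or_false, false_or] at h1
      omega
  · have := j.2
    simp only [Term.lookup, fv_tup, fv_ex, fv_mem, fv_kpair, Term.fv, Formula.fv, Set.mem_union,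
      Set.mem_insert_iff, Set.mem_singleton_iff, Set.mem_sdiff, Set.mem_empty_iff_false,
      or_false, false_or] at h1 h2
    omega

end FreeVariables

section Evaluation

variable {α : Type} [τ.Structure α] {Q : ℕ} {ρ : ℕ → HF α}

theorem eval_tup {x : ℕ} {a c : List α} (h0 : ρ 0 = seg 0 a) (hx : ρ x = seg a.length c) :
    (Term.tup x : Term τ).eval Q ρ = some (seg 0 (a ++ c)) := by
  rw [Term.tup, eval_cup (eval_var 0) (eval_var x), h0, hx, ← cup_seg, zero_add]

theorem eval_concat {z T e : Term τ} {m : ℕ} {c t : List α} {v : α}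
    (hz : z.eval Q ρ = some (seg m c)) (hT : T.eval Q ρ = some (seg 0 t))
    (ht : m + c.length = t.length) (he : e.eval Q ρ = some (atom v)) :
    (Term.concat z T e).eval Q ρ = some (seg m (c ++ [v])) := by
  have h := eval_kpair (eval_card hT) he
  rw [Term.concat, eval_cup hz (eval_pair h h), ← cup_seg, seg_singleton, card_seg, ht]

theorem eval_base {x e : ℕ} {a c : List α} {u : α} (h0 : ρ 0 = seg 0 a)
    (hy : ρ (x + 1) = seg a.length c) (he : ρ e = atom u) :
    (Term.base x e : Term τ).eval Q ρ = some (seg 0 (a ++ c ++ [u])) :=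
  eval_concat (eval_tup h0 hy) (eval_tup h0 hy) (by simp) (by rw [eval_var, he])

variable [Finite α]

theorem eval_full {T : Term τ} {t : List α} (hT : T.eval Q ρ = some (seg 0 t)) :
    (Formula.full T).eval Q ρ = some (t.length = Nat.card α) := by
  rw [Formula.full, eval_eq (eval_card hT) (eval_card_atoms ρ), card_seg, ofNat_inj]

theorem eval_individualize_of_full {x : ℕ} {a c : List α} (h0 : ρ 0 = seg 0 a)
    (hx : ρ x = seg a.length c) (hl : (a ++ c).length = Nat.card α) :
    (Term.individualize x : Term τ).eval Q ρ = some (seg a.length c) := by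
  rw [Term.individualize, eval_ite (eval_full (eval_tup h0 hx)), if_pos hl, eval_var, hx]

theorem eval_individualize {x : ℕ} {a c : List α} {v : α} (h0 : ρ 0 = seg 0 a)
    (hx : ρ x = seg a.length c) (hy : ρ (x + 1) = atom v) (hl : (a ++ c).length ≠ Nat.card α) :
    (Term.individualize x : Term τ).eval Q ρ = some (seg a.length (c ++ [v])) := by
  rw [Term.individualize, eval_ite (eval_full (eval_tup h0 hx)), if_neg hl]
  exact eval_concat (by rw [eval_var, hx]) (eval_tup h0 hx) (by simp) (by rw [eval_var, hy])

theorem eval_select_of_full {s : Term τ} {x : ℕ} {a c : List α} (h0 : ρ 0 = seg 0 a)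
    (hx : ρ x = seg a.length c) (hl : (a ++ c).length = Nat.card α) :
    (Term.select s x).eval Q ρ = some ∅ := by
  rw [Term.select, eval_ite (eval_full (eval_tup h0 hx)), if_pos hl]
  rfl

/-- Under the bound `Q`, the term `s'` selects the same sets as `s`. -/
def SelectsLike (s' : Term τ) (s : CPTWSC.Term τ) (Q : ℕ) (α : Type) [τ.Structure α] : Prop :=
  ∀ (ρ : ℕ → HF α) (t : List α), t.Nodup → ρ 0 = seg 0 t →
    s'.eval Q ρ = some (ofSet (atom '' Sel s t))

theorem eval_select {s' : Term τ} {s : CPTWSC.Term τ} (hs : SelectsLike s' s Q α) {x : ℕ}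
    {a c : List α} (h0 : ρ 0 = seg 0 a) (hx : ρ x = seg a.length c) (hn : (a ++ c).Nodup)
    (hl : (a ++ c).length ≠ Nat.card α) :
    (Term.select s' x).eval Q ρ = some (ofSet (atom '' Sel s (a ++ c))) := by
  rw [Term.select, eval_ite (eval_full (eval_tup h0 hx)), if_neg hl, eval_subst (eval_tup h0 hx)]
  exact hs _ _ hn (by simp)

theorem mem_ofSet_atoms {S : Set α} {x : HF α} : x ∈ ofSet (atom '' S) ↔ ∃ v ∈ S, x = atom v := by
  rw [mem_ofSet (S.toFinite.image _)]
  simp only [Set.mem_image, eq_comm]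

theorem eval_minimum {x : ℕ} {a c : List α} {S : Set α} (hS : S.Nonempty)
    (h0 : ρ 0 = seg 0 a) (hx : ρ x = seg a.length c) (hn : (a ++ c).Nodup)
    (hl : (a ++ c).length = Nat.card α) (hS' : ρ (x + 5) = ofSet (atom '' S)) :
    ∃ v ∈ S, (Term.minimum x : Term τ).eval Q ρ = some (atom v) := by
  classical
  have hev : (Term.minimum x : Term τ).eval Q ρ = some (HF.unique (ofSet {d | ∃ b,
      b ∈ ofSet (atom '' S) ∧ (∃ i, i ∈ (ofNat (Nat.card α) : HF α) ∧
        (HF.kpair i b ∈ seg 0 (a ++ c) ∧ ¬ ∃ j, j ∈ i ∧ ∃ w, w ∈ ofSet (atom '' S) ∧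
          HF.kpair j w ∈ seg 0 (a ++ c))) ∧ b = d})) := by
    refine eval_unique (eval_compr (f := fun b => b) (by rw [eval_var, hS']) (fun b _ => ?_)
      (fun b _ _ => by simp))
    refine eval_ex (eval_card_atoms _) fun i _ => eval_and ?_ (eval_not ?_)
    · refine (eval_mem (eval_kpair rfl rfl) (eval_tup (a := a) (c := c) ?_ ?_)).trans ?_
      · simp [h0]
      · simp [hx]
      · simp
    · refine eval_ex (a := i) (by simp) fun j _ => eval_ex (a := ofSet (atom '' S))
        (by simp [hS']) fun w _ => ?_
      refine (eval_mem (eval_kpair rfl rfl) (eval_tup (a := a) (c := c) ?_ ?_)).trans ?_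
      · simp [h0]
      · simp [hx]
      · simp
  have hex : ∃ (i : ℕ) (v : α), (a ++ c)[i]? = some v ∧ v ∈ S := by
    obtain ⟨v, hv⟩ := hS
    obtain ⟨i, hi⟩ := List.mem_iff_getElem?.1 (mem_of_length_eq hn hl v)
    exact ⟨i, v, hi, hv⟩
  obtain ⟨v, hv, hvS⟩ := Nat.find_spec hex
  refine ⟨v, hvS, ?_⟩
  rw [hev]
  congr 1
  refine unique_eq (isSet_ofSet _) fun z => ?_
  rw [mem_ofSet (finite_image_set _ _ _)]
  constructor
  · rintro ⟨b, hb, ⟨i, hi, h1, h2⟩, rfl⟩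
    obtain ⟨w, hw, rfl⟩ := mem_ofSet_atoms.1 hb
    obtain ⟨k, -, rfl⟩ := mem_ofNat.1 hi
    rw [kpair_mem_seg] at h1
    have h3 : Nat.find hex ≤ k := Nat.find_min' hex ⟨w, h1, hw⟩
    have h4 : ¬ Nat.find hex < k := fun h => h2 ⟨ofNat (Nat.find hex), by simpa using h, atom v,
      mem_ofSet_atoms.2 ⟨v, hvS, rfl⟩, kpair_mem_seg.2 hv⟩
    have h5 : k = Nat.find hex := by omega
    rw [h5, hv] at h1
    cases h1
    rfl
  · rintro rfl
    refine ⟨atom v, mem_ofSet_atoms.2 ⟨v, hvS, rfl⟩, ⟨ofNat (Nat.find hex), ?_, kpair_mem_seg.2 hv,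
      ?_⟩, rfl⟩
    · rw [ofNat_mem_ofNat, ← hl]
      exact (List.getElem?_eq_some_iff.1 hv).1
    · rintro ⟨j, hj, w, hw, h1⟩
      obtain ⟨k, hk, rfl⟩ := mem_ofNat.1 hj
      obtain ⟨w, hwS, rfl⟩ := mem_ofSet_atoms.1 hw
      exact Nat.find_min hex hk ⟨w, kpair_mem_seg.1 h1, hwS⟩

theorem eval_extension {s' : Term τ} {s : CPTWSC.Term τ} (hs : SelectsLike s' s Q α)
    (hi : Individualizes s α) {x e : ℕ} (he0 : e ≠ x + 4)
    (he1 : e ≠ x + 5)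
    (hQ : 3 * Nat.card α ^ 2 + 20 * Nat.card α + 10 ≤ Q) {a c C : List α} {u : α}
    (h0 : ρ 0 = seg 0 a) (hx : ρ x = seg a.length C) (hn : (a ++ C).Nodup)
    (hl : (a ++ C).length = Nat.card α) (hy : ρ (x + 1) = seg a.length c) (he : ρ e = atom u)
    (hnu : (a ++ c ++ [u]).Nodup) :
    ∃ d, Chain s (a ++ c ++ [u]) d ∧ (a ++ c ++ [u] ++ d).length = Nat.card α ∧
      (Term.extension s' x e).eval Q ρ = some (seg 0 (a ++ c ++ [u] ++ d)) := by
  set t := a ++ c ++ [u] with ht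
  have hcup : ∀ d : List α, (Term.cup (.base x e) (.var (x + 4)) : Term τ).eval Q
      (Function.update ρ (x + 4) (seg t.length d)) = some (seg 0 (t ++ d)) := by
    intro d
    rw [eval_cup (eval_base (a := a) (c := c) (u := u) (by simp [h0]) (by simp [hy])
      (by rw [Function.update_of_ne he0, he])) (eval_var _), Function.update_self, ← ht,
      ← cup_seg 0 t d, zero_add]
  have hsmall : ∀ d : List α, (t ++ d).length ≤ Nat.card α → Small Q (seg t.length d) := by
    intro d hd
    rw [HF.small_iff]
    have h1 := ncard_tc_seg t.length d
    rw [List.length_append] at hd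
    have h2 : d.length * (3 * (t.length + d.length) + 20) ≤
        Nat.card α * (3 * Nat.card α + 20) := Nat.mul_le_mul (by omega) (by omega)
    nlinarith
  have hfull : ∀ d : List α, (t ++ d).length = Nat.card α →
      (Term.extensionStep s' x e).eval Q (Function.update ρ (x + 4) (seg t.length d)) =
        some (seg t.length d) := by
    intro d hd
    rw [Term.extensionStep, eval_ite (eval_full (hcup d)), if_pos hd, eval_var,
      Function.update_self]
  have hstep : ∀ d : List α, (t ++ d).Nodup → (t ++ d).length ≠ Nat.card α →
      ∃ v ∈ Sel s (t ++ d), (Term.extensionStep s' x e).eval Q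
        (Function.update ρ (x + 4) (seg t.length d)) = some (seg t.length (d ++ [v])) := by
    intro d hd hdl
    have hne := (hi.fresh _ hd (exists_not_mem (lt_of_le_of_ne (length_le_card hd) hdl))).1
    have hsel : (Term.subst 0 (.cup (.base x e) (.var (x + 4))) s').eval Q
        (Function.update ρ (x + 4) (seg t.length d)) =
          some (ofSet (atom '' Sel s (t ++ d))) := by
      rw [eval_subst (hcup d)]
      exact hs _ _ hd (by simp)
    obtain ⟨v, hv, hmin⟩ := eval_minimum (τ := τ) (Q := Q) (x := x) (ρ := Function.update (Function.update ρ
      (x + 4) (seg t.length d)) (x + 5) (ofSet (atom '' Sel s (t ++ d)))) hne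
      (a := a) (c := C) (by simp [h0]) (by simp [hx]) hn hl (by simp)
    refine ⟨v, hv, ?_⟩
    rw [Term.extensionStep, eval_ite (eval_full (hcup d)), if_neg hdl, eval_subst hsel]
    refine eval_concat (t := t ++ d) (by simp) ?_ (by simp) hmin
    rw [eval_cup (eval_base (a := a) (c := c) (u := u) (by simp [h0]) (by simp [hy]) ?_)
      (eval_var _), ← ht, ← cup_seg 0 t d, zero_add]
    · simp
    · rw [Function.update_of_ne he1, Function.update_of_ne he0, he]
  have hiter : ∀ (r : ℕ) (d : List α), Chain s t d → (t ++ d).Nodup →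
      Nat.card α ≤ (t ++ d).length + r → ∃ d', Chain s t d' ∧ (t ++ d').length = Nat.card α ∧
        iterate Q (fun b => (Term.extensionStep s' x e).eval Q (Function.update ρ (x + 4) b)) r
          (seg t.length d) = some (seg t.length d') := by
    intro r
    induction r with
    | zero =>
      intro d hd hnd hr
      have hle := length_le_card hnd
      have hdl : (t ++ d).length = Nat.card α := by omega
      refine ⟨d, hd, hdl, ?_⟩
      rw [iterate, if_pos (hsmall d hle), hfull d hdl, Option.map_some, if_pos rfl]
    | succ r ih =>
      intro d hd hnd hr
      have hle := length_le_card hnd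
      by_cases hdl : (t ++ d).length = Nat.card α
      · refine ⟨d, hd, hdl, ?_⟩
        rw [iterate, if_pos (hsmall d hle), hfull d hdl, Option.bind_some, if_pos rfl]
      · obtain ⟨v, hv, hev⟩ := hstep d hnd hdl
        have hch : Chain s t (d ++ [v]) := chain_concat.2 ⟨hd, hv⟩
        have hlt := lt_of_le_of_ne hle hdl
        have hnd' : (t ++ (d ++ [v])).Nodup := hi.nodup_chain hnu hch (by
          simp only [List.length_append, List.length_singleton] at hlt ⊢
          omega)
        obtain ⟨d', h1, h2, h3⟩ := ih (d ++ [v]) hch hnd' (by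
          simp only [List.length_append, List.length_singleton] at hr ⊢
          omega)
        refine ⟨d', h1, h2, ?_⟩
        rw [iterate, if_pos (hsmall d hle), hev, Option.bind_some,
          if_neg (seg_ne_of_length_ne (by simp)), h3]
  obtain ⟨d, h1, h2, h3⟩ := hiter Q [] trivial (by simpa using hnu) (by nlinarith)
  refine ⟨d, h1, h2, ?_⟩
  rw [seg_nil] at h3
  have h4 : (Term.iter (Term.extensionStep s' x e) (x + 4)).eval Q ρ = some (seg t.length d) := by
    rw [Term.eval, h3]
  rw [Term.extension, eval_cup (eval_base h0 hy he) h4, ← ht, ← cup_seg 0 t d, zero_add]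

end Evaluation

end BGS

namespace BGS

open HF CPTWSC

variable {τ : Language} {α : Type} [τ.Structure α] [Finite α] {Q : ℕ} {ρ : ℕ → HF α}

theorem mem_atoms {x : HF α} : x ∈ ofSet (Set.range (atom : α → HF α)) ↔ ∃ v, x = atom v := by
  rw [mem_ofSet (Set.finite_range _)]
  simp only [Set.mem_range, eq_comm]

theorem mem_graph {ψ : α ≃[τ] α} {x : HF α} :
    x ∈ HF.graph ψ ↔ ∃ u, x = HF.kpair (atom u) (atom (ψ u)) := by
  rw [HF.graph, mem_ofSet (Set.finite_range _)]
  simp only [Set.mem_range, eq_comm]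

theorem eval_graph {x : ℕ} {l : List α} {ψ : α ≃[τ] α} (hl : ∀ v, v ∈ l)
    (hlen : l.length ≤ Nat.card α) (hp : ρ (x + 4) = seg 0 l) (hq : ρ (x + 5) = seg 0 (l.map ψ)) :
    (Term.graph x : Term τ).eval Q ρ = some (HF.graph ψ) := by
  have hinner : ∀ b : HF α, (Term.compr (.kpair (.var (x + 6)) (.var (x + 7))) (x + 7) .atoms
      (.ex (x + 8) (.card .atoms) (.and (.mem (.kpair (.var (x + 8)) (.var (x + 6))) (.var (x + 4)))
        (.mem (.kpair (.var (x + 8)) (.var (x + 7))) (.var (x + 5))))) : Term τ).eval Q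
      (Function.update ρ (x + 6) b) = some (ofSet {d | ∃ b', b' ∈ ofSet (Set.range (atom : α → HF α)) ∧
        (∃ i, i ∈ (ofNat (Nat.card α) : HF α) ∧ (HF.kpair i b ∈ seg 0 l ∧
          HF.kpair i b' ∈ seg 0 (l.map ψ))) ∧ HF.kpair b b' = d}) := by
    intro b
    refine eval_compr (f := fun b' => HF.kpair b b') rfl (fun b' _ => ?_)
      (fun b' _ _ => (eval_kpair rfl rfl).trans (by simp))
    refine eval_ex (eval_card_atoms _) fun i _ => eval_and ?_ ?_
    · exact (eval_mem (eval_kpair rfl rfl) (eval_var _)).trans (by simp [hp])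
    · exact (eval_mem (eval_kpair rfl rfl) (eval_var _)).trans (by simp [hq])
  refine (eval_union (eval_compr (P := fun _ => True) rfl (fun b _ => eval_tt)
    (fun b _ _ => hinner b))).trans ?_
  congr 1
  refine (isSet_sUnion _).ext (isSet_ofSet _) fun z => ?_
  rw [mem_sUnion]
  refine Iff.trans ?_ mem_graph.symm
  constructor
  · rintro ⟨y, hy, hz⟩
    obtain ⟨b, hb, -, rfl⟩ := (mem_ofSet (finite_image_set _ _ _)).1 hy
    obtain ⟨b', hb', ⟨i, hi, h1, h2⟩, rfl⟩ := (mem_ofSet (finite_image_set _ _ _)).1 hz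
    obtain ⟨u, rfl⟩ := mem_atoms.1 hb
    obtain ⟨v, rfl⟩ := mem_atoms.1 hb'
    obtain ⟨k, -, rfl⟩ := mem_ofNat.1 hi
    rw [kpair_mem_seg] at h1 h2
    rw [List.getElem?_map, h1, Option.map_some, Option.some.injEq] at h2
    exact ⟨u, by rw [h2]⟩
  · rintro ⟨u, rfl⟩
    obtain ⟨i, hi⟩ := List.mem_iff_getElem?.1 (hl u)
    refine ⟨_, (mem_ofSet (finite_image_set _ _ _)).2 ⟨atom u, mem_atoms.2 ⟨u, rfl⟩, trivial, rfl⟩,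
      (mem_ofSet (finite_image_set _ _ _)).2 ⟨atom (ψ u), mem_atoms.2 ⟨ψ u, rfl⟩,
        ⟨ofNat i, ?_, ?_, ?_⟩, rfl⟩⟩
    · rw [ofNat_mem_ofNat]
      exact lt_of_lt_of_le (List.getElem?_eq_some_iff.1 hi).1 hlen
    · rwa [kpair_mem_seg]
    · rw [kpair_mem_seg, List.getElem?_map, hi]
      rfl

variable {s' : Term τ} {s : CPTWSC.Term τ}

theorem eval_transport (hs : SelectsLike s' s Q α) (hi : Individualizes s α) {x : ℕ}
    (hQ : 3 * Nat.card α ^ 2 + 20 * Nat.card α + 10 ≤ Q) {a c C : List α} {u v : α}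
    (h0 : ρ 0 = seg 0 a) (hx : ρ x = seg a.length C) (hn : (a ++ C).Nodup)
    (hl : (a ++ C).length = Nat.card α) (hy : ρ (x + 1) = seg a.length c)
    (hnc : (a ++ c).Nodup) (hlc : (a ++ c).length ≠ Nat.card α)
    (hu : ρ (x + 2) = atom u) (hv : ρ (x + 3) = atom v)
    (huS : u ∈ Sel s (a ++ c)) (hvS : v ∈ Sel s (a ++ c)) :
    ∃ ψ : α ≃[τ] α, (a ++ c).map ψ = a ++ c ∧ ψ u = v ∧
      (Term.transport s' x).eval Q ρ = some (HF.graph ψ) := by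
  have hlt := lt_of_le_of_ne (length_le_card hnc) hlc
  have hnd : ∀ w ∈ Sel s (a ++ c), (a ++ c ++ [w]).Nodup := fun w hw =>
    hi.nodup_chain (d := [w]) hnc ⟨hw, trivial⟩ hlt
  obtain ⟨φ, hφ, hφu⟩ := hi.orbit _ hnc u huS v hvS
  obtain ⟨d, hd, hdl, hde⟩ := eval_extension (x := x) (e := x + 2) hs hi (by omega) (by omega) hQ h0 hx
    hn hl hy hu (hnd u huS)
  set ρ' := Function.update ρ (x + 4) (seg 0 (a ++ c ++ [u] ++ d)) with hρ'
  obtain ⟨d', hd', hdl', hde'⟩ := eval_extension (x := x) (e := x + 3) (ρ := ρ') hs hi (by omega)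
    (by omega) hQ (a := a) (c := c) (C := C) (u := v) (by simp [hρ', h0]) (by simp [hρ', hx]) hn hl
    (by simp [hρ', hy]) (by simp [hρ', hv]) (hnd v hvS)
  have hmap : (a ++ c ++ [u]).map φ = a ++ c ++ [v] := by
    rw [List.map_append, hφ]
    simp [hφu]
  have hnd' : (a ++ c ++ [v] ++ d').Nodup := hi.nodup_chain (hnd v hvS) hd' (by
    rw [← hdl', List.length_append (bs := d')])
  obtain ⟨ψ, hψ⟩ := exists_equiv_of_chain hi φ hd (by rw [hmap]; exact hd')
    (by rw [hmap]; exact hnd') (by simp at hdl hdl'; omega)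
  rw [hmap] at hψ
  have h1 := hψ
  rw [List.map_append] at h1
  have h2 := (List.append_inj h1 (by simp)).1
  rw [List.map_append] at h2
  have h3 := List.append_inj h2 (by simp)
  refine ⟨ψ, h3.1, by simpa using h3.2, ?_⟩
  rw [Term.transport, eval_subst hde, ← hρ', eval_subst hde']
  have hndu : (a ++ c ++ [u] ++ d).Nodup := hi.nodup_chain (hnd u huS) hd (by
    rw [← hdl, List.length_append (bs := d)])
  refine eval_graph (l := a ++ c ++ [u] ++ d) (mem_of_length_eq hndu hdl) hdl.le ?_ ?_
  · rw [hρ']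
    simp
  · rw [hψ]
    simp

theorem eval_witness (hs : SelectsLike s' s Q α) (hi : Individualizes s α) {x : ℕ}
    (hQ : 3 * Nat.card α ^ 2 + 20 * Nat.card α + 10 ≤ Q) {a c C : List α}
    (h0 : ρ 0 = seg 0 a) (hx : ρ x = seg a.length C) (hn : (a ++ C).Nodup)
    (hl : (a ++ C).length = Nat.card α) (hy : ρ (x + 1) = seg a.length c)
    (hnc : (a ++ c).Nodup) :
    ∃ M, (Term.witness s' x).eval Q ρ = some M ∧
      (∀ m, m ∈ M → ∃ ψ : α ≃[τ] α, (a ++ c).map ψ = a ++ c ∧ m = HF.graph ψ) ∧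
      ((a ++ c).length ≠ Nat.card α → ∀ u ∈ Sel s (a ++ c), ∀ v ∈ Sel s (a ++ c),
        ∃ ψ : α ≃[τ] α, (a ++ c).map ψ = a ++ c ∧ ψ u = v ∧ HF.graph ψ ∈ M) := by
  obtain ⟨O, hO, hmem⟩ : ∃ O, (∀ ρ' : ℕ → HF α, ρ' 0 = seg 0 a → ρ' (x + 1) = seg a.length c →
      (Term.select s' (x + 1)).eval Q ρ' = some O) ∧
      ∀ b, b ∈ O ↔ (a ++ c).length ≠ Nat.card α ∧ ∃ v ∈ Sel s (a ++ c), b = atom v := by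
    by_cases hlc : (a ++ c).length = Nat.card α
    · exact ⟨∅, fun ρ' h h' => eval_select_of_full h h' hlc, fun b =>
        iff_of_false (not_mem_empty b) fun h => h.1 hlc⟩
    · refine ⟨_, fun ρ' h h' => eval_select hs h h' hnc hlc, fun b => ?_⟩
      rw [mem_ofSet_atoms]
      exact ⟨fun h => ⟨hlc, h⟩, fun h => h.2⟩
  have hF : ∀ b b', ∃ m, b ∈ O → b' ∈ O → (Term.transport s' x).eval Q
      (Function.update (Function.update ρ (x + 2) b) (x + 3) b') = some m ∧
      ∃ ψ : α ≃[τ] α, (a ++ c).map ψ = a ++ c ∧ m = HF.graph ψ ∧ HF.map ψ b = b' := by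
    intro b b'
    by_cases hb : b ∈ O ∧ b' ∈ O
    · obtain ⟨hlc, u, hu, rfl⟩ := (hmem _).1 hb.1
      obtain ⟨-, v, hv, rfl⟩ := (hmem _).1 hb.2
      obtain ⟨ψ, h1, h2, h3⟩ := eval_transport (x := x) (ρ := Function.update (Function.update ρ (x + 2)
        (atom u)) (x + 3) (atom v)) hs hi hQ (a := a) (c := c) (C := C) (by simp [h0])
        (by simp [hx]) hn hl (by simp [hy]) hnc hlc (by simp) (by simp) hu hv
      exact ⟨_, fun _ _ => ⟨h3, ψ, h1, rfl, by rw [map_atom, h2]⟩⟩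
    · exact ⟨∅, fun h h' => absurd ⟨h, h'⟩ hb⟩
  choose F hF using hF
  have hev := eval_union (eval_compr (N := Q) (ρ := ρ) (y := x + 2)
    (P := fun _ => True) (hO ρ h0 hy) (fun b _ => eval_tt)
    (fun b hb _ => eval_compr (s := Term.transport s' x) (y := x + 3)
      (P := fun _ => True) (f := fun b' => F b b')
      (hO _ (by simp [h0]) (by simp [hy])) (fun b' _ => eval_tt)
      (fun b' hb' _ => (hF b b' hb hb').1)))
  have hM : ∀ m, m ∈ HF.sUnion (ofSet {d | ∃ b, b ∈ O ∧ True ∧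
      ofSet {d | ∃ b', b' ∈ O ∧ True ∧ F b b' = d} = d}) ↔ ∃ b b', b ∈ O ∧ b' ∈ O ∧ m = F b b' := by
    intro m
    rw [mem_sUnion]
    constructor
    · rintro ⟨y, h1, h2⟩
      obtain ⟨b, hb, -, rfl⟩ := (mem_ofSet (finite_image_set _ _ _)).1 h1
      obtain ⟨b', hb', -, rfl⟩ := (mem_ofSet (finite_image_set _ _ _)).1 h2
      exact ⟨b, b', hb, hb', rfl⟩
    · rintro ⟨b, b', hb, hb', rfl⟩
      exact ⟨_, (mem_ofSet (finite_image_set _ _ _)).2 ⟨b, hb, trivial, rfl⟩,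
        (mem_ofSet (finite_image_set _ _ _)).2 ⟨b', hb', trivial, rfl⟩⟩
  refine ⟨_, hev, fun m hm => ?_, fun hlc u hu v hv => ?_⟩
  · obtain ⟨b, b', hb, hb', rfl⟩ := (hM m).1 hm
    obtain ⟨-, ψ, h1, h2, -⟩ := hF b b' hb hb'
    exact ⟨ψ, h1, h2⟩
  · have hb := (hmem (atom u)).2 ⟨hlc, u, hu, rfl⟩
    have hb' := (hmem (atom v)).2 ⟨hlc, v, hv, rfl⟩
    obtain ⟨-, ψ, h1, h2, h3⟩ := hF _ _ hb hb'
    exact ⟨ψ, h1, atom_injective h3, (hM _).2 ⟨_, _, hb, hb', h2.symm⟩⟩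

/-! ### Computations -/

/-- The stages of a computation which individualizes the atoms in `r`, in reverse order. -/
noncomputable def segs {α : Type} (k : ℕ) : List α → List (HF α)
  | [] => [∅]
  | v :: r => seg k (v :: r).reverse :: segs k r

theorem exists_segs_eq {α : Type} (k : ℕ) (r : List α) :
    ∃ l, segs k r = seg k r.reverse :: l ∧ l.head? ≠ some (seg k r.reverse) := by
  cases r with
  | nil => exact ⟨[], by simp [segs], by simp⟩
  | cons v r =>
    refine ⟨segs k r, rfl, ?_⟩
    cases r with
    | nil =>
      intro h
      refine seg_ne_of_length_ne (m := k) (c := ([] : List α)) (d := [v].reverse) (by simp) ?_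
      simpa [segs] using h
    | cons w r =>
      intro h
      refine seg_ne_of_length_ne (m := k) (c := (w :: r).reverse) (d := (v :: w :: r).reverse)
        (by simp) ?_
      simpa [segs] using h

theorem eq_of_cons_eq_segs {α : Type} {k : ℕ} {r : List α} {b : HF α} {l : List (HF α)}
    (h : b :: l = segs k r) : b = seg k r.reverse ∧ l.head? ≠ some b := by
  obtain ⟨l', h1, h2⟩ := exists_segs_eq k r
  rw [h1] at h
  cases h
  exact ⟨rfl, h2⟩

theorem length_segs {α : Type} (k : ℕ) (r : List α) : (segs k r).length = r.length + 1 := by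
  induction r with
  | nil => rfl
  | cons v r ih => simp [segs, ih]

theorem suffix_segs {α : Type} {k : ℕ} {r : List α} {b : HF α} {l : List (HF α)}
    (h : (b :: l) <:+ segs k r) : ∃ r', r' <:+ r ∧ b :: l = segs k r' := by
  induction r with
  | nil =>
    refine ⟨[], List.suffix_rfl, ?_⟩
    rcases List.suffix_cons_iff.1 h with h | h
    · exact h
    · simp at h
  | cons v r ih =>
    rcases List.suffix_cons_iff.1 h with h | h
    · exact ⟨v :: r, List.suffix_rfl, h⟩
    · obtain ⟨r', h1, h2⟩ := ih h
      exact ⟨r', h1.trans (List.suffix_cons v r), h2⟩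

theorem mem_segs {α : Type} {k : ℕ} {r : List α} {b : HF α} (h : b ∈ segs k r) :
    ∃ r', r' <:+ r ∧ b = seg k r'.reverse := by
  obtain ⟨l₁, l₂, h⟩ := List.append_of_mem h
  obtain ⟨r', h1, h2⟩ := suffix_segs (r := r) (b := b) (l := l₂) ⟨l₁, h.symm⟩
  exact ⟨r', h1, (eq_of_cons_eq_segs h2).1⟩

theorem chain_of_suffix {α : Type} [τ.Structure α] {s : CPTWSC.Term τ} {a r r' : List α} (h : r' <:+ r) (hr : Chain s a r.reverse) :
    Chain s a r'.reverse := by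
  obtain ⟨q, rfl⟩ := h
  rw [List.reverse_append, chain_append] at hr
  exact hr.1

/-- The functions `step` and `choice` individualize the atoms selected by `s`, starting with the
tuple `a`, until all atoms are individualized. -/
structure Individualizing (s : CPTWSC.Term τ) (a : List α)
    (step : HF α → HF α → Option (HF α)) (choice : HF α → Option (HF α)) : Prop where
  step_full : ∀ c e, (a ++ c).length = Nat.card α →
    step (seg a.length c) e = some (seg a.length c)
  step_concat : ∀ c v, (a ++ c).length ≠ Nat.card α →
    step (seg a.length c) (atom v) = some (seg a.length (c ++ [v]))
  choice_full : ∀ c, (a ++ c).length = Nat.card α → choice (seg a.length c) = some ∅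
  choice_sel : ∀ c, (a ++ c).Nodup → (a ++ c).length ≠ Nat.card α →
    choice (seg a.length c) = some (ofSet (atom '' Sel s (a ++ c)))

section Runs

variable {a : List α} {step : HF α → HF α → Option (HF α)} {choice : HF α → Option (HF α)}

theorem Individualizing.eq_atom (h : Individualizing s a step choice) (hi : Individualizes s α)
    {c : List α} (hn : (a ++ c).Nodup) (hl : (a ++ c).length ≠ Nat.card α) {Y e : HF α}
    (hY : choice (seg a.length c) = some Y) (he : IsChoice Y e) :
    ∃ v ∈ Sel s (a ++ c), e = atom v := by
  rw [h.choice_sel c hn hl] at hY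
  cases hY
  rcases he with he | ⟨he, -⟩
  · exact mem_ofSet_atoms.1 he
  · obtain ⟨v, hv⟩ := (hi.fresh _ hn (exists_not_mem (lt_of_le_of_ne (length_le_card hn) hl))).1
    exact absurd (mem_ofSet_atoms.2 ⟨v, hv, rfl⟩) (he _)

theorem Individualizing.run_spec (h : Individualizing s a step choice) (hi : Individualizes s α)
    (ha : a.Nodup) {l : List (HF α)} (hl : Run step choice l) :
    ∃ r, Chain s a r.reverse ∧ (a ++ r.reverse).Nodup ∧ (l = segs a.length r ∨
      ((a ++ r.reverse).length = Nat.card α ∧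
        l = seg a.length r.reverse :: segs a.length r)) := by
  induction hl with
  | root => exact ⟨[], trivial, by simpa using ha, Or.inl rfl⟩
  | @next b l Y e d _ hb hY he hd ih =>
    obtain ⟨r, hr, hn, h1 | ⟨hf, h1⟩⟩ := ih
    · obtain ⟨rfl, -⟩ := eq_of_cons_eq_segs h1
      by_cases hf : (a ++ r.reverse).length = Nat.card α
      · rw [h.step_full _ _ hf] at hd
        cases hd
        exact ⟨r, hr, hn, Or.inr ⟨hf, by rw [h1]⟩⟩
      · obtain ⟨v, hv, rfl⟩ := h.eq_atom hi hn hf hY he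
        rw [h.step_concat _ _ hf] at hd
        cases hd
        have hch : Chain s a (v :: r).reverse := by
          rw [List.reverse_cons]
          exact chain_concat.2 ⟨hr, hv⟩
        refine ⟨v :: r, hch, hi.nodup_chain ha hch ?_, Or.inl ?_⟩
        · have := lt_of_le_of_ne (length_le_card hn) hf
          simp at this ⊢
          omega
        · rw [h1, segs, List.reverse_cons]
    · cases h1
      obtain ⟨l', h2, -⟩ := exists_segs_eq a.length r
      rw [h2] at hb
      exact absurd rfl hb

theorem Individualizing.complete_spec (h : Individualizing s a step choice)
    (hi : Individualizes s α) (ha : a.Nodup) {c : HF α} {l : List (HF α)}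
    (hl : Run step choice (c :: c :: l)) :
    ∃ r, Chain s a r.reverse ∧ (a ++ r.reverse).Nodup ∧ (a ++ r.reverse).length = Nat.card α ∧
      c = seg a.length r.reverse ∧ c :: l = segs a.length r := by
  obtain ⟨r, hr, hn, h1 | ⟨hf, h1⟩⟩ := h.run_spec hi ha hl
  · exact absurd rfl (eq_of_cons_eq_segs h1).2
  · obtain ⟨h2, h3⟩ := List.cons_eq_cons.1 h1
    exact ⟨r, hr, hn, hf, h2, h3⟩

theorem Individualizing.run_segs (h : Individualizing s a step choice) (hi : Individualizes s α)
    (ha : a.Nodup) {r : List α} (hr : Chain s a r.reverse)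
    (hl : (a ++ r.reverse).length ≤ Nat.card α) : Run step choice (segs a.length r) := by
  induction r with
  | nil => exact Run.root
  | cons v r ih =>
    rw [List.reverse_cons, chain_concat] at hr
    have hl' : (a ++ r.reverse).length < Nat.card α := by
      simp at hl ⊢
      omega
    have hrun := ih hr.1 hl'.le
    have hn : (a ++ r.reverse).Nodup := hi.nodup_chain ha hr.1 (by
      rw [← List.length_append]
      exact hl'.le)
    obtain ⟨l, h1, h2⟩ := exists_segs_eq a.length r
    rw [segs, h1, List.reverse_cons]
    rw [h1] at hrun
    exact hrun.next h2 (h.choice_sel _ hn hl'.ne) (Or.inl (mem_ofSet_atoms.2 ⟨v, hr.2, rfl⟩))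
      (h.step_concat _ _ hl'.ne)

theorem Individualizing.run_complete (h : Individualizing s a step choice)
    (hi : Individualizes s α) (ha : a.Nodup) {r : List α} (hr : Chain s a r.reverse)
    (hl : (a ++ r.reverse).length = Nat.card α) :
    ∃ l, Run step choice (seg a.length r.reverse :: seg a.length r.reverse :: l) := by
  have hrun := h.run_segs hi ha hr hl.le
  obtain ⟨l, h1, h2⟩ := exists_segs_eq a.length r
  rw [h1] at hrun
  exact ⟨l, hrun.next h2 (h.choice_full _ hl) (Or.inr ⟨not_mem_empty, rfl⟩)
    (h.step_full _ _ hl)⟩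

theorem Individualizing.not_wscFails (h : Individualizing s a step choice)
    (hi : Individualizes s α) (ha : a.Nodup)
    (hQ : 3 * Nat.card α ^ 2 + 20 * Nat.card α + 10 ≤ Q) {P : Set (HF α)}
    (hP : ∀ p ∈ P, ∀ ψ : α ≃[τ] α, a.map ψ = a → HF.map ψ p = p)
    {wit : HF α → HF α → Option (HF α)}
    (hw : ∀ C c, (a ++ C).Nodup → (a ++ C).length = Nat.card α → (a ++ c).Nodup →
      ∃ M, wit (seg a.length C) (seg a.length c) = some M ∧
        (∀ m, m ∈ M → ∃ ψ : α ≃[τ] α, (a ++ c).map ψ = a ++ c ∧ m = HF.graph ψ) ∧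
        ((a ++ c).length ≠ Nat.card α → ∀ u ∈ Sel s (a ++ c), ∀ v ∈ Sel s (a ++ c),
          ∃ ψ : α ≃[τ] α, (a ++ c).map ψ = a ++ c ∧ ψ u = v ∧ HF.graph ψ ∈ M)) :
    ¬ WscFails τ Q P step choice wit := by
  rintro (⟨b, l, hl, hb, hfail⟩ | ⟨l, hl, hfail⟩ | ⟨c, l, hl, hfail⟩)
  · obtain ⟨r, hr, hn, h1 | ⟨hf, h1⟩⟩ := h.run_spec hi ha hl
    · obtain ⟨rfl, -⟩ := eq_of_cons_eq_segs h1
      by_cases hf : (a ++ r.reverse).length = Nat.card α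
      · rcases hfail with hfail | ⟨Y, e, -, -, hfail⟩
        · rw [h.choice_full _ hf] at hfail
          cases hfail
        · rw [h.step_full _ _ hf] at hfail
          cases hfail
      · rcases hfail with hfail | ⟨Y, e, hY, he, hfail⟩
        · rw [h.choice_sel _ hn hf] at hfail
          cases hfail
        · obtain ⟨v, -, rfl⟩ := h.eq_atom hi hn hf hY he
          rw [h.step_concat _ _ hf] at hfail
          cases hfail
    · cases h1
      obtain ⟨l', h2, -⟩ := exists_segs_eq a.length r
      rw [h2] at hb
      exact absurd rfl hb
  · obtain ⟨r, hr, hn, h1⟩ := h.run_spec hi ha hl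
    have hle := length_le_card hn
    rw [List.length_append, List.length_reverse] at hle
    have hlen : l.length ≤ r.length + 2 := by
      rcases h1 with rfl | ⟨-, rfl⟩ <;> simp [length_segs]
    have hmem : ∀ b ∈ l, ∃ r', r' <:+ r ∧ b = seg a.length r'.reverse := by
      intro b hb
      rcases h1 with rfl | ⟨-, rfl⟩
      · exact mem_segs hb
      · rcases List.mem_cons.1 hb with rfl | hb
        · exact ⟨r, List.suffix_rfl, rfl⟩
        · exact mem_segs hb
    rcases hfail with hfail | ⟨b, hb, hfail⟩
    · nlinarith
    · obtain ⟨r', hr', rfl⟩ := hmem b hb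
      refine hfail ?_
      rw [HF.small_iff]
      have h2 := ncard_tc_seg a.length r'.reverse
      have h3 := hr'.length_le
      rw [List.length_reverse] at h2
      have h4 : r'.length * (3 * (a.length + r'.length) + 20) ≤
        Nat.card α * (3 * Nat.card α + 20) := Nat.mul_le_mul (by omega) (by omega)
      nlinarith
  · obtain ⟨r, hr, hn, hf, rfl, h1⟩ := h.complete_spec hi ha hl
    refine hfail fun b l' hbl => ?_
    rw [h1] at hbl
    obtain ⟨r', hr', h2⟩ := suffix_segs hbl
    obtain ⟨rfl, -⟩ := eq_of_cons_eq_segs h2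
    have hle := length_le_card hn
    have hlen := hr'.length_le
    rw [List.length_append, List.length_reverse] at hle
    have hn' : (a ++ r'.reverse).Nodup := hi.nodup_chain ha (chain_of_suffix hr' hr) (by
      rw [List.length_reverse]
      omega)
    obtain ⟨M, hM, h3, h4⟩ := hw _ r'.reverse hn hf hn'
    have hstab : ∀ ψ : α ≃[τ] α, (a ++ r'.reverse).map ψ = a ++ r'.reverse →
        ψ ∈ HF.stab τ (P ∪ {x | x ∈ seg a.length r'.reverse :: l'}) := by
      intro ψ hψ
      rw [List.map_append] at hψ
      obtain ⟨h5, h6⟩ := List.append_inj hψ (by simp)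
      rintro p (hp | hp)
      · exact hP p hp ψ h5
      · rw [h2] at hp
        obtain ⟨r'', ⟨q, rfl⟩, rfl⟩ := mem_segs hp
        rw [List.reverse_append, List.map_append] at h6
        rw [map_seg, (List.append_inj h6 (by simp)).1]
    by_cases hf' : (a ++ r'.reverse).length = Nat.card α
    · refine ⟨M, ∅, hM, h.choice_full _ hf', fun m hm => ?_, fun b hb => absurd hb (not_mem_empty b)⟩
      obtain ⟨ψ, h5, h6⟩ := h3 m hm
      exact ⟨ψ, hstab ψ h5, h6⟩
    · refine ⟨M, _, hM, h.choice_sel _ hn' hf', fun m hm => ?_, fun b hb c hc => ?_⟩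
      · obtain ⟨ψ, h5, h6⟩ := h3 m hm
        exact ⟨ψ, hstab ψ h5, h6⟩
      · obtain ⟨u, hu, rfl⟩ := mem_ofSet_atoms.1 hb
        obtain ⟨v, hv, rfl⟩ := mem_ofSet_atoms.1 hc
        obtain ⟨ψ, h5, h6, h7⟩ := h4 hf' u hu v hv
        exact ⟨ψ, hstab ψ h5, h7, by rw [map_atom, h6]⟩

end Runs

theorem eval_lookup {x v : ℕ} (hv1 : v ≠ x + 1) (hv2 : v ≠ x + 2) {a C : List α} {j : ℕ} {w : α}
    (h0 : ρ 0 = seg 0 a) (hx : ρ x = seg a.length C)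
    (hl : (a ++ C).length = Nat.card α) (hv : ρ v = HF.kpair (ofNat a.length) (ofNat j))
    (hw : (a ++ C)[j]? = some w) :
    (Term.lookup x v : Term τ).eval Q ρ = some (atom w) := by
  have hev : (Term.lookup x v : Term τ).eval Q ρ = some (HF.unique (ofSet {d | ∃ b,
      b ∈ ofSet (Set.range (atom : α → HF α)) ∧ (∃ i, i ∈ (ofNat (Nat.card α) : HF α) ∧
        (HF.kpair (ofNat a.length) (ofNat j) = HF.kpair (ofNat a.length) i ∧
          HF.kpair i b ∈ seg 0 (a ++ C))) ∧ b = d})) := by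
    refine eval_unique (eval_compr (f := fun b => b) rfl (fun b _ => ?_) (fun b _ _ => by simp))
    refine eval_ex (eval_card_atoms _) fun i _ => eval_and ?_ ?_
    · refine (eval_eq (eval_var _) (eval_kpair (eval_card (eval_var _)) (eval_var _))).trans ?_
      simp [hv1, hv2, hv, h0, card_seg]
    · refine (eval_mem (eval_kpair rfl rfl) (eval_tup (a := a) (c := C) ?_ ?_)).trans ?_
      · simp [h0]
      · simp [hx]
      · simp
  rw [hev]
  congr 1
  refine unique_eq (isSet_ofSet _) fun z => ?_
  rw [mem_ofSet (finite_image_set _ _ _)]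
  constructor
  · rintro ⟨b, hb, ⟨i, hi, h1, h2⟩, rfl⟩
    obtain ⟨u, rfl⟩ := mem_atoms.1 hb
    rw [← (kpair_inj.1 h1).2, kpair_mem_seg, hw] at h2
    cases h2
    rfl
  · rintro rfl
    refine ⟨_, mem_atoms.2 ⟨w, rfl⟩, ⟨ofNat j, ?_, rfl, kpair_mem_seg.2 hw⟩, rfl⟩
    rw [ofNat_mem_ofNat, ← hl]
    exact (List.getElem?_eq_some_iff.1 hw).1

theorem individualizing_terms (hs : SelectsLike s' s Q α) {x : ℕ} (hx0 : x ≠ 0) {a : List α}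
    (h0 : ρ 0 = seg 0 a) : Individualizing s a
      (fun b e => (Term.individualize x : Term τ).eval Q
        (Function.update (Function.update ρ x b) (x + 1) e))
      (fun b => (Term.select s' x).eval Q (Function.update ρ x b)) where
  step_full c e hl := eval_individualize_of_full (by simp [h0, hx0.symm]) (by simp) hl
  step_concat c v hl := eval_individualize (by simp [h0, hx0.symm]) (by simp) (by simp) hl
  choice_full c hl := eval_select_of_full (by simp [h0, hx0.symm]) (by simp) hl
  choice_sel c hn hl := eval_select hs (by simp [h0, hx0.symm]) (by simp) hn hl

/-- The formula `canonRel` defines the relation `R` on the positions of a complete chain. -/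
theorem eval_canonRel (hs : SelectsLike s' s Q α) (hi : Individualizes s α)
    (hfv : s'.fv ⊆ {0}) (hQ : 3 * Nat.card α ^ 2 + 20 * Nat.card α + 10 ≤ Q) {n : ℕ}
    (R : τ.Relations n) {a C : List α} (ha : a.Nodup) (h0 : ρ 0 = seg 0 a) {j : Fin n → ℕ}
    (hj : ∀ i : Fin n, ρ (i + 1) = HF.kpair (ofNat a.length) (ofNat (j i))) (hC : Chain s a C)
    (hl : (a ++ C).length = Nat.card α) {u : Fin n → α} (hu : ∀ i, (a ++ C)[j i]? = some (u i)) :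
    (Formula.canonRel s' R).eval Q ρ = some (Language.Structure.RelMap R u) := by
  have hind := individualizing_terms (ρ := ρ) hs (x := n + 1) (by omega) h0
  have hout : ∀ r : List α, Chain s a r.reverse → (a ++ r.reverse).Nodup →
      (a ++ r.reverse).length = Nat.card α →
      (Formula.rel R fun i => Term.lookup (n + 1) (i + 1) : Formula τ).eval Q
        (Function.update ρ (n + 1) (seg a.length r.reverse)) =
          some (Language.Structure.RelMap R u) := by
    intro r hr hn hf
    have hrefl : a.map (Language.Equiv.refl τ α) = a := List.map_id a
    obtain ⟨ψ, hψ⟩ := exists_equiv_of_chain hi (Language.Equiv.refl τ α) hC (e := r.reverse)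
      (by rwa [hrefl]) (by rwa [hrefl]) (by simp at hf hl ⊢; omega)
    rw [hrefl] at hψ
    have hlook : ∀ i : Fin n, (Term.lookup (n + 1) (i + 1) : Term τ).eval Q
        (Function.update ρ (n + 1) (seg a.length r.reverse)) = some (atom (ψ (u i))) := by
      intro i
      have hi' := i.2
      refine eval_lookup (a := a) (C := r.reverse) (j := j i) (by omega) (by omega) (by simp [h0])
        (by simp) hf ?_ ?_
      · rw [Function.update_of_ne (by omega), hj]
      · have := congrArg (fun l => l[j i]?) hψ
        simp only [List.getElem?_map, hu] at this
        simpa using this.symm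
    rw [Formula.eval, relEval, if_neg (by simp [hlook])]
    congr 1
    refine propext ⟨?_, fun h => ⟨fun i => ψ (u i), hlook, ?_⟩⟩
    · rintro ⟨w, h1, h2⟩
      have : w = ψ ∘ u := funext fun i => by
        have := h1 i
        rw [hlook i, Option.some.injEq] at this
        exact (atom_injective this).symm
      rw [this] at h2
      exact (ψ.map_rel R u).1 h2
    · exact (ψ.map_rel R u).2 h
  have hP : ∀ p ∈ {p | ∃ z ∈ (Formula.canonRel s' R).fv, p = ρ z}, ∀ ψ : α ≃[τ] α,
      a.map ψ = a → HF.map ψ p = p := by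
    rintro p ⟨z, hz, rfl⟩ ψ hψ
    have hzn : z ≤ n := fv_canonRel hfv R hz
    rcases z with _ | z
    · rw [h0, map_seg, hψ]
    · rw [hj ⟨z, hzn⟩]
      simp
  have hnf := hind.not_wscFails hi ha hQ hP
    (wit := fun c b => (Term.witness s' (n + 1)).eval Q
      (Function.update (Function.update ρ (n + 1) c) (n + 2) b))
    (fun C c hn hl hnc => eval_witness hs hi hQ (by simp [h0]) (by simp) hn hl
      (by simp) hnc)
  obtain ⟨l, hrun⟩ := hind.run_complete hi ha (r := C.reverse) (by simpa using hC)
    (by simpa using hl)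
  rw [Formula.canonRel, Formula.eval, wscEval, if_neg]
  · congr 1
    refine propext ⟨fun h => ?_, fun h c l hcl => ?_⟩
    · obtain ⟨p, h1, h2⟩ := h _ _ hrun
      rw [hout C.reverse (by simpa using hC) (by
        simpa using hi.nodup_chain ha hC (by rw [← hl, List.length_append])) (by simpa using hl)] at h1
      cases h1
      exact h2
    · obtain ⟨r, hr, hn, hf, rfl, -⟩ := hind.complete_spec hi ha hcl
      exact ⟨_, hout r hr hn hf, h⟩
  · rintro (h | ⟨c, l, hcl, h⟩)
    · exact hnf h
    · obtain ⟨r, hr, hn, hf, rfl, -⟩ := hind.complete_spec hi ha hcl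
      rw [hout r hr hn hf] at h
      cases h

end BGS

/-! ## The canonization -/

instance FinStr.finite_carrier {σ : Language} {V : Type*} (𝔄 : FinStr σ V) :
    Finite 𝔄.carrier := 𝔄.finite.to_subtype

namespace HF

/-- The `i`-th element of the canonical form for a parameter tuple of length `k`. -/
noncomputable def code {α : Type*} (k i : ℕ) : HF α := kpair (ofNat k) (ofNat i)

theorem code_inj {α : Type*} {k i k' i' : ℕ} :
    (code k i : HF α) = code k' i' ↔ k = k' ∧ i = i' := by
  rw [code, code, kpair_inj, ofNat_inj, ofNat_inj]

@[simp]
theorem map_code {α β : Type*} (f : α → β) (k i : ℕ) : map f (code k i) = code k i := by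
  simp [code]

end HF

namespace BGS

open HF

variable {τ : Language}

/-- The universe of the canonical form. -/
def Term.canonUniv : Term τ := .compr (.kpair (.card (.var 0)) (.var 1)) 1 (.card .atoms) .tt

/-- The order of the canonical form. -/
def Formula.canonLe : Formula τ :=
  .ex 3 (.card .atoms) (.and (.eq (.var 2) (.kpair (.card (.var 0)) (.var 3)))
    (.ex 4 (.succ (.var 3)) (.eq (.var 1) (.kpair (.card (.var 0)) (.var 4)))))

theorem fv_canonUniv : (Term.canonUniv : Term τ).fv ⊆ {0} := by
  intro z hz
  simp [Term.canonUniv, Term.fv] at hz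
  simp
  omega

theorem fv_canonLe : (Formula.canonLe : Formula τ).fv ⊆ {i | i ≤ 2} := by
  intro z hz
  simp [Formula.canonLe, Term.fv, Formula.fv] at hz
  show z ≤ 2
  omega

variable {α : Type} [τ.Structure α] [Finite α] {Q : ℕ} {ρ : ℕ → HF α} {a : List α}

theorem eval_canonUniv (h0 : ρ 0 = seg 0 a) : ∃ B, (Term.canonUniv : Term τ).eval Q ρ = some B ∧
    ∀ x, x ∈ B ↔ ∃ i < Nat.card α, x = code a.length i := by
  refine ⟨_, eval_compr (P := fun _ => True) (f := fun b => HF.kpair (ofNat a.length) b)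
    (eval_card_atoms _) (fun b _ => eval_tt) (fun b _ _ => ?_), fun x => ?_⟩
  · refine (eval_kpair (eval_card (eval_var _)) (eval_var _)).trans ?_
    simp [h0, card_seg]
  · rw [mem_ofSet (finite_image_set _ _ _)]
    constructor
    · rintro ⟨b, hb, -, rfl⟩
      obtain ⟨i, hi, rfl⟩ := mem_ofNat.1 hb
      exact ⟨i, hi, rfl⟩
    · rintro ⟨i, hi, rfl⟩
      exact ⟨ofNat i, by simpa using hi, trivial, rfl⟩

theorem eval_canonLe (h0 : ρ 0 = seg 0 a) {i j : ℕ} (h1 : ρ 1 = code a.length i)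
    (h2 : ρ 2 = code a.length j) (hj : j < Nat.card α) :
    (Formula.canonLe : Formula τ).eval Q ρ = some (i ≤ j) := by
  have hev : (Formula.canonLe : Formula τ).eval Q ρ = some (∃ y, y ∈ (ofNat (Nat.card α) : HF α) ∧
      (code a.length j = HF.kpair (ofNat a.length) y ∧ ∃ z, z ∈ HF.succ y ∧
        code a.length i = HF.kpair (ofNat a.length) z)) := by
    refine eval_ex (eval_card_atoms _) fun y _ => eval_and ?_ (eval_ex (a := HF.succ y) ?_
      fun z _ => ?_)
    · refine (eval_eq (eval_var _) (eval_kpair (eval_card (eval_var _)) (eval_var _))).trans ?_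
      simp [h0, h2, card_seg]
    · rw [eval_succ (eval_var _)]
      simp
    · refine (eval_eq (eval_var _) (eval_kpair (eval_card (eval_var _)) (eval_var _))).trans ?_
      simp [h0, h1, card_seg]
  rw [hev]
  congr 1
  refine propext ⟨?_, fun hij => ⟨ofNat j, by simpa using hj, rfl, ofNat i, ?_, rfl⟩⟩
  · rintro ⟨y, -, h3, z, hz, h4⟩
    rw [← (kpair_inj.1 h3).2, ← (kpair_inj.1 h4).2, succ_ofNat, ofNat_mem_ofNat] at hz
    exact Nat.lt_succ_iff.1 hz
  · rw [succ_ofNat, ofNat_mem_ofNat]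
    exact Nat.lt_succ_iff.2 hij

end BGS

namespace CPTWSC

open HF BGS

variable {τ : Language} {U : Type}

/-- The interpretation defining the canonization. -/
noncomputable def canonization (s : BGS.Term τ) (hs : s.fv ⊆ {0}) (q : Polynomial ℕ) :
    Interpretation τ (τ.sum Language.order) where
  univ := ⟨.canonUniv, q⟩
  univ_fv := fv_canonUniv
  rel _ R := ⟨R.elim (fun R => .canonRel s R) fun _ => .canonLe, q⟩
  rel_fv n R := by
    match n, R with
    | _, .inl R => exact fv_canonRel hs R
    | _, .inr .le => exact fv_canonLe

theorem valuation_zero {α : Type} (x : HF α) (l : List (HF α)) : valuation (x :: l) 0 = x := rfl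

theorem valuation_ofFn {α : Type} (x : HF α) {n : ℕ} (v : Fin n → HF α) (i : Fin n) :
    valuation (x :: List.ofFn v) (i + 1) = v i := by
  simp [valuation]

variable [τ.IsRelational]

theorem individualizes_of_isOrbit {𝔄 : FinStr τ U} {s : Term τ}
    (h : ∀ a : List 𝔄.carrier, a.Nodup → ∃ O : Set 𝔄.carrier, 𝔄.IsOrbit a O ∧
      s.eval (valuation [HF.ofTuple a]) = some (HF.ofSet (HF.atom '' O)) ∧
      ((∃ O', 𝔄.IsOrbit a O' ∧ Disjoint O' {x | x ∈ a}) → Disjoint O {x | x ∈ a})) :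
    Individualizes s 𝔄.carrier := by
  have hsel : ∀ a : List 𝔄.carrier, a.Nodup → 𝔄.IsOrbit a (Sel s a) ∧
      s.eval (valuation [HF.ofTuple a]) = some (HF.ofSet (HF.atom '' Sel s a)) ∧
      ((∃ O', 𝔄.IsOrbit a O' ∧ Disjoint O' {x | x ∈ a}) → Disjoint (Sel s a) {x | x ∈ a}) := by
    intro a ha
    obtain ⟨O, h1, h2, h3⟩ := h a ha
    have : Sel s a = O := by
      ext v
      constructor
      · rintro ⟨X, hX, hv⟩
        rw [h2] at hX
        cases hX
        obtain ⟨w, hw, hvw⟩ := mem_ofSet_atoms.1 hv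
        rwa [atom_injective hvw]
      · exact fun hv => ⟨_, h2, mem_ofSet_atoms.2 ⟨v, hv, rfl⟩⟩
    rw [this]
    exact ⟨h1, h2, h3⟩
  refine ⟨fun t ht => (hsel t ht).2.1, fun t ht u hu v hv => ?_, fun t ht hx => ?_⟩
  · obtain ⟨w, hw⟩ := (hsel t ht).1
    rw [hw] at hu hv
    obtain ⟨φ, hφ, rfl⟩ := hu
    obtain ⟨ψ, hψ, rfl⟩ := hv
    refine ⟨ψ.comp φ.symm, ?_, by simp⟩
    refine (List.map_congr_left fun x hx => ?_).trans (List.map_id t)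
    have : φ.symm x = x := by
      conv_lhs => rw [← hφ x hx]
      simp
    simp [this, hψ x hx]
  · obtain ⟨w, hw⟩ := (hsel t ht).1
    refine ⟨⟨w, ?_⟩, fun v hv hvt => ?_⟩
    · rw [hw]
      exact ⟨Language.Equiv.refl τ _, fun _ _ => rfl, rfl⟩
    · obtain ⟨x, hx⟩ := hx
      refine Set.disjoint_left.1 ((hsel t ht).2.2 ⟨_, ⟨x, rfl⟩, ?_⟩) hv hvt
      refine Set.disjoint_left.2 ?_
      rintro y ⟨φ, hφ, rfl⟩ hy
      exact hx (by rwa [← φ.injective (hφ _ hy)])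

/-- The hypotheses under which `canonization s' _ q` is a canonization. -/
structure Canonizes (s' : BGS.Term τ) (s : Term τ) (q : Polynomial ℕ) (𝔄 : FinStr τ U) :
    Prop where
  individualizes : Individualizes s 𝔄.carrier
  selectsLike : SelectsLike s' s (q.eval (Nat.card 𝔄.carrier)) 𝔄.carrier
  bound : 3 * Nat.card 𝔄.carrier ^ 2 + 20 * Nat.card 𝔄.carrier + 10 ≤
    q.eval (Nat.card 𝔄.carrier)

variable {s' : BGS.Term τ} {s : Term τ} {q : Polynomial ℕ} (hfv : s'.fv ⊆ {0})
  {𝔄 𝔅 : FinStr τ U} {a : List 𝔄.carrier} {b : List 𝔅.carrier}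

theorem mem_domain {x : HF 𝔄.carrier} : x ∈ (canonization s' hfv q).domain 𝔄 a ↔
    ∃ i < Nat.card 𝔄.carrier, x = code a.length i := by
  obtain ⟨B, h1, h2⟩ := eval_canonUniv (τ := τ) (Q := q.eval (Nat.card 𝔄.carrier))
    (ρ := valuation [ofTuple a]) (ofTuple_eq_seg a)
  rw [← h2]
  constructor
  · rintro ⟨B', h3, h4⟩
    cases h1.symm.trans h3
    exact h4
  · exact fun h => ⟨B, h1, h⟩

theorem mem_carrier {x : HF U} : x ∈ ((canonization s' hfv q).apply 𝔄 a).carrier ↔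
    ∃ i < Nat.card 𝔄.carrier, x = code a.length i := by
  constructor
  · rintro ⟨y, hy, rfl⟩
    obtain ⟨i, hi, rfl⟩ := (mem_domain hfv).1 hy
    exact ⟨i, hi, by simp⟩
  · rintro ⟨i, hi, rfl⟩
    exact ⟨_, (mem_domain hfv).2 ⟨i, hi, rfl⟩, by simp⟩

theorem eval_canonization_inl (h : Canonizes s' s q 𝔄) (ha : a.Nodup) {C : List 𝔄.carrier}
    (hC : Chain s a C) (hl : (a ++ C).length = Nat.card 𝔄.carrier) {n : ℕ} (R : τ.Relations n)
    {j : Fin n → ℕ} {u : Fin n → 𝔄.carrier} (hu : ∀ i, (a ++ C)[j i]? = some (u i)) :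
    ((canonization s' hfv q).rel n (Sum.inl R)).eval
      (valuation (ofTuple a :: List.ofFn fun i => code a.length (j i))) =
        some (Language.Structure.RelMap R u) :=
  eval_canonRel h.selectsLike h.individualizes hfv h.bound R ha
    (by rw [valuation_zero, ofTuple_eq_seg]) (fun i => valuation_ofFn _ _ i) hC hl hu

theorem eval_canonization_inr (R : Language.order.Relations 2) {j : Fin 2 → ℕ}
    (hj : j 1 < Nat.card 𝔄.carrier) :
    ((canonization s' hfv q).rel 2 (Sum.inr R)).eval
      (valuation (ofTuple a :: List.ofFn fun i => (code a.length (j i) : HF 𝔄.carrier))) =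
        some (j 0 ≤ j 1) :=
  eval_canonLe (a := a) (by rw [valuation_zero, ofTuple_eq_seg]) (valuation_ofFn _ _ (0 : Fin 2))
    (valuation_ofFn _ _ (1 : Fin 2)) hj

theorem exists_positions {n : ℕ} {v : Fin n → HF 𝔄.carrier}
    (hv : ∀ i, v i ∈ (canonization s' hfv q).domain 𝔄 a) :
    ∃ j : Fin n → ℕ, (∀ i, j i < Nat.card 𝔄.carrier) ∧ v = fun i => code a.length (j i) := by
  choose j hj hvj using fun i => (mem_domain hfv).1 (hv i)
  exact ⟨j, hj, funext hvj⟩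

theorem mem_rel_inl (h : Canonizes s' s q 𝔄) (ha : a.Nodup) {C : List 𝔄.carrier}
    (hC : Chain s a C) (hl : (a ++ C).length = Nat.card 𝔄.carrier) {n : ℕ} (R : τ.Relations n)
    {w : Fin n → HF U} : w ∈ ((canonization s' hfv q).apply 𝔄 a).rel n (Sum.inl R) ↔
      ∃ (j : Fin n → ℕ) (u : Fin n → 𝔄.carrier), (∀ i, (a ++ C)[j i]? = some (u i)) ∧
        Language.Structure.RelMap R u ∧ w = fun i => code a.length (j i) := by
  constructor
  · rintro ⟨v, hv, ⟨p, hp, hp'⟩, rfl⟩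
    obtain ⟨j, hj, rfl⟩ := exists_positions hfv hv
    have hu : ∀ i, (a ++ C)[j i]? = some ((a ++ C)[j i]'(by rw [hl]; exact hj i)) := fun i =>
      List.getElem?_eq_getElem _
    rw [eval_canonization_inl hfv h ha hC hl R hu] at hp
    cases hp
    exact ⟨j, _, hu, hp', by simp⟩
  · rintro ⟨j, u, hu, hR, rfl⟩
    refine ⟨fun i => code a.length (j i), fun i => (mem_domain hfv).2 ⟨j i, ?_, rfl⟩,
      ⟨_, eval_canonization_inl hfv h ha hC hl R hu, hR⟩, by simp⟩
    rw [← hl]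
    exact (List.getElem?_eq_some_iff.1 (hu i)).1

theorem mem_rel_inr (R : Language.order.Relations 2) {w : Fin 2 → HF U} :
    w ∈ ((canonization s' hfv q).apply 𝔄 a).rel 2 (Sum.inr R) ↔
      ∃ j : Fin 2 → ℕ, (∀ i, j i < Nat.card 𝔄.carrier) ∧ j 0 ≤ j 1 ∧
        w = fun i => code a.length (j i) := by
  constructor
  · rintro ⟨v, hv, ⟨p, hp, hp'⟩, rfl⟩
    obtain ⟨j, hj, rfl⟩ := exists_positions hfv hv
    rw [eval_canonization_inr hfv R (hj 1)] at hp
    cases hp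
    exact ⟨j, hj, hp', by simp⟩
  · rintro ⟨j, hj, hle, rfl⟩
    exact ⟨fun i => code a.length (j i), fun i => (mem_domain hfv).2 ⟨j i, hj i, rfl⟩,
      ⟨_, eval_canonization_inr hfv R (hj 1), hle⟩, by simp⟩

theorem code_mem_rel_inr (R : Language.order.Relations 2) {i j : ℕ}
    (hi : i < Nat.card 𝔄.carrier) (hj : j < Nat.card 𝔄.carrier) :
    ![code a.length i, code a.length j] ∈
      ((canonization s' hfv q).apply 𝔄 a).rel 2 (Sum.inr R) ↔ i ≤ j := by
  rw [mem_rel_inr]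
  constructor
  · rintro ⟨p, -, hp, h⟩
    have h0 := congrFun h 0
    have h1 := congrFun h 1
    simp only [Matrix.cons_val_zero, Matrix.cons_val_one, code_inj, true_and] at h0 h1
    omega
  · intro hij
    refine ⟨![i, j], ?_, hij, ?_⟩
    · intro l
      fin_cases l <;> assumption
    · funext l
      fin_cases l <;> rfl

theorem defined_canonization (h : Canonizes s' s q 𝔄) (ha : a.Nodup) :
    (canonization s' hfv q).Defined 𝔄 a := by
  refine ⟨?_, fun n R v hv => ?_⟩
  · obtain ⟨B, h1, -⟩ := eval_canonUniv (τ := τ) (Q := q.eval (Nat.card 𝔄.carrier))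
      (ρ := valuation [ofTuple a]) (ofTuple_eq_seg a)
    exact fun h2 => by cases h1.symm.trans h2
  · obtain ⟨j, hj, rfl⟩ := exists_positions hfv hv
    rcases R with R | R
    · obtain ⟨C, hC, hl⟩ := h.individualizes.exists_chain ha
      rw [← List.length_append] at hl
      rw [eval_canonization_inl hfv h ha hC hl R fun i =>
        List.getElem?_eq_getElem (by rw [hl]; exact hj i)]
      simp
    · obtain ⟨⟩ := id R
      rw [eval_canonization_inr hfv R (hj 1)]
      simp

theorem isLinearOrder_canonization :
    IsLinearOrder ((canonization s' hfv q).apply 𝔄 a).carrier fun x y =>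
      Language.Structure.RelMap (Language.leSymb : (τ.sum Language.order).Relations 2)
        ![x, y] := by
  have key : ∀ x y : ((canonization s' hfv q).apply 𝔄 a).carrier,
      Language.Structure.RelMap (Language.leSymb : (τ.sum Language.order).Relations 2) ![x, y] ↔
        ![x.1, y.1] ∈ ((canonization s' hfv q).apply 𝔄 a).rel 2 (Sum.inr Language.leSymb) := by
    intro x y
    have : (fun i => ((![x, y] : Fin 2 → _) i : HF U)) = ![x.1, y.1] := by
      funext l
      fin_cases l <;> rfl
    rw [← this]
    rfl
  have hle : ∀ i j (hi : i < Nat.card 𝔄.carrier) (hj : j < Nat.card 𝔄.carrier),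
      Language.Structure.RelMap (Language.leSymb : (τ.sum Language.order).Relations 2)
        ![(⟨code a.length i, (mem_carrier hfv).2 ⟨i, hi, rfl⟩⟩ :
          ((canonization s' hfv q).apply 𝔄 a).carrier),
          ⟨code a.length j, (mem_carrier hfv).2 ⟨j, hj, rfl⟩⟩] ↔ i ≤ j := fun i j hi hj =>
    (key _ _).trans (code_mem_rel_inr hfv _ hi hj)
  have hex : ∀ x : ((canonization s' hfv q).apply 𝔄 a).carrier, ∃ i, ∃ hi : i < Nat.card 𝔄.carrier,
      x = ⟨code a.length i, (mem_carrier hfv).2 ⟨i, hi, rfl⟩⟩ := by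
    rintro ⟨x, hx⟩
    obtain ⟨i, hi, rfl⟩ := (mem_carrier hfv).1 hx
    exact ⟨i, hi, rfl⟩
  refine @IsLinearOrder.mk _ _ (@IsPartialOrder.mk _ _ (@IsPreorder.mk _ _ ⟨fun x => ?_⟩
    ⟨fun x y z hxy hyz => ?_⟩) ⟨fun x y hxy hyx => ?_⟩) ⟨fun x y => ?_⟩
  · obtain ⟨i, hi, rfl⟩ := hex x
    exact (hle i i hi hi).2 le_rfl
  · obtain ⟨i, hi, rfl⟩ := hex x
    obtain ⟨j, hj, rfl⟩ := hex y
    obtain ⟨k, hk, rfl⟩ := hex z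
    exact (hle i k hi hk).2 (((hle i j hi hj).1 hxy).trans ((hle j k hj hk).1 hyz))
  · obtain ⟨i, hi, rfl⟩ := hex x
    obtain ⟨j, hj, rfl⟩ := hex y
    obtain rfl := ((hle i j hi hj).1 hxy).antisymm ((hle j i hj hi).1 hyx)
    rfl
  · obtain ⟨i, hi, rfl⟩ := hex x
    obtain ⟨j, hj, rfl⟩ := hex y
    exact (le_total i j).imp (hle i j hi hj).2 (hle j i hj hi).2

/-- A complete chain determines an isomorphism onto the canonical form. -/
theorem exists_equiv_canonization (h : Canonizes s' s q 𝔄) (ha : a.Nodup) :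
    ∃ (C : List 𝔄.carrier) (f : 𝔄.carrier ≃[τ]
      (((canonization s' hfv q).apply 𝔄 a).reduct Language.LHom.sumInl).carrier),
      (a ++ C).Nodup ∧ (a ++ C).length = Nat.card 𝔄.carrier ∧
      ∀ i x, (a ++ C)[i]? = some x → (f x).1 = code a.length i := by
  classical
  obtain ⟨C, hC, hl⟩ := h.individualizes.exists_chain ha
  have hn := h.individualizes.nodup_chain ha hC hl.le
  rw [← List.length_append] at hl
  have hlt : ∀ x, (a ++ C).idxOf x < (a ++ C).length := fun x =>
    List.idxOf_lt_length_of_mem (mem_of_length_eq hn hl x)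
  have hget : ∀ x, (a ++ C)[(a ++ C).idxOf x]? = some x := fun x => by
    rw [List.getElem?_eq_getElem (hlt x), List.getElem_idxOf]
  have hidx : ∀ i x, (a ++ C)[i]? = some x → (a ++ C).idxOf x = i := by
    intro i x hx
    obtain ⟨hi, rfl⟩ := List.getElem?_eq_some_iff.1 hx
    exact hn.idxOf_getElem i hi
  let f : 𝔄.carrier → (((canonization s' hfv q).apply 𝔄 a).reduct Language.LHom.sumInl).carrier :=
    fun x => ⟨code a.length ((a ++ C).idxOf x), (mem_carrier hfv).2 ⟨_, hl ▸ hlt x, rfl⟩⟩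
  have hf : Function.Bijective f := by
    constructor
    · intro x y hxy
      have h1 := (code_inj.1 (congrArg Subtype.val hxy)).2
      have h2 := hget x
      rw [h1, hget y] at h2
      cases h2
      rfl
    · rintro ⟨y, hy⟩
      obtain ⟨i, hi, rfl⟩ := (mem_carrier hfv).1 hy
      rw [← hl] at hi
      exact ⟨(a ++ C)[i], Subtype.ext (congrArg (code a.length) (hn.idxOf_getElem i hi))⟩
  refine ⟨C, Language.Equiv.mk (Equiv.ofBijective f hf) (fun g => isEmptyElim g)
    fun {n} R u => ?_, hn, hl, fun i x hx => ?_⟩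
  · refine (mem_rel_inl hfv h ha hC hl R).trans ⟨?_, fun hR => ⟨fun i => (a ++ C).idxOf (u i), u,
      fun i => hget _, hR, rfl⟩⟩
    rintro ⟨j, u', hu', hR, hw⟩
    have : u = u' := funext fun i => by
      have h1 : code a.length ((a ++ C).idxOf (u i)) = code a.length (j i) := congrFun hw i
      have h2 := hu' i
      rw [← (code_inj.1 h1).2, hget] at h2
      exact Option.some.inj h2
    rwa [this]
  · exact congrArg (code a.length) (hidx i x hx)

theorem exists_equiv_initial (h : Canonizes s' s q 𝔄) (ha : a.Nodup) :
    ∃ f : 𝔄.carrier ≃[τ]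
        (((canonization s' hfv q).apply 𝔄 a).reduct Language.LHom.sumInl).carrier,
      ∀ (i : Fin a.length) (x : 𝔄.carrier), ![(f x).1, (f (a.get i)).1] ∈
        ((canonization s' hfv q).apply 𝔄 a).rel 2 Language.leSymb ↔ ∃ j ≤ i, x = a.get j := by
  obtain ⟨C, f, hn, hl, hf⟩ := exists_equiv_canonization hfv h ha
  refine ⟨f, fun i x => ?_⟩
  obtain ⟨m, hm⟩ := List.mem_iff_getElem?.1 (mem_of_length_eq hn hl x)
  have hget : ∀ i : Fin a.length, (a ++ C)[(i : ℕ)]? = some (a.get i) := fun i => by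
    rw [List.getElem?_append_left i.2]
    simp
  have hlt := fun i x (hx : (a ++ C)[i]? = some x) =>
    hl ▸ (List.getElem?_eq_some_iff.1 hx).1
  rw [hf _ _ hm, hf _ _ (hget i)]
  refine (code_mem_rel_inr hfv _ (hlt _ _ hm) (hlt _ _ (hget i))).trans ⟨fun hmi => ?_, ?_⟩
  · refine ⟨⟨m, lt_of_le_of_lt hmi i.2⟩, hmi, ?_⟩
    have := hget ⟨m, lt_of_le_of_lt hmi i.2⟩
    rw [hm] at this
    exact Option.some.inj this
  · rintro ⟨j, hj, rfl⟩
    obtain ⟨h1, h2⟩ := List.getElem?_eq_some_iff.1 hm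
    obtain ⟨h3, h4⟩ := List.getElem?_eq_some_iff.1 (hget j)
    rw [hn.getElem_inj_iff.1 (h2.trans h4.symm)]
    exact hj

theorem iso_of_equiv {σ : Language} [σ.IsRelational] {V W : Type*} {φ : τ →ᴸ σ}
    {X Y : FinStr σ V} {𝔄 𝔅 : FinStr τ W} {a : List 𝔄.carrier} {b : List 𝔅.carrier} (hXY : X = Y)
    (f : 𝔄.carrier ≃[τ] (X.reduct φ).carrier) (g : 𝔅.carrier ≃[τ] (Y.reduct φ).carrier)
    (hab : a.length = b.length)
    (h : ∀ (i : ℕ) x y, a[i]? = some x → b[i]? = some y → (f x).1 = (g y).1) : 𝔄.Iso a 𝔅 b := by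
  subst hXY
  refine ⟨g.symm.comp f, List.ext_getElem (by simpa using hab) fun i h1 h2 => ?_⟩
  rw [List.length_map] at h1
  have := Subtype.ext (h i _ _ (List.getElem?_eq_getElem h1) (List.getElem?_eq_getElem h2))
  simp [this]

theorem iso_of_apply_eq (hA : Canonizes s' s q 𝔄) (hB : Canonizes s' s q 𝔅) (ha : a.Nodup)
    (hb : b.Nodup) [Nonempty 𝔄.carrier]
    (h : (canonization s' hfv q).apply 𝔄 a = (canonization s' hfv q).apply 𝔅 b) :
    𝔄.Iso a 𝔅 b := by
  have hab : a.length = b.length := by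
    have h0 := (mem_carrier (q := q) (a := a) hfv).2 ⟨0, Nat.card_pos, rfl⟩
    rw [h, mem_carrier] at h0
    obtain ⟨i, -, hi⟩ := h0
    exact (code_inj.1 hi).1
  obtain ⟨C, f, -, -, hf⟩ := exists_equiv_canonization hfv hA ha
  obtain ⟨D, g, -, -, hg⟩ := exists_equiv_canonization hfv hB hb
  refine iso_of_equiv h f g hab fun i x y hx hy => ?_
  rw [hf i x (by rw [List.getElem?_append_left (List.getElem?_eq_some_iff.1 hx).1, hx]),
    hg i y (by rw [List.getElem?_append_left (List.getElem?_eq_some_iff.1 hy).1, hy]), hab]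

theorem apply_eq_of_iso (hA : Canonizes s' s q 𝔄) (hB : Canonizes s' s q 𝔅) (ha : a.Nodup)
    (hb : b.Nodup) (h : 𝔄.Iso a 𝔅 b) :
    (canonization s' hfv q).apply 𝔄 a = (canonization s' hfv q).apply 𝔅 b := by
  obtain ⟨φ, rfl⟩ := h
  have hcard : Nat.card 𝔄.carrier = Nat.card 𝔅.carrier := Nat.card_congr φ.toEquiv
  obtain ⟨C, hC, hl⟩ := hA.individualizes.exists_chain ha
  obtain ⟨D, hD, hl'⟩ := hB.individualizes.exists_chain hb
  obtain ⟨ψ, hψ⟩ := exists_equiv_of_chain hB.individualizes φ hC hD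
    (hB.individualizes.nodup_chain hb hD hl'.le) (by rw [List.length_map] at hl'; omega)
  rw [← List.length_append] at hl hl'
  refine FinStr.ext ?_ ?_
  · ext x
    rw [mem_carrier, mem_carrier, hcard, List.length_map]
  · funext n R
    ext w
    rcases R with R | R
    · rw [mem_rel_inl hfv hA ha hC hl, mem_rel_inl hfv hB hb hD hl', ← hψ]
      constructor
      · rintro ⟨j, u, hu, hR, rfl⟩
        exact ⟨j, ψ ∘ u, fun i => by rw [List.getElem?_map, hu]; rfl, (ψ.map_rel R u).2 hR,
          by simp⟩
      · rintro ⟨j, u, hu, hR, rfl⟩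
        refine ⟨j, ψ.symm ∘ u, fun i => ?_, (ψ.symm.map_rel R u).2 hR, by simp⟩
        have := hu i
        rw [List.getElem?_map, Option.map_eq_some_iff] at this
        obtain ⟨v, hv, hvu⟩ := this
        rw [hv, Function.comp_apply, ← hvu]
        simp
    · obtain ⟨⟩ := id R
      rw [mem_rel_inr, mem_rel_inr, hcard, List.length_map]

theorem exists_canonizes (s : Term τ) (hs : s.body.fv ⊆ {0}) :
    ∃ (s' : BGS.Term τ) (q : Polynomial ℕ), s'.fv ⊆ {0} ∧
      ∀ 𝔄 : FinStr τ U, Individualizes s 𝔄.carrier → Canonizes s' s q 𝔄 := by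
  obtain ⟨t, ht, hev⟩ := exists_polynomial_term (L := τ) s.bound
  obtain ⟨s', hs'⟩ := Term.exists_raises ht s.body
  refine ⟨s', 4 * s.bound + 3 * Polynomial.X ^ 2 + 20 * Polynomial.X + 30, by rwa [hs'.1],
    fun 𝔄 h => ⟨h, fun ρ l hl h0 => ?_, ?_⟩⟩
  · rw [hs'.2 _ (s.bound.eval (Nat.card 𝔄.carrier)) _ (fun ρ => hev _ _ ρ) (by simp; omega),
      ← h.eval_eq l hl]
    refine BGS.Term.eval_congr _ _ fun z hz => ?_
    obtain rfl : z = 0 := hs hz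
    rw [h0, valuation_zero, ofTuple_eq_seg]
  · simp
    omega

end CPTWSC

theorem mainTheorem6 {τ : FirstOrder.Language} [τ.IsRelational] [Finite (Σ n, τ.Relations n)]
    {U : Type} (K : Set (FinStr τ U)) (hK : CPTWSC.ReadyForIndividualization K) :
    CPTWSC.DefinesCanonization K := by
  obtain ⟨s, hs, h⟩ := hK
  obtain ⟨s', q, hfv, hs'⟩ := CPTWSC.exists_canonizes (U := U) s hs
  have hcan : ∀ 𝔄 ∈ K, CPTWSC.Canonizes s' s q 𝔄 := fun 𝔄 h𝔄 =>
    hs' 𝔄 (CPTWSC.individualizes_of_isOrbit (h 𝔄 h𝔄))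
  refine ⟨CPTWSC.canonization s' hfv q,
    fun 𝔄 h𝔄 a ha => CPTWSC.defined_canonization hfv (hcan 𝔄 h𝔄) ha,
    fun 𝔄 h𝔄 a ha => CPTWSC.isLinearOrder_canonization hfv,
    fun 𝔄 h𝔄 a ha => CPTWSC.exists_equiv_initial hfv (hcan 𝔄 h𝔄) ha,
    fun 𝔄 h𝔄 𝔅 h𝔅 a b ha hb => ⟨fun heq => ?_, fun hiso =>
      CPTWSC.apply_eq_of_iso hfv (hcan 𝔄 h𝔄) (hcan 𝔅 h𝔅) ha hb hiso⟩⟩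
  obtain ⟨O, ⟨u, -⟩, -⟩ := h 𝔄 h𝔄 a ha
  have : Nonempty 𝔄.carrier := ⟨u⟩
  exact CPTWSC.iso_of_apply_eq hfv (hcan 𝔄 h𝔄) (hcan 𝔅 h𝔅) ha hb heq
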